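/- **Setting.** Let $(X_1,Y_1),\dots,(X_n,Y_n)$, $n\ge 1$, be i.i.d. with law $P$ on $\mathcal X\times\mathbb R$, where $Y=f^*(X)+\varepsilon$, $f^*\in L_2(P_X)$ and $\mathbb E[\varepsilon\mid X]=0$. Let $\mathcal H$ be a separable reproducing kernel Hilbert space of real functions on $\mathcal X$ whose kernel $k$ is measurable and satisfies $k(x,x)\le\kappa$ for all $x$, where $\kappa>0$. Let $K:L_2(P_X)\to L_2(P_X)$, $Kg=\int k(\cdot,x)g(x)\,dP_X(x)$, be the kernel integral operator. *Kernel CG.* Put $K_n=\frac1n(k(X_i,X_j))_{i,j}$, $\mathbf Y=(Y_1,\dots,Y_n)^\top$, $f_\alpha=\frac1n\sum_i\alpha_i k(X_i,\cdot)$ and $\|\alpha\|_{K_n}^2=\frac1n\alpha^\top K_n\alpha$. For $m\ge0$ let $\alpha_m$ minimize $\|\mathbf Y-K_n\alpha\|_{K_n}$ over $\alpha\in\mathrm{span}\{\mathbf Y,K_n\mathbf Y,\dots,K_n^{m-1}\mathbf Y\}$, and let $f_m=f_{\alpha_m}$. **Theorem 2.** Let $r\ge\frac12$ and $\tau'>\frac32$.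 There is a constant $c(r,\tau')>0$ such that the following holds. Assume - (Bernstein) $\mathbb E[\varepsilon^p\mid X]\le\frac12\,p!\,M^p$ almost surely for all integers $p\ge2$, with $M>0$; - (SC($r$)) $f^*=K^ru$ for some $u\in L_2(P_X)$ with $\|u\|\le\kappa^{-r}\rho$; - (ID($s$)) $\mathrm{tr}\big(K(K+\lambda I)^{-1}\big)\le D^2(\kappa^{-1}\lambda)^{-s}$ for all $\lambda\in(0,\kappa]$, with $s\ge0$ and $D\ge1$. Let $0<\gamma<1$, and assume that $s\le1$ or $\frac{4D}{\sqrt n}\log\frac6\gamma\le1$. Let $\widehat m$ be the first iteration $m\ge0$ for which $$\big\|(f_m(X_1),\dots,f_m(X_n))^\top-\mathbf Y\big\|_{K_n}<\Lambda:=\tau'M\sqrt\kappa\Big(\frac{4D}{\sqrt n}\log\frac6\gamma\Big)^{\frac{2r+1}{2r+s}}.$$ Then with probability at least $1-3\gamma$, $\widehat m$ exists and $$\|f_{\widehat m}-f^*\|_{L_2(P_X)}^2\le c(r,\tau')\,(M+\rho)^2\Big(\frac{16D^2}{n}\log^2\frac6\gamma\Big)^{\frac{2r}{2r+s}}.$$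 -/

import Mathlib

open MeasureTheory ProbabilityTheory
open scoped ENNReal Matrix Nat

noncomputable section

namespace KernelCG

/-! ### Kernel conjugate gradient on a sample -/

section Sample

variable {𝒳 : Type*}

/-- The real-valued reproducing kernel `k(x, y)` of a reproducing kernel Hilbert space `H` of
real functions on `𝒳`. -/
def kern (H : Type*) [NormedAddCommGroup H] [InnerProductSpace ℝ H] [RKHS ℝ H 𝒳 ℝ]
    [CompleteSpace H] (x y : 𝒳) : ℝ :=
  RKHS.kernel H x y 1

variable {n : ℕ}

/-- The normalized kernel matrix `K_n = (k(X_i, X_j) / n)_{i,j}`. -/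
def kernelMatrix (k : 𝒳 → 𝒳 → ℝ) (x : Fin n → 𝒳) : Matrix (Fin n) (Fin n) ℝ :=
  Matrix.of fun i j => k (x i) (x j) / n

/-- The function `f_α = (1/n) ∑ i, α_i k(X_i, ·)`. -/
def kernelExpansion (k : 𝒳 → 𝒳 → ℝ) (x : Fin n → 𝒳) (α : Fin n → ℝ) (t : 𝒳) : ℝ :=
  (1 / n) * ∑ i, α i * k (x i) t

/-- The norm `‖α‖_G = √⟨α, G α⟩`, where `⟨·,·⟩` is the Euclidean scalar product of `ℝⁿ`
multiplied by `1/n`. -/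
def matNorm (G : Matrix (Fin n) (Fin n) ℝ) (α : Fin n → ℝ) : ℝ :=
  √((1 / n) * (α ⬝ᵥ (G *ᵥ α)))

/-- The Krylov space `span {y, G y, …, G^(m-1) y}`. -/
def krylov (G : Matrix (Fin n) (Fin n) ℝ) (y : Fin n → ℝ) (m : ℕ) : Submodule ℝ (Fin n → ℝ) :=
  Submodule.span ℝ ((fun j : ℕ => (G ^ j) *ᵥ y) '' Set.Iio m)

/-- `α` minimizes `‖y - G α‖_G` over the `m`-th Krylov space. -/
def IsCGSolution (G : Matrix (Fin n) (Fin n) ℝ) (y : Fin n → ℝ) (m : ℕ) (α : Fin n → ℝ) : Prop :=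
  α ∈ krylov G y m ∧
    ∀ β ∈ krylov G y m, matNorm G (y - G *ᵥ α) ≤ matNorm G (y - G *ᵥ β)

section RKHS

variable (H : Type*) [NormedAddCommGroup H] [InnerProductSpace ℝ H] [RKHS ℝ H 𝒳 ℝ]
  [CompleteSpace H]

theorem kern_eq_inner (x y : 𝒳) :
    kern H x y = inner ℝ (RKHS.kerFun H x (1 : ℝ)) (RKHS.kerFun H y (1 : ℝ)) := by
  rw [RKHS.kerFun_inner, RKHS.kerFun_apply]
  simp [kern]

theorem abs_kern_le {κ : ℝ} (hκ : ∀ x, kern H x x ≤ κ) (x y : 𝒳) : |kern H x y| ≤ κ := by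
  have h : ∀ z : 𝒳, ‖RKHS.kerFun H z (1 : ℝ)‖ ^ 2 ≤ κ := fun z => by
    rw [← real_inner_self_eq_norm_sq, ← kern_eq_inner]; exact hκ z
  rw [kern_eq_inner]
  refine (abs_real_inner_le_norm _ _).trans ?_
  nlinarith [h x, h y, sq_nonneg (‖RKHS.kerFun H x (1 : ℝ)‖ - ‖RKHS.kerFun H y (1 : ℝ)‖)]

/-- The element `(1/n) ∑ i, α_i k(X_i, ·)` of `H`, as a linear function of `α`. -/
def expansionMap (x : Fin n → 𝒳) : (Fin n → ℝ) →ₗ[ℝ] H where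
  toFun α := (1 / n : ℝ) • ∑ i, α i • RKHS.kerFun H (x i) (1 : ℝ)
  map_add' α β := by simp [add_smul, Finset.sum_add_distrib]
  map_smul' c α := by
    simp only [Pi.smul_apply, smul_eq_mul, mul_smul, RingHom.id_apply, ← Finset.smul_sum]
    rw [smul_comm]

/-- The `K_n`-norm of `α` is the `H`-norm of `f_α`. -/
theorem matNorm_kernelMatrix (x : Fin n → 𝒳) (α : Fin n → ℝ) :
    matNorm (kernelMatrix (kern H) x) α = ‖expansionMap H x α‖ := by
  have h : (1 / n : ℝ) * (α ⬝ᵥ (kernelMatrix (kern H) x *ᵥ α)) = ‖expansionMap H x α‖ ^ 2 := by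
    have hα : expansionMap H x α = (1 / n : ℝ) • ∑ i, α i • RKHS.kerFun H (x i) (1 : ℝ) := rfl
    rw [← real_inner_self_eq_norm_sq, hα]
    simp only [inner_smul_left, inner_smul_right,
      sum_inner, inner_sum, ← kern_eq_inner, dotProduct, Matrix.mulVec, kernelMatrix,
      Matrix.of_apply, Finset.mul_sum, conj_trivial]
    rw [Finset.sum_comm]
    refine Finset.sum_congr rfl fun i _ => Finset.sum_congr rfl fun j _ => ?_
    ring
  rw [matNorm, h, Real.sqrt_sq (norm_nonneg _)]

/-- A minimizer over the Krylov space exists, for the kernel matrix of any sample. -/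
theorem exists_isCGSolution (x : Fin n → 𝒳) (y : Fin n → ℝ) (m : ℕ) :
    ∃ α, IsCGSolution (kernelMatrix (kern H) x) y m α := by
  set G := kernelMatrix (kern H) x
  let W : Submodule ℝ H := (krylov G y m).map (expansionMap H x ∘ₗ Matrix.mulVecLin G)
  have hW : IsComplete (W : Set H) := W.complete_of_finiteDimensional
  obtain ⟨v, hv, hmin⟩ := W.exists_norm_eq_iInf_of_complete_subspace hW (expansionMap H x y)
  obtain ⟨α, hα, rfl⟩ := hv
  refine ⟨α, hα, fun β hβ => ?_⟩
  rw [matNorm_kernelMatrix, matNorm_kernelMatrix, map_sub, map_sub]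
  have hβW : expansionMap H x (G *ᵥ β) ∈ W := ⟨β, hβ, rfl⟩
  refine hmin.le.trans (ciInf_le (f := fun w : (W : Set H) => ‖expansionMap H x y - w‖)
    ⟨0, ?_⟩ ⟨_, hβW⟩)
  rintro _ ⟨w, rfl⟩
  exact norm_nonneg _

/-- The coefficients `α_m` of the conjugate gradient solution after `m` iterations. If `K_n` is
singular the minimizer need not be unique, but any two minimizers give the same function
`f_{α_m}` in `H`. -/
def cgCoeff (x : Fin n → 𝒳) (y : Fin n → ℝ) (m : ℕ) : Fin n → ℝ :=
  (exists_isCGSolution H x y m).choose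

/-- The conjugate gradient estimator `f_m = f_{α_m}`. -/
def cgEstimator (x : Fin n → 𝒳) (y : Fin n → ℝ) (m : ℕ) : 𝒳 → ℝ :=
  kernelExpansion (kern H) x (cgCoeff H x y m)

/-- `m` is the first iteration at which the residual
`‖(f_m(X_1), …, f_m(X_n)) - Y‖_{K_n}` is smaller than the threshold `Λ`. -/
def IsDiscrepancyStop (x : Fin n → 𝒳) (y : Fin n → ℝ) (Λ : ℝ) (m : ℕ) : Prop :=
  IsLeast {m : ℕ | matNorm (kernelMatrix (kern H) x)
    ((fun i => cgEstimator H x y m (x i)) - y) < Λ} m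

end RKHS

end Sample

/-! ### Operators on a real Hilbert space -/

section Operators

variable {E : Type*} [NormedAddCommGroup E] [InnerProductSpace ℝ E] [CompleteSpace E]

/-- `f = A^r u` for a compact positive self-adjoint operator `A` and `r > 0`, by the spectral
theorem: `f = ∑ ξ, ξ^r P_ξ u`, where `P_ξ` is the orthogonal projection onto the eigenspace
`ker (A - ξ)` (which is zero if `ξ` is not an eigenvalue). -/
def IsOperatorPow (A : E →L[ℝ] E) (r : ℝ) (u f : E) : Prop :=
  HasSum (fun ξ : ℝ => ξ ^ r • (A - ξ • (1 : E →L[ℝ] E)).ker.starProjection u) f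

/-- The trace of a positive operator, as the supremum of `∑ ⟨e, A e⟩` over finite orthonormal
families. For positive `A` this is the sum of `⟨e, A e⟩` over any orthonormal basis. -/
def posTrace (A : E →L[ℝ] E) : ℝ≥0∞ :=
  ⨆ (s : Finset E) (_ : Orthonormal ℝ ((↑) : s → E)), ∑ e ∈ s, ENNReal.ofReal (inner ℝ e (A e))

/-- The effective dimension `tr (A (A + λ I)⁻¹)`. -/
def effDim (A : E →L[ℝ] E) (lam : ℝ) : ℝ≥0∞ :=
  posTrace (A * Ring.inverse (A + lam • (1 : E →L[ℝ] E)))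

end Operators

/-! ### The learning problem -/

section Learning

variable {𝒳 : Type*} [MeasurableSpace 𝒳]

/-- A kernel that is jointly measurable and bounded. -/
def IsBoundedMeasurableKernel (k : 𝒳 → 𝒳 → ℝ) : Prop :=
  Measurable (Function.uncurry k) ∧ ∃ C : ℝ, ∀ x y, |k x y| ≤ C

variable {ν : Measure 𝒳} [IsProbabilityMeasure ν] {k : 𝒳 → 𝒳 → ℝ}

theorem integrable_kernel_mul (hk : IsBoundedMeasurableKernel k) (g : Lp ℝ 2 ν) (x : 𝒳) :
    Integrable (fun y => k x y * g y) ν := by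
  obtain ⟨hm, C, hC⟩ := hk
  refine ((Lp.memLp g).integrable one_le_two).bdd_mul (c := C) ?_ ?_
  · exact (hm.comp measurable_prodMk_left).aestronglyMeasurable
  · exact Filter.Eventually.of_forall fun y => hC x y

theorem abs_integral_kernel_mul_le {C : ℝ}
    (hC : ∀ x y, |k x y| ≤ C) (g : Lp ℝ 2 ν) (x : 𝒳) :
    |∫ y, k x y * g y ∂ν| ≤ C * ‖g‖ := by
  have hC0 : 0 ≤ C := (abs_nonneg _).trans (hC x x)
  have hg : Integrable g ν := (Lp.memLp g).integrable one_le_two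
  have h1 : ∫ y, ‖g y‖ ∂ν ≤ ‖g‖ := by
    rw [integral_norm_eq_lintegral_enorm hg.1, ← eLpNorm_one_eq_lintegral_enorm, Lp.norm_def]
    exact ENNReal.toReal_mono (Lp.eLpNorm_ne_top g)
      (eLpNorm_le_eLpNorm_of_exponent_le one_le_two hg.1)
  calc |∫ y, k x y * g y ∂ν| ≤ ∫ y, C * ‖g y‖ ∂ν := by
        rw [← Real.norm_eq_abs]
        refine norm_integral_le_of_norm_le (hg.norm.const_mul C) (.of_forall fun y => ?_)
        rw [norm_mul]
        exact mul_le_mul_of_nonneg_right (hC x y) (norm_nonneg _)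
    _ = C * ∫ y, ‖g y‖ ∂ν := integral_const_mul _ _
    _ ≤ C * ‖g‖ := mul_le_mul_of_nonneg_left h1 hC0

theorem memLp_integral_kernel_mul (hk : IsBoundedMeasurableKernel k) (g : Lp ℝ 2 ν) :
    MemLp (fun x => ∫ y, k x y * g y ∂ν) 2 ν := by
  obtain ⟨hm, C, hC⟩ := hk
  refine MemLp.of_bound ?_ (C * ‖g‖) (Filter.Eventually.of_forall fun x => ?_)
  · have hg : StronglyMeasurable (g : 𝒳 → ℝ) := Lp.stronglyMeasurable g
    exact (StronglyMeasurable.integral_prod_right' (ν := ν)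
      (f := fun z : 𝒳 × 𝒳 => k z.1 z.2 * g z.2)
      (hm.stronglyMeasurable.mul (hg.comp_measurable measurable_snd))).aestronglyMeasurable
  · exact abs_integral_kernel_mul_le hC g x

variable (ν k) in
open Classical in
/-- The kernel integral operator `(K g)(x) = ∫ k(x, y) g(y) dν(y)` on `L²(ν)`, for a bounded
measurable kernel `k` (and `0` for other `k`). -/
def kernelOp : Lp ℝ 2 ν →L[ℝ] Lp ℝ 2 ν :=
  if hk : IsBoundedMeasurableKernel k then
    LinearMap.mkContinuousOfExistsBound
      { toFun := fun g => (memLp_integral_kernel_mul hk g).toLp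
        map_add' := fun g h => by
          rw [← MemLp.toLp_add, MemLp.toLp_eq_toLp_iff]
          refine .of_forall fun x => ?_
          simp only [Pi.add_apply]
          rw [← integral_add (integrable_kernel_mul hk g x) (integrable_kernel_mul hk h x)]
          refine integral_congr_ae ?_
          filter_upwards [Lp.coeFn_add g h] with y hy
          rw [hy, Pi.add_apply, mul_add]
        map_smul' := fun a g => by
          rw [RingHom.id_apply, ← MemLp.toLp_const_smul, MemLp.toLp_eq_toLp_iff]
          refine .of_forall fun x => ?_
          simp only [Pi.smul_apply, smul_eq_mul]
          rw [← integral_const_mul]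
          refine integral_congr_ae ?_
          filter_upwards [Lp.coeFn_smul a g] with y hy
          rw [hy, Pi.smul_apply, smul_eq_mul, mul_left_comm] }
      (by
        obtain ⟨hm, C, hC⟩ := id hk
        refine ⟨C, fun g => ?_⟩
        simp only [LinearMap.coe_mk, AddHom.coe_mk]
        rw [Lp.norm_toLp]
        obtain ⟨x₀⟩ : Nonempty 𝒳 := nonempty_of_isProbabilityMeasure ν
        have hC0 : 0 ≤ C := (abs_nonneg _).trans (hC x₀ x₀)
        refine ENNReal.toReal_le_of_le_ofReal (by positivity) ?_
        refine (eLpNorm_le_of_ae_bound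
          (.of_forall fun x => abs_integral_kernel_mul_le hC g x)).trans ?_
        simp)
  else 0

theorem kernelOp_ae_eq (hk : IsBoundedMeasurableKernel k) (g : Lp ℝ 2 ν) :
    kernelOp ν k g =ᵐ[ν] fun x => ∫ y, k x y * g y ∂ν := by
  rw [kernelOp, dif_pos hk]
  exact MemLp.coeFn_toLp (memLp_integral_kernel_mul hk g)

/-- The source condition: `f = K^r u` in `L²(ν)` for some `u ∈ L²(ν)` with `‖u‖ ≤ κ^(-r) ρ`. -/
def SourceCondition (ν : Measure 𝒳) [IsProbabilityMeasure ν] (k : 𝒳 → 𝒳 → ℝ) (κ r ρ : ℝ)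
    (f : 𝒳 → ℝ) : Prop :=
  ∃ u g : Lp ℝ 2 ν, ‖u‖ ≤ κ ^ (-r) * ρ ∧ IsOperatorPow (kernelOp ν k) r u g ∧ f =ᵐ[ν] g

/-- The intrinsic dimensionality condition:
`tr (K (K + λ I)⁻¹) ≤ D² (λ / κ)^(-s)` for all `λ ∈ (0, κ]`. -/
def IntrinsicDim (ν : Measure 𝒳) [IsProbabilityMeasure ν] (k : 𝒳 → 𝒳 → ℝ) (κ s D : ℝ) : Prop :=
  ∀ lam : ℝ, 0 < lam → lam ≤ κ →
    effDim (kernelOp ν k) lam ≤ ENNReal.ofReal (D ^ 2 * (κ⁻¹ * lam) ^ (-s))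

/-- `Y = f(X) + ε` with `f ∈ L²(P_X)` and `E[ε | X] = 0`, where `P` is the law of `(X, Y)`. -/
def IsRegressionFunction (P : Measure (𝒳 × ℝ)) (f : 𝒳 → ℝ) : Prop :=
  MemLp f 2 P.fst ∧ Integrable (fun z => z.2 - f z.1) P ∧
    P[fun z => z.2 - f z.1 | MeasurableSpace.comap Prod.fst inferInstance] =ᵐ[P] 0

/-- The Bernstein condition on the noise `ε = Y - f(X)`: all its moments are finite and
`E[ε^p | X] ≤ (1/2) p! M^p` almost surely for all integers `p ≥ 2`. -/
def BernsteinNoise (P : Measure (𝒳 × ℝ)) (f : 𝒳 → ℝ) (M : ℝ) : Prop :=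
  ∀ p : ℕ, 2 ≤ p → Integrable (fun z => (z.2 - f z.1) ^ p) P ∧
    P[fun z => (z.2 - f z.1) ^ p | MeasurableSpace.comap Prod.fst inferInstance]
      ≤ᵐ[P] fun _ => (1 / 2) * (p ! : ℝ) * M ^ p

end Learning

end KernelCG

end

/-! The kernel conjugate gradient iterate is `f_m = q(A) b`, where `A` is the empirical covariance
operator of the reproducing kernel Hilbert space `H`, `b` is the element `(1/n) ∑ Y_i k(X_i, ·)`,
and `q` is a polynomial of degree less than `m` such that `p = 1 - x q` minimizes the residual
`‖p(A) b‖`. The regression function has a representative `f` in `H`, since `r ≥ 1/2`, and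
`b = A f + ζ` with an empirical noise term `ζ`. The regularization level that corresponds to the
threshold is `lam = κ δ^(2/(2r+s))`, where `δ = 4 D log(6/γ) / √n`.

Deterministic part. In an eigenbasis of `A`, the residual polynomial `p` is an orthogonal
polynomial, so its roots are positive. If `p₁` arises from `p` by removing the smallest root, then
`p₁` has too low a degree to have a residual below the threshold. The extremal property of `p`
bounds the residual of `p₁` by that of an exponential filter, and, if the smallest root is small,
by the part of the data at low frequencies (`IsMinResidual.sqNorm_le_exp`,
`IsMinResidual.sqNorm_le_low`). Hence neither the inverse of the smallest root nor the sum of the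
inverses of the others can exceed a multiple of `1 / lam` (`residual_control`). So `p` is close to
`1` at frequencies below a multiple of `lam`; at the other frequencies the error is controlled by
the residual, which is below the threshold (`spectral_error_le`).

The spectral bound needs the size of spectrally localized parts of `f`. The source condition is a
statement on the population covariance `S = T* T`, where `T` is the inclusion of `H` in `L²`: it
bounds `⟨g, f⟩` by an interpolation between `‖g‖` and `‖T S^j g‖` with `j = ⌊r⌋`
(`exists_preimage_of_isOperatorPow`, `abs_inner_source_le`). The powers of `S` are replaced by
powers of `A` one factor at a time (`norm_pow_comp_adjoint_le`), which works because `S - A` is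
smaller than `lam^r`, up to constants, on the good event.

Probabilistic part. The good event bounds `ζ` and `S - A` in the energy norm
`(‖T h‖² + lam ‖h‖²)^(1/2)`. Both are sums of independent centred vectors in a Hilbert space,
the second one in a
Hilbert tensor product, and their variances are controlled by the effective dimension
(`lintegral_norm_sq_toEnergy_resolvent_le`). Bernstein's inequality in Hilbert space
(`measure_norm_sum_ge_le`) follows from the convexity of `cosh ∘ √`, which makes `E cosh ‖·‖`
submultiplicative along sums up to a correction. If `δ > 1`, then `lam ≥ κ`, and a bound on `‖ζ‖`
is sufficient. -/

set_option linter.unusedSectionVars false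

namespace KernelCG

/-! ### Minimal residual polynomials for a finite measure -/

section ResidualPolynomials

open Polynomial

variable {ι : Type*} [Fintype ι]

/-- The squared norm of the polynomial `p` in `L²` of the measure `∑ j, w j • δ_{σ j}`. -/
noncomputable def sqNorm (σ w : ι → ℝ) (p : ℝ[X]) : ℝ := ∑ j, (p.eval (σ j)) ^ 2 * w j

/-- `p` minimizes the weighted norm among the polynomials of degree at most `m` with value `1`
at `0`. -/
structure IsMinResidual (σ w : ι → ℝ) (m : ℕ) (p : ℝ[X]) : Prop where
  natDegree_le : p.natDegree ≤ m
  eval_zero : p.eval 0 = 1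
  le : ∀ q : ℝ[X], q.natDegree ≤ m → q.eval 0 = 1 → sqNorm σ w p ≤ sqNorm σ w q

/-- The polynomial `∏ r ∈ R, (1 - x / r)`. -/
noncomputable def resPoly (R : Multiset ℝ) : ℝ[X] := (R.map fun r => 1 - C r⁻¹ * X).prod

@[simp] theorem resPoly_zero : resPoly 0 = 1 := by simp [resPoly]

theorem resPoly_cons (r : ℝ) (R : Multiset ℝ) :
    resPoly (r ::ₘ R) = (1 - C r⁻¹ * X) * resPoly R := by simp [resPoly]

theorem eval_resPoly_cons (r : ℝ) (R : Multiset ℝ) (x : ℝ) :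
    (resPoly (r ::ₘ R)).eval x = (1 - x / r) * (resPoly R).eval x := by
  simp [resPoly_cons, div_eq_inv_mul]

@[simp] theorem eval_zero_resPoly (R : Multiset ℝ) : (resPoly R).eval 0 = 1 := by
  induction R using Multiset.induction_on with
  | empty => simp
  | cons r R ih => simp [eval_resPoly_cons, ih]

theorem eval_resPoly (R : Multiset ℝ) (x : ℝ) :
    (resPoly R).eval x = (R.map fun r => 1 - x / r).prod := by
  induction R using Multiset.induction_on with
  | empty => simp
  | cons r R ih => simp [eval_resPoly_cons, ih]

theorem natDegree_resPoly_le (R : Multiset ℝ) : (resPoly R).natDegree ≤ R.card := by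
  induction R using Multiset.induction_on with
  | empty => simp
  | cons r R ih =>
    rw [resPoly_cons, Multiset.card_cons, add_comm]
    refine natDegree_mul_le.trans (add_le_add ?_ ih)
    compute_degree

theorem eval_resPoly_nonneg {R : Multiset ℝ} {x a : ℝ} (hR : ∀ r ∈ R, 0 < r ∧ a ≤ r)
    (hxa : x ≤ a) : 0 ≤ (resPoly R).eval x := by
  induction R using Multiset.induction_on with
  | empty => simp
  | cons r R ih =>
    obtain ⟨h0, h1⟩ := hR r (Multiset.mem_cons_self r R)
    rw [eval_resPoly_cons]
    refine mul_nonneg ?_ (ih fun s hs => hR s (Multiset.mem_cons_of_mem hs))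
    rw [sub_nonneg, div_le_one h0]
    linarith

theorem eval_resPoly_le_exp {R : Multiset ℝ} {x a : ℝ} (hR : ∀ r ∈ R, 0 < r ∧ a ≤ r)
    (hxa : x ≤ a) : (resPoly R).eval x ≤ Real.exp (-(x * (R.map fun r => r⁻¹).sum)) := by
  induction R using Multiset.induction_on with
  | empty => simp
  | cons r R ih =>
    obtain ⟨h0, h1⟩ := hR r (Multiset.mem_cons_self r R)
    have hR' : ∀ r ∈ R, 0 < r ∧ a ≤ r := fun s hs => hR s (Multiset.mem_cons_of_mem hs)
    rw [eval_resPoly_cons, Multiset.map_cons, Multiset.sum_cons, mul_add, neg_add, Real.exp_add]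
    refine mul_le_mul ?_ (ih hR') (eval_resPoly_nonneg hR' hxa) (Real.exp_pos _).le
    have := Real.add_one_le_exp (-(x * r⁻¹))
    rw [div_eq_mul_inv]
    linarith

theorem eval_resPoly_le_one {R : Multiset ℝ} {x a : ℝ} (hR : ∀ r ∈ R, 0 < r ∧ a ≤ r)
    (hx : 0 ≤ x) (hxa : x ≤ a) : (resPoly R).eval x ≤ 1 := by
  refine (eval_resPoly_le_exp hR hxa).trans (Real.exp_le_one_iff.2 ?_)
  rw [neg_nonpos]
  refine mul_nonneg hx (Multiset.sum_nonneg ?_)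
  simp only [Multiset.mem_map, forall_exists_index, and_imp, forall_apply_eq_imp_iff₂]
  exact fun r hr => (inv_pos.2 (hR r hr).1).le

/-- Bernoulli's inequality for products. -/
theorem one_sub_le_eval_resPoly {R : Multiset ℝ} {x a : ℝ} (hR : ∀ r ∈ R, 0 < r ∧ a ≤ r)
    (hx : 0 ≤ x) (hxa : x ≤ a) : 1 - x * (R.map fun r => r⁻¹).sum ≤ (resPoly R).eval x := by
  induction R using Multiset.induction_on with
  | empty => simp
  | cons r R ih =>
    obtain ⟨h0, h1⟩ := hR r (Multiset.mem_cons_self r R)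
    have hR' : ∀ r ∈ R, 0 < r ∧ a ≤ r := fun s hs => hR s (Multiset.mem_cons_of_mem hs)
    rw [eval_resPoly_cons, Multiset.map_cons, Multiset.sum_cons, div_eq_mul_inv]
    have h2 := eval_resPoly_le_one hR' hx hxa
    have h3 : 0 ≤ x * r⁻¹ := mul_nonneg hx (inv_pos.2 h0).le
    nlinarith [ih hR']

variable {σ w : ι → ℝ} {m : ℕ} {p : ℝ[X]}

/-- The first-order condition: the minimal residual polynomial is orthogonal, for the measure
weighted by `x`, to all polynomials of smaller degree. -/
theorem IsMinResidual.orthogonal (hp : IsMinResidual σ w m p) (hw : ∀ j, 0 ≤ w j) {q : ℝ[X]}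
    (hq : q.natDegree < m) : ∑ j, p.eval (σ j) * (σ j * q.eval (σ j)) * w j = 0 := by
  set c := ∑ j, p.eval (σ j) * (σ j * q.eval (σ j)) * w j with hc
  set d := ∑ j, (σ j * q.eval (σ j)) ^ 2 * w j with hd
  have hd0 : 0 ≤ d := Finset.sum_nonneg fun j _ => mul_nonneg (sq_nonneg _) (hw j)
  -- compare `p` with its perturbation `p + t x q`, and take `t = -c / (d + 1)` below
  have key : ∀ t : ℝ, 0 ≤ 2 * t * c + t ^ 2 * d := by
    intro t
    have h1 := hp.le (p + C t * (X * q)) ?_ (by simp [hp.eval_zero])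
    · have h2 : sqNorm σ w (p + C t * (X * q)) = sqNorm σ w p + (2 * t * c + t ^ 2 * d) := by
        simp only [sqNorm, hc, hd, Finset.mul_sum, ← Finset.sum_add_distrib]
        refine Finset.sum_congr rfl fun j _ => ?_
        simp only [eval_add, eval_mul, eval_C, eval_X]
        ring
      linarith
    · refine natDegree_add_le_of_degree_le hp.natDegree_le ((natDegree_C_mul_le _ _).trans ?_)
      refine natDegree_mul_le.trans ?_
      rw [natDegree_X]
      omega
  have h := key (-c / (d + 1))
  have hd1 : 0 < d + 1 := by linarith
  have e : 2 * (-c / (d + 1)) * c + (-c / (d + 1)) ^ 2 * d = -(c ^ 2 * (d + 2)) / (d + 1) ^ 2 := by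
    field_simp
    ring
  rw [e, neg_div, Left.nonneg_neg_iff] at h
  have h3 : 0 ≤ c ^ 2 * (d + 2) / (d + 1) ^ 2 := by positivity
  have h4 := le_antisymm h h3
  rw [div_eq_zero_iff] at h4
  rcases h4 with h4 | h4
  · rcases mul_eq_zero.1 h4 with h5 | h5
    · exact pow_eq_zero_iff (two_ne_zero) |>.1 h5
    · linarith
  · exact absurd h4 (by positivity)

/-- If `p = g h` with `h` of smaller degree, then `g` cannot be positive on the support: otherwise
the orthogonality of `p` to `x h` would force `h` to vanish on the support. -/
theorem IsMinResidual.not_factor (hp : IsMinResidual σ w m p) (hw : ∀ j, 0 ≤ w j)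
    (hσ : ∀ j, w j ≠ 0 → 0 < σ j)
    (hpos : ∀ q : ℝ[X], q.natDegree < m → q.eval 0 = 1 → 0 < sqNorm σ w q)
    {g h : ℝ[X]} (hgh : p = g * h) (hg : ∀ x, 0 < x → 0 < g.eval x) (hh : h.natDegree < m) :
    False := by
  have h1 := hp.orthogonal hw hh
  have hterm : ∀ j, p.eval (σ j) * (σ j * h.eval (σ j)) * w j
      = g.eval (σ j) * (σ j * w j) * (h.eval (σ j)) ^ 2 := by
    intro j; rw [hgh, eval_mul]; ring
  simp_rw [hterm] at h1
  have hnn : ∀ j ∈ Finset.univ, 0 ≤ g.eval (σ j) * (σ j * w j) * (h.eval (σ j)) ^ 2 := by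
    intro j _
    by_cases hj : w j = 0
    · simp [hj]
    · have := hσ j hj
      have := hg _ this
      have := hw j
      positivity
  have h2 := (Finset.sum_eq_zero_iff_of_nonneg hnn).1 h1
  have h0 : h.eval 0 ≠ 0 := by
    intro h0
    have := hp.eval_zero
    rw [hgh, eval_mul, h0, mul_zero] at this
    exact zero_ne_one this
  refine lt_irrefl (0 : ℝ) ((hpos (C (h.eval 0)⁻¹ * h) ?_ ?_).trans_eq ?_)
  · exact (natDegree_C_mul_le _ _).trans_lt hh
  · simp [h0]
  · refine Finset.sum_eq_zero fun j hj => ?_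
    by_cases hwj : w j = 0
    · simp [hwj]
    · have h3 := h2 j hj
      have h4 := hσ j hwj
      have h5 := hg _ h4
      have h6 : h.eval (σ j) = 0 := by
        rcases mul_eq_zero.1 h3 with h7 | h7
        · exact absurd h7 (by positivity)
        · exact pow_eq_zero_iff two_ne_zero |>.1 h7
      simp [h6]

/-- The minimal residual polynomial has full degree and only real roots, which are positive: a
nonconstant factor without roots, or a linear factor with root `r ≤ 0`, would have constant sign on
the support. -/
theorem IsMinResidual.exists_eq_resPoly (hp : IsMinResidual σ w m p) (hw : ∀ j, 0 ≤ w j)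
    (hσ : ∀ j, w j ≠ 0 → 0 < σ j)
    (hpos : ∀ q : ℝ[X], q.natDegree < m → q.eval 0 = 1 → 0 < sqNorm σ w q) :
    ∃ R : Multiset ℝ, (∀ r ∈ R, 0 < r) ∧ R.card = m ∧ p = resPoly R := by
  have hp0 : p ≠ 0 := by
    rintro rfl
    simpa using hp.eval_zero
  have hdeg : p.natDegree = m := by
    by_contra hne
    exact hp.not_factor hw hσ hpos (g := 1) (h := p) (by simp) (by simp)
      (lt_of_le_of_ne hp.natDegree_le hne)
  obtain ⟨g, hg, hcard, hroots⟩ := exists_prod_multiset_X_sub_C_mul p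
  set h := (p.roots.map fun a => X - C a).prod with hh
  have hg0 : g ≠ 0 := by
    rintro rfl
    exact hp0 (by rw [← hg, mul_zero])
  have hg00 : g.eval 0 ≠ 0 := by
    intro h0
    have : (0 : ℝ) ∈ g.roots := (mem_roots hg0).2 h0
    simp [hroots] at this
  have hgpos : ∀ x, 0 < (C (g.eval 0)⁻¹ * g).eval x := by
    intro x
    by_contra hx
    push Not at hx
    have hc : ContinuousOn (fun x => (C (g.eval 0)⁻¹ * g).eval x) Set.univ := by fun_prop
    have h1 : (fun x => (C (g.eval 0)⁻¹ * g).eval x) 0 = 1 := by simp [hg00]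
    obtain ⟨y, -, hy⟩ := isPreconnected_univ.intermediate_value (Set.mem_univ x)
      (Set.mem_univ 0) hc (Set.mem_Icc.2 ⟨hx, (zero_le_one.trans_eq h1.symm : (0 : ℝ) ≤ _)⟩)
    have hy' : g.eval y = 0 := by
      have : (g.eval 0)⁻¹ * g.eval y = 0 := by simpa using hy
      rcases mul_eq_zero.1 this with h2 | h2
      · exact absurd h2 (inv_ne_zero hg00)
      · exact h2
    have : y ∈ g.roots := (mem_roots hg0).2 hy'
    simp [hroots] at this
  have hhdeg : h.natDegree = p.roots.card := by
    rw [hh, natDegree_multiset_prod_X_sub_C_eq_card]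
  have hgdeg : g.natDegree = 0 := by
    by_contra hne
    refine hp.not_factor hw hσ hpos (g := C (g.eval 0)⁻¹ * g) (h := C (g.eval 0) * h) ?_
      (fun x _ => hgpos x) ?_
    · rw [← hg, mul_mul_mul_comm, ← C_mul, inv_mul_cancel₀ hg00, C_1, one_mul, mul_comm]
    · refine (natDegree_C_mul_le _ _).trans_lt ?_
      omega
  have hrpos : ∀ r ∈ p.roots, 0 < r := by
    intro r hr
    by_contra hr0
    push Not at hr0
    obtain ⟨q, hq⟩ := dvd_iff_isRoot.2 (isRoot_of_mem_roots hr)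
    have hq0 : q ≠ 0 := by
      rintro rfl
      exact hp0 (by rw [hq, mul_zero])
    refine hp.not_factor hw hσ hpos hq (fun x hx => by simp; linarith) ?_
    have := natDegree_mul (X_sub_C_ne_zero r) hq0
    rw [← hq, natDegree_X_sub_C] at this
    omega
  refine ⟨p.roots, hrpos, by omega, ?_⟩
  obtain ⟨c, rfl⟩ := natDegree_eq_zero.1 hgdeg
  have hev : ∀ x, p.eval x = (p.roots.map fun a => x - a).prod * c := by
    intro x
    conv_lhs => rw [← hg]
    rw [eval_mul, eval_C, hh, eval_multiset_prod, Multiset.map_map]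
    simp
  have hfac : ∀ x, (p.roots.map fun a => x - a).prod
      = (p.roots.map fun a => 0 - a).prod * (resPoly p.roots).eval x := by
    intro x
    rw [eval_resPoly, ← Multiset.prod_map_mul]
    refine congrArg _ (Multiset.map_congr rfl fun a ha => ?_)
    have := (hrpos a ha).ne'
    field_simp
    ring
  refine Polynomial.funext fun x => ?_
  have h1 : (p.roots.map fun a => 0 - a).prod * c = 1 := by rw [← hev 0, hp.eval_zero]
  rw [hev x, hfac x, mul_right_comm, h1, one_mul]

theorem exists_min_cons {R : Multiset ℝ} (hR : R ≠ 0) :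
    ∃ (x : ℝ) (R' : Multiset ℝ), R = x ::ₘ R' ∧ ∀ r ∈ R', x ≤ r := by
  obtain ⟨x, hx, hmin⟩ := R.toFinset.exists_min_image id (by
    obtain ⟨a, ha⟩ := Multiset.exists_mem_of_ne_zero hR
    exact ⟨a, Multiset.mem_toFinset.2 ha⟩)
  obtain ⟨R', rfl⟩ := Multiset.exists_cons_of_mem (Multiset.mem_toFinset.1 hx)
  exact ⟨x, R', rfl, fun r hr => hmin r (Multiset.mem_toFinset.2 (Multiset.mem_cons_of_mem hr))⟩

/-- If the smallest root `x₁` of the minimal residual polynomial `p` is removed, the remaining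
factor is dominated, in norm, by an exponential filter. With `x₂` the next root, the square of
that factor is bounded pointwise by the filter plus a multiple of `p(x) x p'(x)`, where `p'` lacks
the roots `x₁, x₂`; the latter term integrates to zero. -/
theorem IsMinResidual.sqNorm_le_exp {x₁ : ℝ} {R : Multiset ℝ}
    (hp : IsMinResidual σ w m (resPoly (x₁ ::ₘ R))) (hw : ∀ j, 0 ≤ w j) (hσ : ∀ j, 0 ≤ σ j)
    (hm : R.card < m) (hx₁ : 0 < x₁) (hR : ∀ r ∈ R, x₁ ≤ r) :
    sqNorm σ w (resPoly R) ≤ ∑ j, Real.exp (-(σ j * (R.map fun r => r⁻¹).sum)) * w j := by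
  rcases eq_or_ne R 0 with rfl | hR0
  · simp [sqNorm]
  obtain ⟨x₂, R', rfl, hR'⟩ := exists_min_cons hR0
  have h12 : x₁ ≤ x₂ := hR x₂ (Multiset.mem_cons_self _ _)
  have hx₂ : 0 < x₂ := hx₁.trans_le h12
  have hRR : ∀ r ∈ R', 0 < r ∧ x₂ ≤ r := fun r hr => ⟨hx₂.trans_le (hR' r hr), hR' r hr⟩
  rw [Multiset.card_cons] at hm
  have horth := hp.orthogonal hw (q := resPoly R')
    ((natDegree_resPoly_le R').trans_lt (by omega))
  have hpt : ∀ j, (resPoly (x₂ ::ₘ R')).eval (σ j) ^ 2 * w j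
      ≤ Real.exp (-(σ j * ((x₂ ::ₘ R').map fun r => r⁻¹).sum)) * w j
        + (x₁ / x₂ ^ 2) * ((resPoly (x₁ ::ₘ x₂ ::ₘ R')).eval (σ j)
          * (σ j * (resPoly R').eval (σ j)) * w j) := by
    intro j
    set x := σ j
    have hx := hσ j
    suffices h : (resPoly (x₂ ::ₘ R')).eval x ^ 2
        ≤ Real.exp (-(x * ((x₂ ::ₘ R').map fun r => r⁻¹).sum))
        + (x₁ / x₂ ^ 2) * ((resPoly (x₁ ::ₘ x₂ ::ₘ R')).eval x * (x * (resPoly R').eval x)) by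
      calc _ ≤ _ := mul_le_mul_of_nonneg_right h (hw j)
        _ = _ := by ring
    simp only [eval_resPoly_cons]
    set e := (resPoly R').eval x with he
    have key : x₁ / x₂ ^ 2 * ((1 - x / x₁) * ((1 - x / x₂) * e) * (x * e))
        = (1 - x / x₂) * e ^ 2 * ((x₁ - x) * x / x₂ ^ 2) := by
      field_simp
    rw [key]
    rcases le_total x x₂ with hle | hle
    · have ht0 : 0 ≤ 1 - x / x₂ := by rw [sub_nonneg, div_le_one hx₂]; exact hle
      have h3 : (1 - x / x₂) * e ^ 2
          ≤ Real.exp (-(x * ((x₂ ::ₘ R').map fun r => r⁻¹).sum)) := by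
        have h4 := eval_resPoly_le_exp (R := x₂ ::ₘ R') (x := x) (a := x₂) (by
          intro r hr
          rcases Multiset.mem_cons.1 hr with rfl | hr
          · exact ⟨hx₂, le_rfl⟩
          · exact hRR r hr) hle
        rw [eval_resPoly_cons] at h4
        have h5 := eval_resPoly_le_one hRR hx hle
        have h6 := eval_resPoly_nonneg hRR hle
        refine le_trans ?_ h4
        rw [← he] at h5 h6 ⊢
        rw [sq]
        exact mul_le_mul_of_nonneg_left (by nlinarith) ht0
      have h7 : ((1 - x / x₂) * e) ^ 2 - (1 - x / x₂) * e ^ 2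
          ≤ (1 - x / x₂) * e ^ 2 * ((x₁ - x) * x / x₂ ^ 2) := by
        have h8 : - (x / x₂) ≤ (x₁ - x) * x / x₂ ^ 2 := by
          rw [← sub_nonneg]
          have : (x₁ - x) * x / x₂ ^ 2 - -(x / x₂) = (x₁ + (x₂ - x)) * x / x₂ ^ 2 := by
            field_simp
            ring
          rw [this]
          have : 0 ≤ x₂ - x := by linarith
          positivity
        calc ((1 - x / x₂) * e) ^ 2 - (1 - x / x₂) * e ^ 2
            = (1 - x / x₂) * e ^ 2 * (-(x / x₂)) := by ring
          _ ≤ _ := mul_le_mul_of_nonneg_left h8 (by positivity)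
      linarith
    · have ht0 : 0 ≤ x / x₂ - 1 := by rw [sub_nonneg, one_le_div hx₂]; exact hle
      have h7 : ((1 - x / x₂) * e) ^ 2 ≤ (1 - x / x₂) * e ^ 2 * ((x₁ - x) * x / x₂ ^ 2) := by
        have h8 : x / x₂ - 1 ≤ (x - x₁) * x / x₂ ^ 2 := by
          have : x / x₂ - 1 = (x - x₂) * x₂ / x₂ ^ 2 := by field_simp
          rw [this]
          exact div_le_div_of_nonneg_right (by nlinarith) (by positivity)
        calc ((1 - x / x₂) * e) ^ 2 = (x / x₂ - 1) * e ^ 2 * (x / x₂ - 1) := by ring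
          _ ≤ (x / x₂ - 1) * e ^ 2 * ((x - x₁) * x / x₂ ^ 2) :=
            mul_le_mul_of_nonneg_left h8 (by positivity)
          _ = _ := by ring
      have := Real.exp_pos (-(x * ((x₂ ::ₘ R').map fun r => r⁻¹).sum))
      linarith
  calc sqNorm σ w (resPoly (x₂ ::ₘ R')) ≤ _ := Finset.sum_le_sum fun j _ => hpt j
    _ = _ := by rw [Finset.sum_add_distrib, ← Finset.mul_sum, horth, mul_zero, add_zero]

/-- If the smallest root `x₁` is much smaller than the others, then the norm of the factor that
remains when it is removed is carried by the low frequencies. Again a multiple of an expression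
that integrates to zero is added pointwise. -/
theorem IsMinResidual.sqNorm_le_low {x₁ a : ℝ} {R : Multiset ℝ}
    (hp : IsMinResidual σ w m (resPoly (x₁ ::ₘ R))) (hw : ∀ j, 0 ≤ w j) (hσ : ∀ j, 0 ≤ σ j)
    (hm : R.card < m) (hx₁ : 0 < x₁) (hx₁a : 2 * x₁ ≤ a) (hR : ∀ r ∈ R, a ≤ r) :
    sqNorm σ w (resPoly R) ≤ 9 / 8 * ∑ j, if σ j ≤ a then w j else 0 := by
  have ha : 0 < a := by linarith
  have horth := hp.orthogonal hw (q := resPoly R) ((natDegree_resPoly_le R).trans_lt hm)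
  set c := x₁ / (a * (a - x₁)) with hc
  have hax : 0 < a - x₁ := by linarith
  have hc0 : 0 < c := by positivity
  have hcx : c * x₁ ≤ 1 / 2 := by
    rw [hc, div_mul_eq_mul_div, div_le_iff₀ (by positivity)]
    nlinarith
  have hpt : ∀ j, (resPoly R).eval (σ j) ^ 2 * w j ≤ 9 / 8 * (if σ j ≤ a then w j else 0)
      - c * ((resPoly (x₁ ::ₘ R)).eval (σ j) * (σ j * (resPoly R).eval (σ j)) * w j) := by
    intro j
    set x := σ j
    have hx : 0 ≤ x := hσ j
    set e := (resPoly R).eval x with he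
    rw [eval_resPoly_cons]
    have hwj := hw j
    split_ifs with hxa
    · have hRR : ∀ r ∈ R, 0 < r ∧ a ≤ r := fun r hr => ⟨ha.trans_le (hR r hr), hR r hr⟩
      have h1 : e ^ 2 ≤ 1 := by
        have := eval_resPoly_le_one hRR hx hxa
        have := eval_resPoly_nonneg hRR hxa
        nlinarith
      have h2 : (1 - x / x₁) * x ≤ x₁ / 4 := by
        have : x₁ / 4 - (1 - x / x₁) * x = (x - x₁ / 2) ^ 2 / x₁ := by field_simp; ring
        have : 0 ≤ (x - x₁ / 2) ^ 2 / x₁ := by positivity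
        linarith
      have h3 : e ^ 2 * (1 + c * ((1 - x / x₁) * x)) ≤ 9 / 8 := by
        have : 1 + c * ((1 - x / x₁) * x) ≤ 9 / 8 := by nlinarith
        nlinarith [sq_nonneg e]
      nlinarith
    · push Not at hxa
      have h1 : 1 ≤ c * ((x / x₁ - 1) * x) := by
        have : c * ((x / x₁ - 1) * x) = (x - x₁) * x / (a * (a - x₁)) := by
          rw [hc]; field_simp
        rw [this, one_le_div (by positivity)]
        nlinarith
      have h2 : e ^ 2 * w j * 1 ≤ e ^ 2 * w j * (c * ((x / x₁ - 1) * x)) :=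
        mul_le_mul_of_nonneg_left h1 (by positivity)
      nlinarith
  calc sqNorm σ w (resPoly R) ≤ _ := Finset.sum_le_sum fun j _ => hpt j
    _ = _ := by
      rw [Finset.sum_sub_distrib, ← Finset.mul_sum, ← Finset.mul_sum, horth, mul_zero, sub_zero]

end ResidualPolynomials

/-! ### The error of the stopped iteration in spectral coordinates -/

section SpectralError

open Polynomial

variable {ι : Type*} [Fintype ι] {σ b f : ι → ℝ} {lam Q F τ : ℝ} {m : ℕ} {p : ℝ[X]}

theorem exp_mul_add_le {x lam B : ℝ} (hx : 0 ≤ x) (hlam : 0 < lam) (hB : 1 / lam ≤ B) :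
    Real.exp (-(x * B)) * (x + lam) ≤ lam := by
  have h1 : x / lam + 1 ≤ Real.exp (x * B) := by
    refine (Real.add_one_le_exp (x / lam)).trans (Real.exp_le_exp.2 ?_)
    rw [div_eq_mul_one_div]
    exact mul_le_mul_of_nonneg_left hB hx
  rw [Real.exp_neg, inv_mul_le_iff₀ (Real.exp_pos _)]
  calc x + lam = (x / lam + 1) * lam := by field_simp
    _ ≤ _ := mul_le_mul_of_nonneg_right h1 hlam.le

/-- At the stopping index, the minimal residual polynomial is at most `1` and has a controlled
slope on an interval of length comparable to `lam`. The threshold exceeds the contribution of the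
noise to every residual that precedes the stopping index. -/
theorem residual_control (hτ : 3 / 2 ≤ τ) (hσ : ∀ j, 0 ≤ σ j) (hb : ∀ j, b j ≠ 0 → 0 < σ j)
    (hlam : 0 < lam) (hQ : 0 < Q) (hF : 0 ≤ F)
    (hnoise : ∑ j, (b j - σ j * f j) ^ 2 / (σ j + lam) ≤ 9 / 16 * Q ^ 2 / lam)
    (hlow : (∑ j, if σ j ≤ lam then f j ^ 2 else 0) ≤ F ^ 2)
    (hfilter : ∀ B, 1 / lam ≤ B →
      ∑ j, Real.exp (-(σ j * B)) * (σ j * f j) ^ 2 ≤ (F / B) ^ 2)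
    (hp : IsMinResidual σ (fun j => b j ^ 2) m p)
    (hbefore : ∀ q : ℝ[X], q.natDegree < m → q.eval 0 = 1 →
      (τ * Q) ^ 2 ≤ sqNorm σ (fun j => b j ^ 2) q)
    {x : ℝ} (hx : 0 ≤ x) (hxa : x ≤ lam / (8 * (1 + lam * F / Q))) :
    0 ≤ p.eval x ∧ p.eval x ≤ 1 ∧ 1 - x * (10 * (1 + lam * F / Q) / lam) ≤ p.eval x := by
  set w : ι → ℝ := fun j => b j ^ 2 with hw_def
  have hw : ∀ j, 0 ≤ w j := fun j => sq_nonneg _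
  set Θ := 1 + lam * F / Q with hΘ
  have hΘ1 : 1 ≤ Θ := by
    have : 0 ≤ lam * F / Q := by positivity
    linarith
  have hΘ0 : 0 < Θ := by linarith
  have hFΘ : lam * F ≤ Θ * Q := by
    rw [hΘ, add_mul, div_mul_cancel₀ _ hQ.ne']
    linarith
  have hτQ : 9 / 4 * Q ^ 2 ≤ (τ * Q) ^ 2 := by
    rw [mul_pow]
    exact mul_le_mul_of_nonneg_right (by nlinarith) (sq_nonneg _)
  have hwle : ∀ j, w j ≤ 2 * (b j - σ j * f j) ^ 2 + 2 * (σ j * f j) ^ 2 := by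
    intro j
    simp only [hw_def]
    nlinarith [sq_nonneg ((b j - σ j * f j) - σ j * f j)]
  rcases Nat.eq_zero_or_pos m with rfl | hm
  · have h1 : p = 1 := by
      obtain ⟨c, rfl⟩ := natDegree_eq_zero.1 (Nat.le_zero.1 hp.natDegree_le)
      have := hp.eval_zero
      rw [eval_C] at this
      rw [this, C_1]
    rw [h1]
    refine ⟨by simp, by simp, ?_⟩
    rw [eval_one, sub_le_self_iff]
    positivity
  have hpos : ∀ q : ℝ[X], q.natDegree < m → q.eval 0 = 1 → 0 < sqNorm σ w q :=
    fun q h1 h2 => lt_of_lt_of_le (by positivity) (hτQ.trans (hbefore q h1 h2))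
  obtain ⟨R₀, hR₀, hcard, hpR⟩ := hp.exists_eq_resPoly hw
    (fun j hj => hb j fun h0 => hj (by simp [hw_def, h0])) hpos
  have hR₀0 : R₀ ≠ 0 := by
    rintro rfl
    simp at hcard
    omega
  obtain ⟨x₁, R, rfl, hR⟩ := exists_min_cons hR₀0
  have hx₁ : 0 < x₁ := hR₀ x₁ (Multiset.mem_cons_self _ _)
  have hRm : R.card < m := by
    rw [Multiset.card_cons] at hcard
    omega
  have hRpos : ∀ r ∈ R, 0 < r := fun r hr => hR₀ r (Multiset.mem_cons_of_mem hr)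
  rw [hpR] at hp
  have hbef := hτQ.trans (hbefore (resPoly R) ((natDegree_resPoly_le R).trans_lt hRm) (by simp))
  set B := (R.map fun r => r⁻¹).sum with hBdef
  have hinvB : ∀ r ∈ R, r⁻¹ ≤ B := by
    intro r hr
    refine Multiset.single_le_sum ?_ _ (Multiset.mem_map_of_mem _ hr)
    simp only [Multiset.mem_map, forall_exists_index, and_imp, forall_apply_eq_imp_iff₂]
    exact fun r hr => (inv_pos.2 (hRpos r hr)).le
  -- If the sum `B` of the inverses of the other roots were larger, then the exponential filter
  -- would make the residual of the polynomial without the root `x₁` smaller than the threshold.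
  have hB : B ≤ 4 / 3 * Θ / lam := by
    by_contra hB
    push Not at hB
    have hB1 : 1 / lam ≤ B := by
      refine le_trans ?_ hB.le
      exact div_le_div_of_nonneg_right (by linarith) hlam.le
    have hB0 : 0 < B := lt_of_lt_of_le (by positivity) hB1
    have h1 := hp.sqNorm_le_exp hw hσ hRm hx₁ hR
    have h2 : ∑ j, Real.exp (-(σ j * B)) * w j ≤ 9 / 8 * Q ^ 2 + 2 * (F / B) ^ 2 := by
      calc ∑ j, Real.exp (-(σ j * B)) * w j
          ≤ ∑ j, (2 * lam * ((b j - σ j * f j) ^ 2 / (σ j + lam))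
            + 2 * (Real.exp (-(σ j * B)) * (σ j * f j) ^ 2)) := by
            refine Finset.sum_le_sum fun j _ => ?_
            have h3 := exp_mul_add_le (hσ j) hlam hB1
            have h4 : 0 < σ j + lam := by linarith [hσ j]
            have h5 : Real.exp (-(σ j * B)) * (b j - σ j * f j) ^ 2
                ≤ lam * ((b j - σ j * f j) ^ 2 / (σ j + lam)) := by
              rw [mul_div_assoc', le_div_iff₀ h4]
              calc _ = Real.exp (-(σ j * B)) * (σ j + lam) * (b j - σ j * f j) ^ 2 := by ring
                _ ≤ _ := mul_le_mul_of_nonneg_right h3 (sq_nonneg _)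
            have h6 := mul_le_mul_of_nonneg_left (hwle j) (Real.exp_pos (-(σ j * B))).le
            linarith
        _ ≤ 2 * lam * (9 / 16 * Q ^ 2 / lam) + 2 * (F / B) ^ 2 := by
            rw [Finset.sum_add_distrib, ← Finset.mul_sum, ← Finset.mul_sum]
            exact add_le_add (mul_le_mul_of_nonneg_left hnoise (by positivity))
              (mul_le_mul_of_nonneg_left (hfilter B hB1) (by norm_num))
        _ = _ := by
            field_simp
            ring
    have h3 : (3 / 4 * Q) ^ 2 ≤ (F / B) ^ 2 := by nlinarith
    have h4 : 3 / 4 * Q ≤ F / B := (pow_le_pow_iff_left₀ (by positivity) (by positivity)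
      two_ne_zero).1 h3
    rw [le_div_iff₀ hB0] at h4
    rw [div_lt_iff₀ hlam] at hB
    have h5 : 3 / 4 * Q * (4 / 3 * Θ) < 3 / 4 * Q * (B * lam) :=
      mul_lt_mul_of_pos_left hB (by positivity)
    nlinarith
  -- All other roots are at least `a`, by the bound on `B`. If `x₁` were much smaller than `a`, the
  -- residual of the polynomial without the root `x₁` would again be smaller than the threshold.
  set a := lam / (4 * Θ) with ha
  have ha0 : 0 < a := by positivity
  have haΘ : a * (4 * Θ) = lam := by rw [ha]; field_simp
  have hal : a ≤ lam / 4 := by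
    rw [ha]
    exact div_le_div_of_nonneg_left hlam.le (by norm_num) (by linarith)
  have hRa : ∀ r ∈ R, a ≤ r := by
    intro r hr
    have h1 := (hinvB r hr).trans hB
    have h2 := hRpos r hr
    rw [inv_le_comm₀ h2 (by positivity)] at h1
    refine le_trans ?_ h1
    rw [ha, inv_div]
    exact div_le_div_of_nonneg_left hlam.le (by positivity) (by linarith)
  have hx₁a : a ≤ 2 * x₁ := by
    by_contra hlt
    push Not at hlt
    have h1 := hp.sqNorm_le_low hw hσ hRm hx₁ hlt.le hRa
    have h2 : (∑ j, if σ j ≤ a then w j else 0)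
        ≤ 2 * (5 / 4 * lam) * (9 / 16 * Q ^ 2 / lam) + 2 * a ^ 2 * F ^ 2 := by
      calc (∑ j, if σ j ≤ a then w j else 0)
          ≤ ∑ j, (2 * (5 / 4 * lam) * ((b j - σ j * f j) ^ 2 / (σ j + lam))
            + 2 * a ^ 2 * (if σ j ≤ lam then f j ^ 2 else 0)) := by
            refine Finset.sum_le_sum fun j _ => ?_
            have h4 : 0 < σ j + lam := by linarith [hσ j]
            have h7 : 0 ≤ (b j - σ j * f j) ^ 2 / (σ j + lam) := by positivity
            split_ifs with h3 h5 h5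
            · have h5 : (b j - σ j * f j) ^ 2
                  ≤ 5 / 4 * lam * ((b j - σ j * f j) ^ 2 / (σ j + lam)) := by
                rw [mul_div_assoc', le_div_iff₀ h4, mul_comm]
                exact mul_le_mul_of_nonneg_right (by linarith) (sq_nonneg _)
              have h6 : (σ j * f j) ^ 2 ≤ a ^ 2 * f j ^ 2 := by
                rw [mul_pow]
                exact mul_le_mul_of_nonneg_right (pow_le_pow_left₀ (hσ j) h3 2) (sq_nonneg _)
              linarith [hwle j]
            · linarith
            · positivity
            · positivity
        _ ≤ _ := by
            rw [Finset.sum_add_distrib, ← Finset.mul_sum, ← Finset.mul_sum]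
            exact add_le_add (mul_le_mul_of_nonneg_left hnoise (by positivity))
              (mul_le_mul_of_nonneg_left hlow (by positivity))
    have h3 : 2 * (5 / 4 * lam) * (9 / 16 * Q ^ 2 / lam) = 45 / 32 * Q ^ 2 := by
      field_simp
      ring
    have h4 : a * F ≤ Q / 4 := by
      have : a * F * (4 * Θ) ≤ Q / 4 * (4 * Θ) := by
        calc a * F * (4 * Θ) = lam * F := by rw [← haΘ]; ring
          _ ≤ Θ * Q := hFΘ
          _ = _ := by ring
      exact le_of_mul_le_mul_right this (by positivity)
    have h5 : (a * F) ^ 2 ≤ (Q / 4) ^ 2 := pow_le_pow_left₀ (by positivity) h4 2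
    rw [h3] at h2
    nlinarith [sq_pos_of_pos hQ]
  have hxx₁ : x ≤ x₁ := by
    refine hxa.trans ?_
    have : lam / (8 * Θ) = a / 2 := by rw [ha]; field_simp; norm_num
    linarith
  have hall : ∀ r ∈ x₁ ::ₘ R, 0 < r ∧ x₁ ≤ r := by
    intro r hr
    refine ⟨hR₀ r hr, ?_⟩
    rcases Multiset.mem_cons.1 hr with rfl | hr
    · exact le_rfl
    · exact hR r hr
  rw [hpR]
  refine ⟨eval_resPoly_nonneg hall hxx₁, eval_resPoly_le_one hall hx hxx₁,
    le_trans ?_ (one_sub_le_eval_resPoly hall hx hxx₁)⟩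
  rw [Multiset.map_cons, Multiset.sum_cons]
  refine sub_le_sub_left (mul_le_mul_of_nonneg_left ?_ hx) _
  have h1 : x₁⁻¹ ≤ 8 * Θ / lam := by
    rw [inv_le_comm₀ hx₁ (by positivity), inv_div]
    have : lam / (8 * Θ) = a / 2 := by rw [ha]; field_simp; norm_num
    linarith
  calc x₁⁻¹ + B ≤ 8 * Θ / lam + 4 / 3 * Θ / lam := add_le_add h1 hB
    _ = (28 / 3 * Θ) / lam := by ring
    _ ≤ _ := div_le_div_of_nonneg_right (by linarith) hlam.le

/-- The error at a low frequency `x`, where `y` is the value of the filter `q`, `1 - x y` that of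
the residual polynomial, `β` the data and `v` the target. -/
theorem low_frequency_error_le {x y β v Θ : ℝ} (hx : 0 ≤ x) (hβ : β ≠ 0 → 0 < x)
    (hlam : 0 < lam) (hxlam : x ≤ lam) (hp0 : 0 ≤ 1 - x * y) (hp1 : 1 - x * y ≤ 1)
    (hps : 1 - x * (10 * Θ / lam) ≤ 1 - x * y) :
    (x + lam) * (y * β - v) ^ 2
      ≤ 800 * Θ ^ 2 * ((β - x * v) ^ 2 / (x + lam)) + 4 * lam * v ^ 2 := by
  set ζ := β - x * v with hζ
  set t := 1 - x * y with ht
  have hxl : 0 < x + lam := by linarith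
  have hZ' : (x + lam) ^ 2 * (ζ ^ 2 / (x + lam)) = (x + lam) * ζ ^ 2 := by field_simp
  have e : y * β - v = y * ζ - t * v := by rw [ht, hζ]; ring
  have h2 : (t * v) ^ 2 ≤ v ^ 2 := by
    rw [mul_pow]
    exact mul_le_of_le_one_left (sq_nonneg _) (pow_le_one₀ hp0 hp1)
  have h3 : (y * ζ) ^ 2 ≤ (10 * Θ / lam) ^ 2 * ζ ^ 2 := by
    rcases hx.eq_or_lt with hx0 | hx0
    · have h4 : β = 0 := by
        by_contra hne
        exact absurd (hβ hne) (by rw [← hx0]; exact lt_irrefl 0)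
      have h5 : ζ = 0 := by rw [hζ, h4, ← hx0]; ring
      rw [h5]; simp
    · rw [mul_pow]
      refine mul_le_mul_of_nonneg_right ?_ (sq_nonneg _)
      have hy0 : 0 ≤ y := by
        have : 0 ≤ x * y := by linarith
        exact nonneg_of_mul_nonneg_right this hx0
      refine pow_le_pow_left₀ hy0 ?_ 2
      have : x * y ≤ x * (10 * Θ / lam) := by linarith
      exact le_of_mul_le_mul_left this hx0
  have h1 : (y * β - v) ^ 2 ≤ 2 * ((10 * Θ / lam) ^ 2 * ζ ^ 2) + 2 * v ^ 2 := by
    rw [e]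
    nlinarith [sq_nonneg (y * ζ + t * v)]
  have h5 : (x + lam) * ((10 * Θ / lam) ^ 2 * ζ ^ 2) ≤ 400 * Θ ^ 2 * (ζ ^ 2 / (x + lam)) := by
    calc (x + lam) * ((10 * Θ / lam) ^ 2 * ζ ^ 2)
        = 100 * Θ ^ 2 / lam ^ 2 * ((x + lam) ^ 2 * (ζ ^ 2 / (x + lam))) := by
          rw [hZ']; field_simp; ring
      _ ≤ 100 * Θ ^ 2 / lam ^ 2 * ((2 * lam) ^ 2 * (ζ ^ 2 / (x + lam))) := by
          gcongr
          linarith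
      _ = _ := by field_simp; ring
  have h6 : (x + lam) * v ^ 2 ≤ 2 * lam * v ^ 2 :=
    mul_le_mul_of_nonneg_right (by linarith) (sq_nonneg _)
  have h4 := mul_le_mul_of_nonneg_left h1 hxl.le
  linarith

/-- The error at a high frequency `x`, in terms of the noise `β - x v` and the residual
`(1 - x y) β`. -/
theorem high_frequency_error_le {x y β v Θ : ℝ} (hlam : 0 < lam) (hΘ : 1 ≤ Θ)
    (hxa : lam / (8 * Θ) < x) :
    (x + lam) * (y * β - v) ^ 2
      ≤ 162 * Θ ^ 2 * ((β - x * v) ^ 2 / (x + lam))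
        + 144 * Θ ^ 2 / lam * ((1 - x * y) ^ 2 * β ^ 2) := by
  set ζ := β - x * v with hζ
  set t := 1 - x * y with ht
  have hx0 : 0 < x := lt_trans (by positivity) hxa
  have hxl : 0 < x + lam := by linarith
  have hZ' : (x + lam) ^ 2 * (ζ ^ 2 / (x + lam)) = (x + lam) * ζ ^ 2 := by field_simp
  have hlx : lam ≤ 8 * Θ * x := by
    rw [div_lt_iff₀ (by positivity)] at hxa
    linarith
  have hxlx : x + lam ≤ 9 * Θ * x := by
    have := mul_le_mul_of_nonneg_right hΘ hx0.le
    linarith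
  have e : (x + lam) * (y * β - v) ^ 2 = (x + lam) / x ^ 2 * (ζ - t * β) ^ 2 := by
    rw [ht, hζ]; field_simp; ring
  have h1 : (ζ - t * β) ^ 2 ≤ 2 * ζ ^ 2 + 2 * (t ^ 2 * β ^ 2) := by
    nlinarith [sq_nonneg (ζ + t * β)]
  have h2 : (x + lam) / x ^ 2 * ζ ^ 2 ≤ 81 * Θ ^ 2 * (ζ ^ 2 / (x + lam)) := by
    calc (x + lam) / x ^ 2 * ζ ^ 2 = (x + lam) ^ 2 * (ζ ^ 2 / (x + lam)) / x ^ 2 := by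
          rw [hZ']; ring
      _ ≤ (9 * Θ * x) ^ 2 * (ζ ^ 2 / (x + lam)) / x ^ 2 := by gcongr
      _ = _ := by field_simp; ring
  have h3 : (x + lam) / x ^ 2 ≤ 72 * Θ ^ 2 / lam := by
    rw [div_le_div_iff₀ (by positivity) hlam]
    calc (x + lam) * lam ≤ 9 * Θ * x * (8 * Θ * x) := by gcongr
      _ = _ := by ring
  have h4 := mul_le_mul_of_nonneg_left h1 (by positivity : 0 ≤ (x + lam) / x ^ 2)
  have h5 := mul_le_mul_of_nonneg_right h3 (by positivity : 0 ≤ t ^ 2 * β ^ 2)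
  have h8 : 144 * Θ ^ 2 / lam * (t ^ 2 * β ^ 2) = 2 * (72 * Θ ^ 2 / lam * (t ^ 2 * β ^ 2)) := by
    ring
  rw [e, h8]
  linarith

/-- The error bound at the stopping index. The coordinates of the data are `b = σ f + noise`, where
`f` is the target, and the estimator is `q(σ) b`. -/
theorem spectral_error_le (hτ : 3 / 2 ≤ τ) (hσ : ∀ j, 0 ≤ σ j) (hb : ∀ j, b j ≠ 0 → 0 < σ j)
    (hlam : 0 < lam) (hQ : 0 < Q) (hF : 0 ≤ F)
    (hnoise : ∑ j, (b j - σ j * f j) ^ 2 / (σ j + lam) ≤ 9 / 16 * Q ^ 2 / lam)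
    (hlow : (∑ j, if σ j ≤ lam then f j ^ 2 else 0) ≤ F ^ 2)
    (hfilter : ∀ B, 1 / lam ≤ B →
      ∑ j, Real.exp (-(σ j * B)) * (σ j * f j) ^ 2 ≤ (F / B) ^ 2)
    (hp : IsMinResidual σ (fun j => b j ^ 2) m p)
    (hresid : sqNorm σ (fun j => b j ^ 2) p ≤ (τ * Q) ^ 2)
    (hbefore : ∀ q : ℝ[X], q.natDegree < m → q.eval 0 = 1 →
      (τ * Q) ^ 2 ≤ sqNorm σ (fun j => b j ^ 2) q)
    {q : ℝ[X]} (hpq : p = 1 - X * q) :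
    ∑ j, (σ j + lam) * (q.eval (σ j) * b j - f j) ^ 2
      ≤ (600 + 144 * τ ^ 2) * ((Q + lam * F) ^ 2 / lam) := by
  set Θ := 1 + lam * F / Q with hΘ
  have hΘ1 : 1 ≤ Θ := by
    have : 0 ≤ lam * F / Q := by positivity
    linarith
  have hΘ0 : 0 < Θ := by linarith
  have hΘQ : Θ * Q = Q + lam * F := by
    rw [hΘ, add_mul, div_mul_cancel₀ _ hQ.ne', one_mul]
  have hterm : ∀ j, (σ j + lam) * (q.eval (σ j) * b j - f j) ^ 2
      ≤ 962 * Θ ^ 2 * ((b j - σ j * f j) ^ 2 / (σ j + lam))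
        + 4 * lam * (if σ j ≤ lam then f j ^ 2 else 0)
        + 144 * Θ ^ 2 / lam * (p.eval (σ j) ^ 2 * b j ^ 2) := by
    intro j
    have hx : 0 ≤ σ j := hσ j
    have hpx : p.eval (σ j) = 1 - σ j * q.eval (σ j) := by rw [hpq]; simp
    have hZ : 0 ≤ Θ ^ 2 * ((b j - σ j * f j) ^ 2 / (σ j + lam)) := by positivity
    have hR : 0 ≤ 144 * Θ ^ 2 / lam * (p.eval (σ j) ^ 2 * b j ^ 2) := by positivity
    rcases le_or_gt (σ j) (lam / (8 * Θ)) with hxa | hxa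
    · obtain ⟨hp0, hp1, hps⟩ := residual_control hτ hσ hb hlam hQ hF hnoise hlow hfilter hp
        hbefore hx hxa
      rw [hpx] at hp0 hp1 hps
      have hxlam : σ j ≤ lam := hxa.trans (div_le_self hlam.le (by linarith))
      rw [if_pos hxlam]
      have := low_frequency_error_le hx (hb j) hlam hxlam hp0 hp1 hps (v := f j)
      linarith
    · have h1 := high_frequency_error_le (y := q.eval (σ j)) (β := b j) (v := f j) hlam hΘ1 hxa
      rw [← hpx] at h1
      have h2 : 0 ≤ 4 * lam * (if σ j ≤ lam then f j ^ 2 else 0) := by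
        split_ifs <;> positivity
      linarith
  calc ∑ j, (σ j + lam) * (q.eval (σ j) * b j - f j) ^ 2
      ≤ 962 * Θ ^ 2 * (9 / 16 * Q ^ 2 / lam) + 4 * lam * F ^ 2
        + 144 * Θ ^ 2 / lam * (τ * Q) ^ 2 := by
        refine (Finset.sum_le_sum fun j _ => hterm j).trans ?_
        rw [Finset.sum_add_distrib, Finset.sum_add_distrib, ← Finset.mul_sum, ← Finset.mul_sum,
          ← Finset.mul_sum]
        gcongr
        exact hresid
    _ = (962 * 9 / 16 + 144 * τ ^ 2) * ((Θ * Q) ^ 2 / lam) + 4 * ((lam * F) ^ 2 / lam) := by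
        field_simp
        ring
    _ ≤ (962 * 9 / 16 + 144 * τ ^ 2) * ((Q + lam * F) ^ 2 / lam)
        + 4 * ((Q + lam * F) ^ 2 / lam) := by
        rw [hΘQ]
        gcongr
        linarith
    _ ≤ _ := by
        have : 0 ≤ (Q + lam * F) ^ 2 / lam := by positivity
        nlinarith

end SpectralError

/-! ### A Bernstein inequality in Hilbert space -/

section Bernstein

theorem hasSum_cosh_sqrt {q : ℝ} (hq : 0 ≤ q) :
    HasSum (fun n : ℕ => q ^ n / ((2 * n)! : ℝ)) (Real.cosh √q) := by
  have h := Real.hasSum_cosh √q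
  simpa [pow_mul, Real.sq_sqrt hq] using h

/-- The function `cosh ∘ √` is convex, since it is a power series with nonnegative coefficients. -/
theorem convexOn_cosh_sqrt : ConvexOn ℝ (Set.Ici 0) fun q : ℝ => Real.cosh √q := by
  refine ⟨convex_Ici 0, fun x hx y hy a b ha hb hab => ?_⟩
  have hx' : 0 ≤ x := hx
  have hy' : 0 ≤ y := hy
  have h1 := hasSum_cosh_sqrt (q := a • x + b • y) (by
    simp only [smul_eq_mul]; positivity)
  have h2 := ((hasSum_cosh_sqrt hx').mul_left a).add ((hasSum_cosh_sqrt hy').mul_left b)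
  refine hasSum_le (fun n => ?_) h1 h2
  have h3 := (convexOn_pow n).2 hx hy ha hb hab
  simp only [smul_eq_mul] at h3 ⊢
  rw [mul_div_assoc', mul_div_assoc', ← add_div]
  exact div_le_div_of_nonneg_right h3 (by positivity)

variable {V : Type*} [NormedAddCommGroup V] [InnerProductSpace ℝ V]

theorem cosh_norm_add_le (s x : V) :
    Real.cosh ‖s + x‖ ≤ Real.cosh ‖s‖ * Real.cosh ‖x‖
      + inner ℝ s x * (Real.sinh ‖s‖ / ‖s‖) * (Real.sinh ‖x‖ / ‖x‖) := by
  rcases eq_or_ne s 0 with rfl | hs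
  · simp
  rcases eq_or_ne x 0 with rfl | hx
  · simp
  have ha : 0 < ‖s‖ := norm_pos_iff.2 hs
  have hb : 0 < ‖x‖ := norm_pos_iff.2 hx
  set a := ‖s‖
  set b := ‖x‖
  set c := inner ℝ s x
  have hc : |c| ≤ a * b := abs_real_inner_le_norm s x
  obtain ⟨hc1, hc2⟩ := abs_le.1 hc
  have hab : 0 < a * b := by positivity
  have hn : ‖s + x‖ = √(a ^ 2 + 2 * c + b ^ 2) := by
    rw [← norm_add_sq_real, Real.sqrt_sq (norm_nonneg _)]
  -- `‖s + x‖²` lies on the segment from `(a - b)²` to `(a + b)²`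
  have h1 : 0 ≤ (1 + c / (a * b)) / 2 := by
    have : -1 ≤ c / (a * b) := by rw [le_div_iff₀ hab]; linarith
    linarith
  have h2 : 0 ≤ (1 - c / (a * b)) / 2 := by
    have : c / (a * b) ≤ 1 := by rw [div_le_iff₀ hab]; linarith
    linarith
  have hconv := convexOn_cosh_sqrt.2 (Set.mem_Ici.2 (sq_nonneg (a + b)))
    (Set.mem_Ici.2 (sq_nonneg (a - b))) h1 h2 (by ring)
  have e : ((1 + c / (a * b)) / 2) • (a + b) ^ 2 + ((1 - c / (a * b)) / 2) • (a - b) ^ 2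
      = a ^ 2 + 2 * c + b ^ 2 := by
    simp only [smul_eq_mul]
    field_simp
    ring
  rw [e] at hconv
  simp only [Real.sqrt_sq_eq_abs, Real.cosh_abs, smul_eq_mul, Real.cosh_add, Real.cosh_sub]
    at hconv
  rw [hn]
  refine hconv.trans_eq ?_
  field_simp
  ring

/-- A bound for `cosh ‖s + x‖` in which only the first term depends on the direction of `x`. -/
theorem cosh_norm_add_le' (s x : V) :
    Real.cosh ‖s + x‖ ≤ (Real.sinh ‖s‖ / ‖s‖) * inner ℝ s x
      + Real.cosh ‖s‖ * (2 * Real.cosh ‖x‖ - 1) := by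
  have h0 : 0 ≤ Real.cosh ‖s‖ * (Real.cosh ‖x‖ - 1) :=
    mul_nonneg (Real.cosh_pos _).le (by linarith [Real.one_le_cosh ‖x‖])
  refine (cosh_norm_add_le s x).trans ?_
  rcases eq_or_ne s 0 with rfl | hs
  · simp only [norm_zero, Real.cosh_zero, inner_zero_left] at h0 ⊢
    linarith
  rcases eq_or_ne x 0 with rfl | hx
  · simp only [norm_zero, Real.cosh_zero, inner_zero_right] at h0 ⊢
    linarith
  have ha : 0 < ‖s‖ := norm_pos_iff.2 hs
  have hb : 0 < ‖x‖ := norm_pos_iff.2 hx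
  have hc : inner ℝ s x ≤ ‖s‖ * ‖x‖ := real_inner_le_norm s x
  set a := ‖s‖
  set b := ‖x‖
  set c := inner ℝ s x
  have hsb : b ≤ Real.sinh b := Real.self_le_sinh_iff.2 hb.le
  have hsa : 0 ≤ Real.sinh a := Real.sinh_nonneg_iff.2 ha.le
  have h1 : c * (Real.sinh a / a) * (Real.sinh b / b)
      ≤ Real.sinh a / a * c + Real.sinh a * (Real.sinh b - b) := by
    have h2 : c * (Real.sinh a / a) * (Real.sinh b / b) - Real.sinh a / a * c
        = c * (Real.sinh a / a * ((Real.sinh b - b) / b)) := by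
      field_simp
    have h3 : c * (Real.sinh a / a * ((Real.sinh b - b) / b))
        ≤ a * b * (Real.sinh a / a * ((Real.sinh b - b) / b)) := by
      refine mul_le_mul_of_nonneg_right hc ?_
      have : 0 ≤ Real.sinh b - b := by linarith
      positivity
    have h4 : a * b * (Real.sinh a / a * ((Real.sinh b - b) / b))
        = Real.sinh a * (Real.sinh b - b) := by
      field_simp
    linarith
  have h5 : Real.sinh b - b ≤ Real.cosh b - 1 := by
    have := Real.cosh_sub_sinh b
    have := Real.add_one_le_exp (-b)
    linarith
  have h6 : Real.sinh a * (Real.sinh b - b) ≤ Real.cosh a * (Real.cosh b - 1) :=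
    mul_le_mul (Real.sinh_lt_cosh a).le h5 (by linarith) (Real.cosh_pos a).le
  linarith

variable {α : Type*} [MeasurableSpace α] {P : Measure α} [IsProbabilityMeasure P] {Φ : α → V}

/-- Adding a centred random vector multiplies the mean of `cosh ‖·‖` by at most
`E (2 cosh ‖Φ‖ - 1)`. -/
theorem lintegral_cosh_norm_add_le (hΦ : StronglyMeasurable Φ)
    (hint : Integrable (fun z => Real.cosh ‖Φ z‖) P)
    (hmean : ∀ v : V, Integrable (fun z => inner ℝ v (Φ z)) P ∧ ∫ z, inner ℝ v (Φ z) ∂P = 0)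
    (s : V) :
    ∫⁻ z, ENNReal.ofReal (Real.cosh ‖s + Φ z‖) ∂P
      ≤ ENNReal.ofReal (Real.cosh ‖s‖ * ∫ z, (2 * Real.cosh ‖Φ z‖ - 1) ∂P) := by
  obtain ⟨hi1, hi2⟩ := hmean s
  have hi5 : Integrable (fun z => Real.cosh ‖s‖ * (2 * Real.cosh ‖Φ z‖ - 1)) P :=
    ((hint.const_mul 2).sub (integrable_const 1)).const_mul _
  have hi3 : Integrable (fun z => Real.sinh ‖s‖ / ‖s‖ * inner ℝ s (Φ z)
      + Real.cosh ‖s‖ * (2 * Real.cosh ‖Φ z‖ - 1)) P := (hi1.const_mul _).add hi5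
  have hi4 : Integrable (fun z => Real.cosh ‖s + Φ z‖) P := by
    refine hi3.mono' ?_ (.of_forall fun z => ?_)
    · exact (Real.continuous_cosh.comp_stronglyMeasurable
        (stronglyMeasurable_const.add hΦ).norm).aestronglyMeasurable
    · rw [Real.norm_eq_abs, abs_of_pos (Real.cosh_pos _)]
      exact cosh_norm_add_le' s (Φ z)
  rw [← ofReal_integral_eq_lintegral_ofReal hi4 (.of_forall fun z => (Real.cosh_pos _).le)]
  refine ENNReal.ofReal_le_ofReal ?_
  refine (integral_mono hi4 hi3 fun z => cosh_norm_add_le' s (Φ z)).trans_eq ?_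
  rw [integral_add (hi1.const_mul _) hi5,
    integral_const_mul, integral_const_mul, hi2, mul_zero, zero_add]

theorem lintegral_pi_cosh_norm_sum_le (hΦ : StronglyMeasurable Φ)
    (hint : Integrable (fun z => Real.cosh ‖Φ z‖) P)
    (hmean : ∀ v : V, Integrable (fun z => inner ℝ v (Φ z)) P ∧ ∫ z, inner ℝ v (Φ z) ∂P = 0)
    (n : ℕ) (s : V) :
    ∫⁻ z : Fin n → α, ENNReal.ofReal (Real.cosh ‖s + ∑ i, Φ (z i)‖) ∂(Measure.pi fun _ => P)
      ≤ ENNReal.ofReal (Real.cosh ‖s‖ * (∫ z, (2 * Real.cosh ‖Φ z‖ - 1) ∂P) ^ n) := by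
  set C := ∫ z, (2 * Real.cosh ‖Φ z‖ - 1) ∂P with hC
  have hC0 : 0 ≤ C := integral_nonneg fun z => by
    have := Real.one_le_cosh ‖Φ z‖
    simp only [Pi.zero_apply]
    linarith
  induction n generalizing s with
  | zero => simp
  | succ n ih =>
    have hmp := (measurePreserving_piFinSuccAbove (fun _ : Fin (n + 1) => P) 0).symm
    rw [← hmp.lintegral_comp_emb (MeasurableEquiv.measurableEmbedding _)]
    simp_rw [MeasurableEquiv.piFinSuccAbove_symm_apply, Fin.insertNthEquiv, Fin.sum_univ_succ,
      Equiv.coe_fn_mk, Fin.insertNth_zero, Fin.cons_zero, Fin.cons_succ]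
    have hsm : StronglyMeasurable fun z : α × (Fin n → α) => s + (Φ z.1 + ∑ i, Φ (z.2 i)) :=
      stronglyMeasurable_const.add ((hΦ.comp_measurable measurable_fst).add
        (Finset.stronglyMeasurable_fun_sum _ fun i _ =>
          hΦ.comp_measurable ((measurable_pi_apply i).comp measurable_snd)))
    change ∫⁻ a : α × (Fin n → α), ENNReal.ofReal
      (Real.cosh ‖s + (Φ a.1 + ∑ i, Φ (a.2 i))‖) ∂(P.prod (Measure.pi fun _ => P)) ≤ _
    rw [lintegral_prod _ ((Real.continuous_cosh.comp_stronglyMeasurable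
      hsm.norm).measurable.ennreal_ofReal.aemeasurable)]
    calc _ ≤ ∫⁻ z, ENNReal.ofReal (Real.cosh ‖s + Φ z‖ * C ^ n) ∂P := by
          refine lintegral_mono fun z => ?_
          simp_rw [← add_assoc]
          exact ih (s + Φ z)
      _ = (∫⁻ z, ENNReal.ofReal (Real.cosh ‖s + Φ z‖) ∂P) * ENNReal.ofReal (C ^ n) := by
          simp_rw [ENNReal.ofReal_mul (Real.cosh_pos _).le]
          exact lintegral_mul_const' _ _ ENNReal.ofReal_ne_top
      _ ≤ ENNReal.ofReal (Real.cosh ‖s‖ * C) * ENNReal.ofReal (C ^ n) := by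
          gcongr
          exact lintegral_cosh_norm_add_le hΦ hint hmean s
      _ = _ := by
          rw [← ENNReal.ofReal_mul (mul_nonneg (Real.cosh_pos _).le hC0)]
          congr 1
          ring

theorem hasSum_one_add_geometric (c : ℝ) :
    HasSum (fun j : ℕ => if j = 0 then (1 : ℝ) else c * (1 / 4) ^ j) (1 + c * (1 / 3)) := by
  have h1 := (hasSum_geometric_of_lt_one (r := (1 : ℝ) / 4) (by norm_num) (by norm_num)).mul_left
    (c * (1 / 4))
  have h2 : HasSum (fun j : ℕ => if j + 1 = 0 then (1 : ℝ) else c * (1 / 4) ^ (j + 1))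
      (c * (1 / 3)) := by
    have e1 : (fun j : ℕ => if j + 1 = 0 then (1 : ℝ) else c * (1 / 4) ^ (j + 1))
        = fun j => c * (1 / 4) * (1 / 4) ^ j := by
      funext j
      rw [if_neg (Nat.succ_ne_zero j), pow_succ]
      ring
    have e2 : c * (1 / 4) * (1 - 1 / 4)⁻¹ = c * (1 / 3) := by
      rw [mul_assoc]
      congr 1
      norm_num
    rw [e1, ← e2]
    exact h1
  have h3 := (hasSum_nat_add_iff (f := fun j : ℕ => if j = 0 then (1 : ℝ) else c * (1 / 4) ^ j)
    1).1 h2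
  rw [Finset.sum_range_one, if_pos rfl, add_comm] at h3
  exact h3

/-- Bounds on the even moments control the exponential moment. -/
theorem integral_cosh_le (hΦ : StronglyMeasurable Φ) {B L θ : ℝ} (hL : 0 ≤ L)
    (hθ : 0 ≤ θ) (hθL : θ * L ≤ 1 / 2)
    (hmom : ∀ j : ℕ, ∫⁻ z, ENNReal.ofReal (‖Φ z‖ ^ (2 * (j + 1))) ∂P
      ≤ ENNReal.ofReal (1 / 2 * ((2 * (j + 1))! : ℝ) * B ^ 2 * L ^ (2 * j))) :
    Integrable (fun z => Real.cosh ‖θ • Φ z‖) P ∧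
      ∫ z, (2 * Real.cosh ‖θ • Φ z‖ - 1) ∂P ≤ Real.exp (4 / 3 * (θ * B) ^ 2) := by
  have hterm : ∀ j : ℕ, ∫⁻ z, ENNReal.ofReal (‖θ • Φ z‖ ^ (2 * j) / ((2 * j)! : ℝ)) ∂P
      ≤ ENNReal.ofReal (if j = 0 then 1 else 2 * (θ * B) ^ 2 * (1 / 4) ^ j) := by
    intro j
    rcases j with _ | j
    · simp
    · have hθ2 : 0 ≤ θ ^ (2 * (j + 1)) / ((2 * (j + 1))! : ℝ) := by positivity
      have e : ∀ z, ENNReal.ofReal (‖θ • Φ z‖ ^ (2 * (j + 1)) / ((2 * (j + 1))! : ℝ))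
          = ENNReal.ofReal (θ ^ (2 * (j + 1)) / ((2 * (j + 1))! : ℝ))
            * ENNReal.ofReal (‖Φ z‖ ^ (2 * (j + 1))) := by
        intro z
        rw [← ENNReal.ofReal_mul hθ2, norm_smul, Real.norm_eq_abs, abs_of_nonneg hθ, mul_pow]
        congr 1
        ring
      simp_rw [e]
      rw [lintegral_const_mul' _ _ ENNReal.ofReal_ne_top]
      refine (mul_le_mul_right (hmom j) _).trans ?_
      rw [← ENNReal.ofReal_mul hθ2]
      refine ENNReal.ofReal_le_ofReal ?_
      rw [if_neg (Nat.succ_ne_zero j)]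
      have h1 : (θ * L) ^ (2 * j) ≤ (1 / 4) ^ j := by
        calc (θ * L) ^ (2 * j) ≤ (1 / 2) ^ (2 * j) := by gcongr
          _ = _ := by rw [pow_mul]; norm_num
      calc θ ^ (2 * (j + 1)) / ((2 * (j + 1))! : ℝ)
            * (1 / 2 * ((2 * (j + 1))! : ℝ) * B ^ 2 * L ^ (2 * j))
          = 1 / 2 * (θ * B) ^ 2 * (θ * L) ^ (2 * j) := by
            field_simp
            ring
        _ ≤ 1 / 2 * (θ * B) ^ 2 * (1 / 4) ^ j := by gcongr
        _ = _ := by ring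
  have hsum := hasSum_one_add_geometric (2 * (θ * B) ^ 2)
  have hmeas : ∀ j : ℕ, AEMeasurable
      (fun z => ENNReal.ofReal (‖θ • Φ z‖ ^ (2 * j) / ((2 * j)! : ℝ))) P := fun j =>
    ((((hΦ.const_smul θ).norm.measurable.pow_const _).div_const _).ennreal_ofReal).aemeasurable
  have hlin : ∫⁻ z, ENNReal.ofReal (Real.cosh ‖θ • Φ z‖) ∂P
      ≤ ENNReal.ofReal (1 + 2 * (θ * B) ^ 2 * (1 / 3)) := by
    calc ∫⁻ z, ENNReal.ofReal (Real.cosh ‖θ • Φ z‖) ∂P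
        = ∫⁻ z, ∑' j : ℕ, ENNReal.ofReal (‖θ • Φ z‖ ^ (2 * j) / ((2 * j)! : ℝ)) ∂P := by
          refine lintegral_congr fun z => ?_
          rw [← (Real.hasSum_cosh ‖θ • Φ z‖).tsum_eq, ENNReal.ofReal_tsum_of_nonneg
            (fun j => by positivity) (Real.hasSum_cosh ‖θ • Φ z‖).summable]
      _ = ∑' j : ℕ, ∫⁻ z, ENNReal.ofReal (‖θ • Φ z‖ ^ (2 * j) / ((2 * j)! : ℝ)) ∂P :=
          lintegral_tsum hmeas
      _ ≤ ∑' j : ℕ, ENNReal.ofReal (if j = 0 then 1 else 2 * (θ * B) ^ 2 * (1 / 4) ^ j) :=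
          ENNReal.tsum_le_tsum hterm
      _ = _ := by
          rw [← hsum.tsum_eq, ENNReal.ofReal_tsum_of_nonneg _ hsum.summable]
          intro j
          split_ifs <;> positivity
  have hint : Integrable (fun z => Real.cosh ‖θ • Φ z‖) P := by
    refine ⟨(Real.continuous_cosh.comp_stronglyMeasurable
      (hΦ.const_smul θ).norm).aestronglyMeasurable, ?_⟩
    rw [hasFiniteIntegral_iff_ofReal (.of_forall fun z => (Real.cosh_pos _).le)]
    exact hlin.trans_lt ENNReal.ofReal_lt_top
  refine ⟨hint, ?_⟩
  rw [← ofReal_integral_eq_lintegral_ofReal hint (.of_forall fun z => (Real.cosh_pos _).le),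
    ENNReal.ofReal_le_ofReal_iff (by positivity)] at hlin
  rw [integral_sub (hint.const_mul 2) (integrable_const 1), integral_const_mul]
  simp only [integral_const, probReal_univ, smul_eq_mul, mul_one]
  have := Real.add_one_le_exp (4 / 3 * (θ * B) ^ 2)
  linarith

/-- **Bernstein's inequality** for sums of independent centred random vectors in an inner product
space. -/
theorem measure_norm_sum_ge_le (hΦ : StronglyMeasurable Φ) {B L : ℝ} (hB : 0 ≤ B) (hL : 0 < L)
    (hmom : ∀ j : ℕ, ∫⁻ z, ENNReal.ofReal (‖Φ z‖ ^ (2 * (j + 1))) ∂P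
      ≤ ENNReal.ofReal (1 / 2 * ((2 * (j + 1))! : ℝ) * B ^ 2 * L ^ (2 * j)))
    (hmean : ∀ v : V, Integrable (fun z => inner ℝ v (Φ z)) P ∧ ∫ z, inner ℝ v (Φ z) ∂P = 0)
    {n : ℕ} {Ω : Type*} [MeasurableSpace Ω] {μ : Measure Ω} [IsProbabilityMeasure μ]
    {W : Fin n → Ω → α} (hW : ∀ i, Measurable (W i)) (hindep : iIndepFun W μ)
    (hlaw : ∀ i, μ.map (W i) = P) (x : ℝ) :
    μ {ω | (2 * L + B * √n) * x ≤ ‖∑ i, Φ (W i ω)‖}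
      ≤ ENNReal.ofReal (2 * Real.exp (4 / 3) * Real.exp (-x)) := by
  have hden : 0 < 2 * L + B * √n := by positivity
  set θ := 1 / (2 * L + B * √n) with hθ
  have hθ0 : 0 < θ := by positivity
  have hθL : θ * L ≤ 1 / 2 := by
    rw [hθ, one_div_mul_eq_div, div_le_iff₀ hden]
    have : 0 ≤ B * √n := by positivity
    linarith
  have hθB : (θ * B) ^ 2 * n ≤ 1 := by
    have h1 : θ * (B * √n) ≤ 1 := by
      rw [hθ, one_div_mul_eq_div, div_le_one hden]
      linarith
    have h2 : (θ * B) ^ 2 * n = (θ * (B * √n)) ^ 2 := by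
      rw [mul_pow, mul_pow, mul_pow, Real.sq_sqrt (Nat.cast_nonneg n), mul_assoc]
    rw [h2]
    exact pow_le_one₀ (by positivity) h1
  obtain ⟨hint, hC⟩ := integral_cosh_le (P := P) hΦ hL.le hθ0.le hθL hmom
  set Φ' : α → V := fun z => θ • Φ z with hΦ'
  have hΦ's : StronglyMeasurable Φ' := hΦ.const_smul θ
  have hmean' : ∀ v : V, Integrable (fun z => inner ℝ v (Φ' z)) P ∧
      ∫ z, inner ℝ v (Φ' z) ∂P = 0 := by
    intro v
    obtain ⟨h1, h2⟩ := hmean v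
    simp only [hΦ', inner_smul_right]
    exact ⟨h1.const_mul θ, by rw [integral_const_mul, h2, mul_zero]⟩
  have hpi := lintegral_pi_cosh_norm_sum_le hΦ's hint hmean' n 0
  have hmap : μ.map (fun ω i => W i ω) = Measure.pi fun _ => P := by
    rw [(iIndepFun_iff_map_fun_eq_pi_map fun i => (hW i).aemeasurable).1 hindep]
    simp_rw [hlaw]
  have hsm : StronglyMeasurable fun z : Fin n → α => ∑ i, Φ' (z i) :=
    Finset.stronglyMeasurable_fun_sum _ fun i _ => hΦ's.comp_measurable (measurable_pi_apply i)
  have hmeas : Measurable fun z : Fin n → α => ENNReal.ofReal (Real.cosh ‖∑ i, Φ' (z i)‖) :=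
    (Real.continuous_cosh.comp_stronglyMeasurable hsm.norm).measurable.ennreal_ofReal
  simp only [zero_add, norm_zero, Real.cosh_zero, one_mul] at hpi
  rw [← hmap, lintegral_map hmeas (measurable_pi_lambda _ hW)] at hpi
  have hCn : (∫ z, (2 * Real.cosh ‖Φ' z‖ - 1) ∂P) ^ n ≤ Real.exp (4 / 3) := by
    have hC0 : 0 ≤ ∫ z, (2 * Real.cosh ‖Φ' z‖ - 1) ∂P := integral_nonneg fun z => by
      have := Real.one_le_cosh ‖Φ' z‖
      simp only [Pi.zero_apply]
      linarith
    calc _ ≤ (Real.exp (4 / 3 * (θ * B) ^ 2)) ^ n := pow_le_pow_left₀ hC0 hC n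
      _ = Real.exp (4 / 3 * ((θ * B) ^ 2 * n)) := by
          rw [← Real.exp_nat_mul]
          congr 1
          ring
      _ ≤ _ := Real.exp_le_exp.2 (by linarith)
  have hsub : {ω | (2 * L + B * √n) * x ≤ ‖∑ i, Φ (W i ω)‖}
      ⊆ {ω | ENNReal.ofReal (Real.exp x / 2)
        ≤ ENNReal.ofReal (Real.cosh ‖∑ i, Φ' (W i ω)‖)} := by
    intro ω hω
    simp only [Set.mem_ofPred_eq] at hω ⊢
    refine ENNReal.ofReal_le_ofReal ?_
    have h1 : x ≤ ‖∑ i, Φ' (W i ω)‖ := by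
      simp only [hΦ', ← Finset.smul_sum, norm_smul, Real.norm_eq_abs, abs_of_pos hθ0]
      rw [hθ, one_div_mul_eq_div, le_div_iff₀ hden, mul_comm]
      exact hω
    have h2 := Real.exp_le_exp.2 h1
    have h3 := (Real.exp_pos (-‖∑ i, Φ' (W i ω)‖)).le
    rw [Real.cosh_eq]
    linarith
  refine (measure_mono hsub).trans ?_
  refine (meas_ge_le_lintegral_div (hmeas.comp (measurable_pi_lambda _ hW)).aemeasurable
    (ENNReal.ofReal_pos.2 (by positivity)).ne' ENNReal.ofReal_ne_top).trans ?_
  refine ENNReal.div_le_of_le_mul ?_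
  rw [← ENNReal.ofReal_mul (by positivity)]
  refine hpi.trans (ENNReal.ofReal_le_ofReal (hCn.trans_eq ?_))
  rw [Real.exp_neg]
  field_simp

end Bernstein

/-! ### Resolvents, energy norms and traces -/

section EnergyNorm

variable {E : Type*} [NormedAddCommGroup E] [InnerProductSpace ℝ E] [CompleteSpace E]
variable {H : Type*} [NormedAddCommGroup H] [InnerProductSpace ℝ H] [CompleteSpace H]
variable {lam : ℝ}

theorem isUnit_add_smul_one {A : E →L[ℝ] E} (hA : ∀ x, 0 ≤ inner ℝ (A x) x) (hlam : 0 < lam) :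
    IsUnit (A + lam • (1 : E →L[ℝ] E)) := by
  refine ContinuousLinearMap.isUnit_of_forall_le_norm_inner_map _ (c := ⟨lam, hlam.le⟩) hlam
    fun x => ?_
  refine le_trans ?_ (le_abs_self _)
  change ‖x‖ ^ 2 * lam ≤ _
  simp only [FunLike.coe_add, Pi.add_apply, FunLike.coe_smul, Pi.smul_apply,
    FunLike.coe_one_eq_id, id_eq, inner_add_left, inner_smul_left, conj_trivial,
    real_inner_self_eq_norm_sq]
  linarith [hA x]

/-- The resolvent `(T* T + lam)⁻¹`. -/
noncomputable def resolvent (T : H →L[ℝ] E) (lam : ℝ) : H →L[ℝ] H :=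
  Ring.inverse (T.adjoint ∘L T + lam • (1 : H →L[ℝ] H))

variable {T : H →L[ℝ] E}

theorem inner_gram_add (g h : H) :
    inner ℝ ((T.adjoint ∘L T + lam • (1 : H →L[ℝ] H)) g) h
      = inner ℝ (T g) (T h) + lam * inner ℝ g h := by
  simp [inner_add_left, inner_smul_left, ContinuousLinearMap.adjoint_inner_left]

theorem isUnit_gram_add (hlam : 0 < lam) :
    IsUnit (T.adjoint ∘L T + lam • (1 : H →L[ℝ] H)) :=
  isUnit_add_smul_one (fun x => by
    rw [ContinuousLinearMap.comp_apply, ContinuousLinearMap.adjoint_inner_left]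
    exact real_inner_self_nonneg) hlam

theorem gram_add_resolvent (hlam : 0 < lam) (h : H) :
    (T.adjoint ∘L T + lam • (1 : H →L[ℝ] H)) (resolvent T lam h) = h := by
  have := Ring.mul_inverse_cancel _ (isUnit_gram_add (T := T) hlam)
  exact DFunLike.congr_fun this h

theorem inner_resolvent (hlam : 0 < lam) (g h : H) :
    inner ℝ (T (resolvent T lam g)) (T h) + lam * inner ℝ (resolvent T lam g) h = inner ℝ g h := by
  rw [← inner_gram_add, gram_add_resolvent hlam]

theorem inner_resolvent_comm (hlam : 0 < lam) (g h : H) :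
    inner ℝ (resolvent T lam g) h = inner ℝ g (resolvent T lam h) := by
  rw [← inner_resolvent (T := T) hlam g, real_inner_comm, ← inner_resolvent (T := T) hlam h,
    real_inner_comm (T _), real_inner_comm (resolvent T lam g)]

/-- The map `h ↦ (T h, √lam • h)`, for which `‖energyMap h‖² = ‖T h‖² + lam ‖h‖²`. -/
noncomputable def energyMap (T : H →L[ℝ] E) (lam : ℝ) : H →L[ℝ] WithLp 2 (E × H) :=
  (WithLp.prodContinuousLinearEquiv 2 ℝ E H).symm.toContinuousLinearMap ∘L
    (T.prod (√lam • ContinuousLinearMap.id ℝ H))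

theorem inner_energyMap (hlam : 0 ≤ lam) (g h : H) :
    inner ℝ (energyMap T lam g) (energyMap T lam h)
      = inner ℝ (T g) (T h) + lam * inner ℝ g h := by
  simp only [energyMap, ContinuousLinearMap.comp_apply, WithLp.prod_inner_apply]
  simp only [ContinuousLinearEquiv.coe_coe, WithLp.prodContinuousLinearEquiv_symm_apply,
    ContinuousLinearMap.prod_apply, FunLike.coe_smul, Pi.smul_apply,
    ContinuousLinearMap.coe_id', id_eq, inner_smul_left, inner_smul_right, conj_trivial]
  rw [← mul_assoc, Real.mul_self_sqrt hlam]

/-- The closure of the range of `energyMap`, as a Hilbert space: the completion of `H` for the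
energy norm `(‖T h‖² + lam ‖h‖²)^(1/2)`. Unlike the ambient space it is separable when `H` is. -/
def EnergySpace (T : H →L[ℝ] E) (lam : ℝ) : Type _ :=
  ((energyMap T lam).range.topologicalClosure : Submodule ℝ (WithLp 2 (E × H)))

noncomputable instance (T : H →L[ℝ] E) (lam : ℝ) : NormedAddCommGroup (EnergySpace T lam) :=
  inferInstanceAs (NormedAddCommGroup
    ((energyMap T lam).range.topologicalClosure : Submodule ℝ (WithLp 2 (E × H))))

noncomputable instance (T : H →L[ℝ] E) (lam : ℝ) : InnerProductSpace ℝ (EnergySpace T lam) :=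
  inferInstanceAs (InnerProductSpace ℝ
    ((energyMap T lam).range.topologicalClosure : Submodule ℝ (WithLp 2 (E × H))))

instance (T : H →L[ℝ] E) (lam : ℝ) : CompleteSpace (EnergySpace T lam) :=
  (Submodule.isClosed_topologicalClosure (energyMap T lam).range).completeSpace_coe

instance (T : H →L[ℝ] E) (lam : ℝ) [TopologicalSpace.SeparableSpace H] :
    TopologicalSpace.SeparableSpace (EnergySpace T lam) := by
  have h : TopologicalSpace.IsSeparable (Set.range (energyMap T lam)) :=
    TopologicalSpace.isSeparable_range (energyMap T lam).continuous
  exact h.closure.separableSpace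

/-- `energyMap` with values in `EnergySpace`. -/
noncomputable def toEnergy (T : H →L[ℝ] E) (lam : ℝ) : H →L[ℝ] EnergySpace T lam :=
  (energyMap T lam).codRestrict ((energyMap T lam).range.topologicalClosure) fun h =>
    Submodule.le_topologicalClosure _ (LinearMap.mem_range_self _ h)

theorem inner_toEnergy (hlam : 0 ≤ lam) (g h : H) :
    inner ℝ (toEnergy T lam g) (toEnergy T lam h) = inner ℝ (T g) (T h) + lam * inner ℝ g h :=
  inner_energyMap hlam g h

theorem norm_toEnergy_sq (hlam : 0 ≤ lam) (h : H) :
    ‖toEnergy T lam h‖ ^ 2 = ‖T h‖ ^ 2 + lam * ‖h‖ ^ 2 := by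
  rw [← real_inner_self_eq_norm_sq, inner_toEnergy hlam, real_inner_self_eq_norm_sq,
    real_inner_self_eq_norm_sq]

theorem inner_toEnergy_resolvent (hlam : 0 < lam) (g h : H) :
    inner ℝ (toEnergy T lam (resolvent T lam g)) (toEnergy T lam h) = inner ℝ g h := by
  rw [inner_toEnergy hlam.le, inner_resolvent hlam]

theorem norm_toEnergy_resolvent_sq_le (hlam : 0 < lam) (g : H) :
    ‖toEnergy T lam (resolvent T lam g)‖ ^ 2 ≤ ‖g‖ ^ 2 / lam := by
  set y := resolvent T lam g
  have h1 : ‖toEnergy T lam y‖ ^ 2 = inner ℝ g y := by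
    rw [← real_inner_self_eq_norm_sq, inner_toEnergy_resolvent hlam]
  have h2 : lam * ‖y‖ ^ 2 ≤ ‖toEnergy T lam y‖ ^ 2 := by
    rw [norm_toEnergy_sq hlam.le]
    linarith [sq_nonneg ‖T y‖]
  have h3 : inner ℝ g y ≤ ‖g‖ * ‖y‖ := real_inner_le_norm g y
  rw [le_div_iff₀ hlam]
  have h4 : (lam * ‖y‖) ^ 2 ≤ ‖g‖ ^ 2 := by
    rcases (norm_nonneg y).eq_or_lt with h0 | h0
    · rw [← h0]; simp
    · have : lam * ‖y‖ ≤ ‖g‖ := by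
        refine le_of_mul_le_mul_right ?_ h0
        nlinarith
      exact pow_le_pow_left₀ (by positivity) this 2
  have h5 : lam * ‖y‖ ≤ ‖g‖ := (pow_le_pow_iff_left₀ (by positivity) (by positivity)
    two_ne_zero).1 h4
  rw [h1]
  nlinarith [norm_nonneg g]

/-- The identity `T (T* T + lam)⁻¹ T* = T T* (T T* + lam)⁻¹`. -/
theorem comp_resolvent_comp_adjoint (hlam : 0 < lam) :
    T ∘L resolvent T lam ∘L T.adjoint
      = (T ∘L T.adjoint) * Ring.inverse (T ∘L T.adjoint + lam • (1 : E →L[ℝ] E)) := by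
  have hu : IsUnit (T ∘L T.adjoint + lam • (1 : E →L[ℝ] E)) :=
    isUnit_add_smul_one (fun x => by
      rw [ContinuousLinearMap.comp_apply, ← ContinuousLinearMap.adjoint_inner_right]
      exact real_inner_self_nonneg) hlam
  have h1 : (T ∘L resolvent T lam ∘L T.adjoint) * (T ∘L T.adjoint + lam • (1 : E →L[ℝ] E))
      = T ∘L T.adjoint := by
    refine ContinuousLinearMap.ext fun x => ?_
    have h2 : resolvent T lam ((T.adjoint ∘L T + lam • (1 : H →L[ℝ] H)) (T.adjoint x))
        = T.adjoint x := by
      have := Ring.inverse_mul_cancel _ (isUnit_gram_add (T := T) hlam)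
      exact DFunLike.congr_fun this (T.adjoint x)
    have h3 : T.adjoint ((T ∘L T.adjoint + lam • (1 : E →L[ℝ] E)) x)
        = (T.adjoint ∘L T + lam • (1 : H →L[ℝ] H)) (T.adjoint x) := by
      simp
    change T (resolvent T lam (T.adjoint ((T ∘L T.adjoint + lam • (1 : E →L[ℝ] E)) x)))
      = T (T.adjoint x)
    rw [h3, h2]
  calc _ = (T ∘L resolvent T lam ∘L T.adjoint) * (T ∘L T.adjoint + lam • (1 : E →L[ℝ] E))
        * Ring.inverse (T ∘L T.adjoint + lam • (1 : E →L[ℝ] E)) := by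
        rw [mul_assoc, Ring.mul_inverse_cancel _ hu, mul_one]
    _ = _ := by rw [h1]

/-- The squared Hilbert-Schmidt norm of `L` is at most the trace of `L L*`. -/
theorem sum_norm_sq_le_posTrace {V : Type*} [NormedAddCommGroup V] [InnerProductSpace ℝ V]
    [CompleteSpace V] (L : V →L[ℝ] E) {ι : Type*} {v : ι → V} (hv : Orthonormal ℝ v)
    (s : Finset ι) :
    ∑ i ∈ s, ENNReal.ofReal (‖L (v i)‖ ^ 2) ≤ posTrace (L ∘L L.adjoint) := by
  classical
  set U : Submodule ℝ E := Submodule.span ℝ (s.image fun i => L (v i) : Finset E) with hU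
  have : FiniteDimensional ℝ U := FiniteDimensional.span_finset ℝ _
  set ψ := stdOrthonormalBasis ℝ U
  have hinj : Function.Injective fun k => (ψ k : E) :=
    Subtype.val_injective.comp ψ.toBasis.injective
  set t : Finset E := Finset.univ.image fun k => (ψ k : E) with ht
  have hψ : Orthonormal ℝ fun k => (ψ k : E) := by
    have := ψ.orthonormal
    exact this.comp_linearIsometry U.subtypeₗᵢ
  have htorth : Orthonormal ℝ (Subtype.val : t → E) := by
    have h1 : Orthonormal ℝ (Subtype.val : Set.range (fun k => (ψ k : E)) → E) := hψ.toSubtypeRange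
    have h2 : ∀ x : t, (x : E) ∈ Set.range fun k => (ψ k : E) := fun x => by
      obtain ⟨k, -, hk⟩ := Finset.mem_image.1 x.2
      exact ⟨k, hk⟩
    exact h1.comp (fun x : t => ⟨x, h2 x⟩) fun x y hxy => Subtype.ext (Subtype.mk.inj hxy)
  rw [posTrace]
  refine le_trans ?_ (le_iSup₂ t htorth)
  have hin : ∀ e : E, inner ℝ e ((L ∘L L.adjoint) e) = ‖L.adjoint e‖ ^ 2 := by
    intro e
    rw [ContinuousLinearMap.comp_apply, ← ContinuousLinearMap.adjoint_inner_left,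
      real_inner_self_eq_norm_sq]
  simp_rw [hin]
  rw [ht, Finset.sum_image hinj.injOn, ← ENNReal.ofReal_sum_of_nonneg (fun i _ => sq_nonneg _),
    ← ENNReal.ofReal_sum_of_nonneg (fun i _ => sq_nonneg _)]
  refine ENNReal.ofReal_le_ofReal ?_
  calc ∑ i ∈ s, ‖L (v i)‖ ^ 2 = ∑ i ∈ s, ∑ k, (inner ℝ (v i) (L.adjoint (ψ k : E))) ^ 2 := by
        refine Finset.sum_congr rfl fun i hi => ?_
        have hmem : L (v i) ∈ U := Submodule.subset_span
          (Finset.mem_coe.2 (Finset.mem_image_of_mem _ hi))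
        have h1 := ψ.sum_sq_norm_inner_left ⟨L (v i), hmem⟩
        change _ = ‖L (v i)‖ ^ 2 at h1
        rw [← h1]
        refine Finset.sum_congr rfl fun k _ => ?_
        rw [ContinuousLinearMap.adjoint_inner_right, Real.norm_eq_abs, sq_abs]
        rfl
    _ = ∑ k, ∑ i ∈ s, (inner ℝ (v i) (L.adjoint (ψ k : E))) ^ 2 := Finset.sum_comm
    _ ≤ ∑ k, ‖L.adjoint (ψ k : E)‖ ^ 2 := by
        refine Finset.sum_le_sum fun k _ => ?_
        have := hv.sum_inner_products_le (L.adjoint (ψ k : E)) (s := s)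
        simpa only [Real.norm_eq_abs, sq_abs] using this

theorem countable_of_orthonormal [TopologicalSpace.SeparableSpace E] {ι : Type*} {v : ι → E}
    (hv : Orthonormal ℝ v) : Countable ι := by
  have hdisj : Pairwise (Function.onFun Disjoint fun i => Metric.ball (v i) (1 / 2)) := by
    intro i j hij
    refine Metric.ball_disjoint_ball ?_
    have h1 : ‖v i - v j‖ ^ 2 = 2 := by
      rw [norm_sub_sq_real, hv.1 i, hv.1 j, hv.2 hij]
      norm_num
    rw [dist_eq_norm]
    nlinarith [norm_nonneg (v i - v j)]
  have h := Set.PairwiseDisjoint.countable_of_isOpen (a := Set.univ)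
    (s := fun i => Metric.ball (v i) (1 / 2)) (hdisj.set_pairwise _)
    (fun i _ => Metric.isOpen_ball) (fun i _ => ⟨v i, Metric.mem_ball_self (by norm_num)⟩)
  exact Set.countable_univ_iff.1 h

end EnergyNorm

/-! ### The source condition in the reproducing kernel Hilbert space -/

section Source

variable {E : Type*} [NormedAddCommGroup E] [InnerProductSpace ℝ E] [CompleteSpace E]
variable {H : Type*} [NormedAddCommGroup H] [InnerProductSpace ℝ H] [CompleteSpace H]

/-- The orthogonal projection onto the eigenspace of `A` for `ξ`. -/
noncomputable abbrev eigenProj (A : E →L[ℝ] E) (ξ : ℝ) : E →L[ℝ] E :=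
  (A - ξ • (1 : E →L[ℝ] E)).ker.starProjection

theorem apply_eigenProj (A : E →L[ℝ] E) (ξ : ℝ) (x : E) :
    A (eigenProj A ξ x) = ξ • eigenProj A ξ x := by
  have h : eigenProj A ξ x ∈ (A - ξ • (1 : E →L[ℝ] E)).ker := Submodule.starProjection_apply_mem _ x
  rw [LinearMap.mem_ker] at h
  have h2 : A (eigenProj A ξ x) - ξ • eigenProj A ξ x = 0 := h
  exact sub_eq_zero.1 h2

theorem inner_eigenProj_self (A : E →L[ℝ] E) (ξ : ℝ) (x y : E) :
    inner ℝ x (eigenProj A ξ y) = inner ℝ (eigenProj A ξ x) (eigenProj A ξ y) := by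
  have h := Submodule.starProjection_inner_eq_zero (K := (A - ξ • (1 : E →L[ℝ] E)).ker) x
    (eigenProj A ξ y) (Submodule.starProjection_apply_mem _ y)
  rw [inner_sub_left, sub_eq_zero] at h
  exact h

variable {A : E →L[ℝ] E}

theorem inner_eigen_eq_zero (hA : ∀ x y, inner ℝ (A x) y = inner ℝ x (A y)) {ξ η : ℝ}
    (hne : ξ ≠ η) {x y : E} (hx : A x = ξ • x) (hy : A y = η • y) : inner ℝ x y = 0 := by
  have h := hA x y
  rw [hx, hy, inner_smul_left, inner_smul_right, conj_trivial] at h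
  have h2 : (ξ - η) * inner ℝ x y = 0 := by linarith
  exact (mul_eq_zero.1 h2).resolve_left (sub_ne_zero.2 hne)

theorem norm_sq_sum_eigen (hA : ∀ x y, inner ℝ (A x) y = inner ℝ x (A y)) (F : Finset ℝ)
    {v : ℝ → E} (hv : ∀ ξ, A (v ξ) = ξ • v ξ) : ‖∑ ξ ∈ F, v ξ‖ ^ 2 = ∑ ξ ∈ F, ‖v ξ‖ ^ 2 := by
  rw [← real_inner_self_eq_norm_sq, sum_inner]
  refine Finset.sum_congr rfl fun ξ hξ => ?_
  rw [inner_sum, Finset.sum_eq_single ξ, real_inner_self_eq_norm_sq]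
  · exact fun η _ hne => inner_eigen_eq_zero hA hne.symm (hv ξ) (hv η)
  · exact fun h => absurd hξ h

/-- Bessel's inequality, for mutually orthogonal eigenvectors `v ξ` whose inner products with `x`
are `‖v ξ‖²`. -/
theorem sum_norm_sq_eigen_le (hA : ∀ x y, inner ℝ (A x) y = inner ℝ x (A y)) (F : Finset ℝ)
    {v : ℝ → E} (hv : ∀ ξ, A (v ξ) = ξ • v ξ) {x : E}
    (hx : ∀ ξ ∈ F, inner ℝ x (v ξ) = ‖v ξ‖ ^ 2) : ∑ ξ ∈ F, ‖v ξ‖ ^ 2 ≤ ‖x‖ ^ 2 := by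
  have h1 : inner ℝ x (∑ ξ ∈ F, v ξ) = ∑ ξ ∈ F, ‖v ξ‖ ^ 2 := by
    rw [inner_sum]
    exact Finset.sum_congr rfl hx
  have h2 := real_inner_le_norm x (∑ ξ ∈ F, v ξ)
  rw [h1] at h2
  have h3 := norm_sq_sum_eigen hA F hv
  nlinarith [sq_nonneg (‖x‖ - ‖∑ ξ ∈ F, v ξ‖)]

theorem sum_norm_sq_eigenProj_le (hA : ∀ x y, inner ℝ (A x) y = inner ℝ x (A y)) (F : Finset ℝ)
    (x : E) : ∑ ξ ∈ F, ‖eigenProj A ξ x‖ ^ 2 ≤ ‖x‖ ^ 2 :=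
  sum_norm_sq_eigen_le hA F (fun ξ => apply_eigenProj A ξ x) fun ξ _ => by
    rw [inner_eigenProj_self, real_inner_self_eq_norm_sq]

theorem eigenProj_pow_apply (hA : ∀ x y, inner ℝ (A x) y = inner ℝ x (A y)) (ξ : ℝ) (j : ℕ)
    (x : E) : eigenProj A ξ ((A ^ j) x) = ξ ^ j • eigenProj A ξ x := by
  have h1 : ∀ x : E, eigenProj A ξ (A x) = ξ • eigenProj A ξ x := by
    intro x
    refine ext_inner_right ℝ fun y => ?_
    have h2 : ∀ a b : E, inner ℝ (eigenProj A ξ a) b = inner ℝ a (eigenProj A ξ b) := fun a b =>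
      Submodule.inner_starProjection_left_eq_right _ a b
    rw [h2, hA, apply_eigenProj, inner_smul_right, inner_smul_left, h2, conj_trivial]
  induction j generalizing x with
  | zero => simp
  | succ j ih =>
    rw [pow_succ, mul_apply_eq_comp, ih, h1, smul_smul, pow_succ]

variable {T : H →L[ℝ] E} {κ : ℝ}

theorem inner_comp_adjoint (x y : E) :
    inner ℝ ((T ∘L T.adjoint) x) y = inner ℝ (T.adjoint x) (T.adjoint y) := by
  rw [ContinuousLinearMap.comp_apply, ContinuousLinearMap.adjoint_inner_right]

theorem comp_adjoint_symm (x y : E) :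
    inner ℝ ((T ∘L T.adjoint) x) y = inner ℝ x ((T ∘L T.adjoint) y) := by
  rw [inner_comp_adjoint, ← real_inner_comm, ← inner_comp_adjoint, real_inner_comm]

theorem norm_adjoint_eigenProj_sq (ξ : ℝ) (x : E) :
    ‖T.adjoint (eigenProj (T ∘L T.adjoint) ξ x)‖ ^ 2
      = ξ * ‖eigenProj (T ∘L T.adjoint) ξ x‖ ^ 2 := by
  rw [← real_inner_self_eq_norm_sq, ← inner_comp_adjoint, apply_eigenProj, inner_smul_left,
    conj_trivial, real_inner_self_eq_norm_sq]

theorem eigenProj_eq_zero_of_neg {ξ : ℝ} (hξ : ξ < 0) (x : E) :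
    eigenProj (T ∘L T.adjoint) ξ x = 0 := by
  have h := norm_adjoint_eigenProj_sq (T := T) ξ x
  have h2 : 0 ≤ ξ * ‖eigenProj (T ∘L T.adjoint) ξ x‖ ^ 2 := h ▸ sq_nonneg _
  have h3 : ‖eigenProj (T ∘L T.adjoint) ξ x‖ ^ 2 = 0 := by
    nlinarith [sq_nonneg ‖eigenProj (T ∘L T.adjoint) ξ x‖]
  simpa using h3

theorem eigenProj_eq_zero_of_lt (hT : ∀ h, ‖T h‖ ^ 2 ≤ κ * ‖h‖ ^ 2) {ξ : ℝ} (hκ : 0 < κ)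
    (hξ : κ < ξ) (x : E) : eigenProj (T ∘L T.adjoint) ξ x = 0 := by
  set y := eigenProj (T ∘L T.adjoint) ξ x with hy
  have h1 : ‖T.adjoint y‖ ^ 2 = ξ * ‖y‖ ^ 2 := norm_adjoint_eigenProj_sq ξ x
  have h2 : T (T.adjoint y) = ξ • y := apply_eigenProj (T ∘L T.adjoint) ξ x
  have h3 := hT (T.adjoint y)
  rw [h2, h1, norm_smul, mul_pow, Real.norm_eq_abs, sq_abs] at h3
  have h4 : ξ * (ξ - κ) * ‖y‖ ^ 2 ≤ 0 := by nlinarith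
  have h5 : 0 < ξ * (ξ - κ) := mul_pos (hκ.trans hξ) (sub_pos.2 hξ)
  have h6 : ‖y‖ ^ 2 = 0 := by
    by_contra hne
    have : 0 < ‖y‖ ^ 2 := lt_of_le_of_ne (sq_nonneg _) (Ne.symm hne)
    nlinarith [mul_pos h5 this]
  simpa using h6

theorem adjoint_eigenProj_eq_zero {ξ : ℝ} (hξ : ξ ≤ 0) (x : E) :
    T.adjoint (eigenProj (T ∘L T.adjoint) ξ x) = 0 := by
  rcases hξ.lt_or_eq with h | rfl
  · rw [eigenProj_eq_zero_of_neg h, map_zero]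
  · have := norm_adjoint_eigenProj_sq (T := T) 0 x
    rw [zero_mul] at this
    simpa using this

/-- If `g = (T T*)^r u` with `r ≥ 1/2`, then `g = T f` for some `f`, formally
`f = (T* T)^(r - 1/2) w` with `‖w‖ ≤ ‖u‖`. Only duality bounds for `f` are recorded: `⟨h, f⟩` is
controlled by the norms of `h` and `T (T* T)^j h`, as soon as `ξ^(2 r - 1) ≤ a + b ξ^(2 j + 1)` on
the spectrum. -/
theorem exists_preimage_of_isOperatorPow (hκ : 0 < κ) (hT : ∀ h, ‖T h‖ ^ 2 ≤ κ * ‖h‖ ^ 2) {r : ℝ}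
    (hr : 1 / 2 ≤ r) {u g : E} (hg : IsOperatorPow (T ∘L T.adjoint) r u g) :
    ∃ f : H, T f = g ∧ ∀ (j : ℕ) (a b : ℝ), 0 ≤ a → 0 ≤ b →
      (∀ ξ, 0 < ξ → ξ ≤ κ → ξ ^ (2 * r - 1) ≤ a + b * ξ ^ (2 * j + 1)) →
      ∀ h : H, (inner ℝ h f) ^ 2
        ≤ ‖u‖ ^ 2 * (a * ‖h‖ ^ 2 + b * ‖((T ∘L T.adjoint) ^ j) (T h)‖ ^ 2) := by
  set K := T ∘L T.adjoint with hK
  have hKs : ∀ x y, inner ℝ (K x) y = inner ℝ x (K y) := comp_adjoint_symm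
  set S := T.adjoint ∘L T with hS
  have hSs : ∀ x y, inner ℝ (S x) y = inner ℝ x (S y) := fun x y => by
    rw [hS, ContinuousLinearMap.comp_apply, ContinuousLinearMap.comp_apply,
      ContinuousLinearMap.adjoint_inner_left, ContinuousLinearMap.adjoint_inner_right]
  have hSeig : ∀ (c ξ : ℝ) (x : E),
      S (c • T.adjoint (eigenProj K ξ x)) = ξ • (c • T.adjoint (eigenProj K ξ x)) := by
    intro c ξ x
    have h1 : S (T.adjoint (eigenProj K ξ x)) = ξ • T.adjoint (eigenProj K ξ x) := by
      have := apply_eigenProj K ξ x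
      change T.adjoint (K (eigenProj K ξ x)) = _
      rw [this, map_smul]
    rw [map_smul, h1, smul_comm]
  set a : ℝ → H := fun ξ => ξ ^ (r - 1) • T.adjoint (eigenProj K ξ u) with ha
  have ha0 : ∀ ξ, ξ ≤ 0 → a ξ = 0 := fun ξ hξ => by
    rw [ha]; simp only; rw [adjoint_eigenProj_eq_zero hξ, smul_zero]
  have hnorm : ∀ ξ, ‖a ξ‖ ^ 2 ≤ κ ^ (2 * r - 1) * ‖eigenProj K ξ u‖ ^ 2 := by
    intro ξ
    rcases le_or_gt ξ 0 with h0 | h0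
    · rw [ha0 ξ h0, norm_zero, zero_pow two_ne_zero]
      exact mul_nonneg (Real.rpow_nonneg hκ.le _) (sq_nonneg _)
    rcases lt_or_ge κ ξ with h1 | h1
    · rw [ha]
      simp only
      rw [eigenProj_eq_zero_of_lt hT hκ h1]
      simp
    · rw [ha]
      simp only
      rw [norm_smul, mul_pow, norm_adjoint_eigenProj_sq, Real.norm_eq_abs, sq_abs, ← mul_assoc]
      refine mul_le_mul_of_nonneg_right ?_ (sq_nonneg _)
      calc (ξ ^ (r - 1)) ^ 2 * ξ = ξ ^ (2 * r - 1) := by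
            rw [← Real.rpow_natCast, ← Real.rpow_mul h0.le, ← Real.rpow_add_one h0.ne']
            congr 1
            push_cast
            ring
        _ ≤ κ ^ (2 * r - 1) := Real.rpow_le_rpow h0.le h1 (by linarith)
  have hsq : Summable fun ξ => ‖a ξ‖ ^ 2 := by
    refine Summable.of_nonneg_of_le (fun ξ => sq_nonneg _) hnorm (Summable.mul_left _ ?_)
    exact summable_of_sum_le (fun ξ => sq_nonneg _) fun F => sum_norm_sq_eigenProj_le hKs F u
  have hSsym : LinearMap.IsSymmetric (S : H →ₗ[ℝ] H) := fun x y => hSs x y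
  have hsum : Summable a := by
    have h1 := (hSsym.orthogonalFamily_eigenspaces).summable_iff_norm_sq_summable
      (fun ξ => ⟨a ξ, Module.End.mem_eigenspace_iff.2 (hSeig _ ξ u)⟩)
    exact h1.2 hsq
  obtain ⟨f, hf⟩ := hsum
  have hTa : ∀ ξ, T (a ξ) = ξ ^ r • eigenProj K ξ u := by
    intro ξ
    rcases le_or_gt ξ 0 with h0 | h0
    · rw [ha0 ξ h0, map_zero]
      rcases h0.lt_or_eq with h | rfl
      · rw [eigenProj_eq_zero_of_neg h, smul_zero]
      · rw [Real.zero_rpow (by linarith), zero_smul]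
    · have h1 : T (T.adjoint (eigenProj K ξ u)) = ξ • eigenProj K ξ u := apply_eigenProj K ξ u
      rw [ha]
      simp only
      rw [map_smul, h1, smul_smul, ← Real.rpow_add_one h0.ne', sub_add_cancel]
  refine ⟨f, ?_, ?_⟩
  · have h1 := hf.mapL T
    simp_rw [hTa] at h1
    exact h1.unique hg
  intro j α β hα0 hβ hαβ h
  set M := ‖u‖ ^ 2 * (α * ‖h‖ ^ 2 + β * ‖(K ^ j) (T h)‖ ^ 2) with hM
  have hlim := (hf.mapL (innerSL ℝ h))
  have hlim2 : Filter.Tendsto (fun F : Finset ℝ => (∑ ξ ∈ F, inner ℝ h (a ξ)) ^ 2) Filter.atTop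
      (nhds ((inner ℝ h f) ^ 2)) := by
    have : Filter.Tendsto (fun F : Finset ℝ => ∑ ξ ∈ F, inner ℝ h (a ξ)) Filter.atTop
      (nhds (inner ℝ h f)) := hlim
    exact this.pow 2
  refine le_of_tendsto hlim2 (.of_forall fun F => ?_)
  have hfilter : ∑ ξ ∈ F, inner ℝ h (a ξ)
      = ∑ ξ ∈ F.filter (fun ξ => 0 < ξ ∧ ξ ≤ κ), inner ℝ h (a ξ) := by
    rw [Finset.sum_filter]
    refine Finset.sum_congr rfl fun ξ _ => ?_
    split_ifs with hξ
    · rfl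
    · rcases le_or_gt ξ 0 with h0 | h0
      · rw [ha0 ξ h0, inner_zero_right]
      · have h1 : κ < ξ := by
          by_contra hle
          exact hξ ⟨h0, not_lt.1 hle⟩
        rw [ha]
        simp only
        rw [eigenProj_eq_zero_of_lt hT hκ h1, map_zero, smul_zero, inner_zero_right]
  rw [hfilter]
  set F' := F.filter (fun ξ => 0 < ξ ∧ ξ ≤ κ) with hF'
  have hF'pos : ∀ ξ ∈ F', 0 < ξ ∧ ξ ≤ κ := fun ξ hξ => (Finset.mem_filter.1 hξ).2
  have hterm : ∀ ξ ∈ F', inner ℝ h (a ξ)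
      ≤ (ξ ^ (r - 1) * ‖eigenProj K ξ (T h)‖) * ‖eigenProj K ξ u‖ ∧
      -((ξ ^ (r - 1) * ‖eigenProj K ξ (T h)‖) * ‖eigenProj K ξ u‖) ≤ inner ℝ h (a ξ) := by
    intro ξ hξ
    have h1 : inner ℝ h (a ξ)
        = ξ ^ (r - 1) * inner ℝ (eigenProj K ξ (T h)) (eigenProj K ξ u) := by
      rw [ha]
      simp only
      rw [inner_smul_right, ContinuousLinearMap.adjoint_inner_right, inner_eigenProj_self]
    have h2 := abs_le.1 (abs_real_inner_le_norm (eigenProj K ξ (T h)) (eigenProj K ξ u))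
    have h3 : 0 ≤ ξ ^ (r - 1) := Real.rpow_nonneg (hF'pos ξ hξ).1.le _
    rw [h1]
    constructor <;> nlinarith [h2.1, h2.2]
  have hCS : (∑ ξ ∈ F', inner ℝ h (a ξ)) ^ 2
      ≤ (∑ ξ ∈ F', (ξ ^ (r - 1) * ‖eigenProj K ξ (T h)‖) ^ 2)
        * ∑ ξ ∈ F', ‖eigenProj K ξ u‖ ^ 2 := by
    refine le_trans ?_ (Finset.sum_mul_sq_le_sq_mul_sq F' _ _)
    rw [sq_le_sq]
    refine le_trans ?_ (le_abs_self _)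
    rw [abs_le]
    constructor
    · rw [← Finset.sum_neg_distrib]
      exact Finset.sum_le_sum fun ξ hξ => (hterm ξ hξ).2
    · exact Finset.sum_le_sum fun ξ hξ => (hterm ξ hξ).1
  have hnK : ∀ ξ x, ‖T.adjoint (eigenProj K ξ x)‖ ^ 2 = ξ * ‖eigenProj K ξ x‖ ^ 2 :=
    norm_adjoint_eigenProj_sq
  have hb1 : ∑ ξ ∈ F', ξ⁻¹ * ‖eigenProj K ξ (T h)‖ ^ 2 ≤ ‖h‖ ^ 2 := by
    have h1 := sum_norm_sq_eigen_le hSs F'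
      (v := fun ξ => ξ⁻¹ • T.adjoint (eigenProj K ξ (T h))) (fun ξ => hSeig _ ξ _) (x := h) ?_
    · refine le_trans (Finset.sum_le_sum fun ξ hξ => ?_) h1
      rw [norm_smul, mul_pow, hnK, Real.norm_eq_abs, sq_abs]
      have := (hF'pos ξ hξ).1.ne'
      refine le_of_eq ?_
      field_simp
    · intro ξ hξ
      rw [norm_smul, mul_pow, hnK, Real.norm_eq_abs, sq_abs,
        inner_smul_right, ContinuousLinearMap.adjoint_inner_right, inner_eigenProj_self,
        real_inner_self_eq_norm_sq]
      have := (hF'pos ξ hξ).1.ne'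
      field_simp
  have hb2 : ∑ ξ ∈ F', (ξ ^ j) ^ 2 * ‖eigenProj K ξ (T h)‖ ^ 2 ≤ ‖(K ^ j) (T h)‖ ^ 2 := by
    refine le_trans (le_of_eq ?_) (sum_norm_sq_eigenProj_le hKs F' ((K ^ j) (T h)))
    refine Finset.sum_congr rfl fun ξ _ => ?_
    rw [eigenProj_pow_apply hKs, norm_smul, mul_pow, Real.norm_eq_abs, sq_abs]
  have hb3 : ∑ ξ ∈ F', (ξ ^ (r - 1) * ‖eigenProj K ξ (T h)‖) ^ 2
      ≤ α * ‖h‖ ^ 2 + β * ‖(K ^ j) (T h)‖ ^ 2 := by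
    calc ∑ ξ ∈ F', (ξ ^ (r - 1) * ‖eigenProj K ξ (T h)‖) ^ 2
        ≤ ∑ ξ ∈ F', (α * (ξ⁻¹ * ‖eigenProj K ξ (T h)‖ ^ 2)
          + β * ((ξ ^ j) ^ 2 * ‖eigenProj K ξ (T h)‖ ^ 2)) := by
          refine Finset.sum_le_sum fun ξ hξ => ?_
          obtain ⟨h0, h1⟩ := hF'pos ξ hξ
          have h2 := hαβ ξ h0 h1
          have h3 : (ξ ^ (r - 1)) ^ 2 = ξ ^ (2 * r - 1) * ξ⁻¹ := by
            rw [← Real.rpow_natCast, ← Real.rpow_mul h0.le, ← Real.rpow_neg_one ξ,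
              ← Real.rpow_add h0]
            congr 1
            push_cast
            ring
          have h4 : ξ ^ (2 * j + 1) * ξ⁻¹ = (ξ ^ j) ^ 2 := by
            field_simp
            ring
          rw [mul_pow, h3]
          calc _ ≤ (α + β * ξ ^ (2 * j + 1)) * ξ⁻¹ * ‖eigenProj K ξ (T h)‖ ^ 2 := by gcongr
            _ = α * (ξ⁻¹ * ‖eigenProj K ξ (T h)‖ ^ 2)
                + β * (ξ ^ (2 * j + 1) * ξ⁻¹ * ‖eigenProj K ξ (T h)‖ ^ 2) := by ring
            _ = _ := by rw [h4]
      _ ≤ _ := by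
          rw [Finset.sum_add_distrib, ← Finset.mul_sum, ← Finset.mul_sum]
          gcongr
  refine hCS.trans ?_
  rw [hM, mul_comm]
  exact mul_le_mul (sum_norm_sq_eigenProj_le hKs F' u) hb3
    (Finset.sum_nonneg fun ξ _ => sq_nonneg _) (sq_nonneg _)

end Source

/-! ### The feature map and the inclusion into `L²` -/

section Feature

variable {𝒳 : Type*} (H : Type*) [NormedAddCommGroup H] [InnerProductSpace ℝ H] [RKHS ℝ H 𝒳 ℝ]
  [CompleteSpace H]

/-- The feature map `x ↦ k(x, ·)`. -/
noncomputable def feature (x : 𝒳) : H := RKHS.kerFun H x (1 : ℝ)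

variable {H}

@[simp]
theorem inner_feature (x : 𝒳) (h : H) : inner ℝ (feature H x) h = h x := by
  rw [feature, RKHS.kerFun_inner]
  simp

theorem feature_apply (x y : 𝒳) : (feature H x : H) y = kern H x y := by
  rw [← inner_feature, kern_eq_inner, real_inner_comm]
  rfl

theorem norm_feature_sq (x : 𝒳) : ‖feature H x‖ ^ 2 = kern H x x := by
  rw [← real_inner_self_eq_norm_sq, kern_eq_inner]
  rfl

theorem kern_comm (x y : 𝒳) : kern H x y = kern H y x := by
  rw [kern_eq_inner, kern_eq_inner, real_inner_comm]

theorem apply_sq_le {κ : ℝ} (hκ : ∀ x : 𝒳, kern H x x ≤ κ) (h : H) (x : 𝒳) :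
    (h x) ^ 2 ≤ κ * ‖h‖ ^ 2 := by
  rw [← inner_feature]
  have h1 := abs_real_inner_le_norm (feature H x) h
  calc (inner ℝ (feature H x) h) ^ 2 = |inner ℝ (feature H x) h| ^ 2 := (sq_abs _).symm
    _ ≤ (‖feature H x‖ * ‖h‖) ^ 2 := pow_le_pow_left₀ (abs_nonneg _) h1 2
    _ = ‖feature H x‖ ^ 2 * ‖h‖ ^ 2 := mul_pow _ _ _
    _ ≤ κ * ‖h‖ ^ 2 := by
      rw [norm_feature_sq]
      exact mul_le_mul_of_nonneg_right (hκ x) (sq_nonneg _)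

variable [MeasurableSpace 𝒳]

theorem measurable_coe (hmeas : Measurable (Function.uncurry (kern H (𝒳 := 𝒳)))) (h : H) :
    Measurable (h : 𝒳 → ℝ) := by
  have hspan : ∀ g ∈ Submodule.span ℝ {RKHS.kerFun H x v | (x : 𝒳) (v : ℝ)},
      Measurable (g : 𝒳 → ℝ) := by
    intro g hg
    induction hg using Submodule.span_induction with
    | mem g hg =>
      obtain ⟨x, v, rfl⟩ := hg
      have h1 : RKHS.kerFun H x v = v • feature H x := by
        rw [feature, ← map_smul, smul_eq_mul, mul_one]
      rw [h1, RKHS.coe_smul]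
      have h2 : ((feature H x : H) : 𝒳 → ℝ) = fun y => Function.uncurry (kern H) (x, y) :=
        funext fun y => feature_apply x y
      rw [h2]
      exact (hmeas.comp measurable_prodMk_left).const_smul v
    | zero => rw [RKHS.coe_zero]; exact measurable_zero
    | add f g _ _ hf hg => rw [RKHS.coe_add]; exact hf.add hg
    | smul c g _ hg => rw [RKHS.coe_smul]; exact hg.const_smul c
  have hd : h ∈ (Submodule.span ℝ {RKHS.kerFun H x v | (x : 𝒳) (v : ℝ)}).topologicalClosure := by
    rw [RKHS.kerFun_dense]
    trivial
  obtain ⟨u, hu, hlim⟩ := mem_closure_iff_seq_limit.1 hd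
  refine measurable_of_tendsto_metrizable (f := fun n => (u n : 𝒳 → ℝ)) (fun n => hspan _ (hu n)) ?_
  rw [tendsto_pi_nhds]
  intro x
  exact ((RKHS.continuous_eval x).tendsto h).comp hlim

theorem stronglyMeasurable_feature [TopologicalSpace.SeparableSpace H]
    (hmeas : Measurable (Function.uncurry (kern H (𝒳 := 𝒳)))) :
    StronglyMeasurable (feature H : 𝒳 → H) := by
  obtain ⟨w, b, -⟩ := exists_hilbertBasis ℝ H
  have : Countable w := countable_of_orthonormal b.orthonormal
  refine stronglyMeasurable_of_tendsto
    (f := fun (s : Finset w) x => ∑ i ∈ s, b.repr (feature H x) i • b i)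
    Filter.atTop (fun s => ?_) ?_
  · refine Finset.stronglyMeasurable_fun_sum s fun i _ => ?_
    refine StronglyMeasurable.smul_const ?_ _
    have h1 : (fun x => b.repr (feature H x) i) = fun x : 𝒳 => (b i) x := by
      funext x
      rw [b.repr_apply_apply, real_inner_comm, inner_feature]
    rw [h1]
    exact (measurable_coe hmeas _).stronglyMeasurable
  · rw [tendsto_pi_nhds]
    intro x
    exact b.hasSum_repr (feature H x)

variable {ν : Measure 𝒳} [IsProbabilityMeasure ν] {κ : ℝ}

theorem memLp_coe (hmeas : Measurable (Function.uncurry (kern H (𝒳 := 𝒳))))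
    (hκ : ∀ x : 𝒳, kern H x x ≤ κ) (h : H) : MemLp (h : 𝒳 → ℝ) 2 ν := by
  refine MemLp.of_bound (measurable_coe hmeas h).aestronglyMeasurable (√(κ * ‖h‖ ^ 2))
    (.of_forall fun x => ?_)
  rw [Real.norm_eq_abs]
  exact Real.abs_le_sqrt (apply_sq_le hκ h x)

variable (ν) in
/-- The inclusion of the reproducing kernel Hilbert space in `L²`. -/
theorem exists_inclusion (hmeas : Measurable (Function.uncurry (kern H (𝒳 := 𝒳))))
    (hκ : ∀ x : 𝒳, kern H x x ≤ κ) :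
    ∃ T : H →L[ℝ] Lp ℝ 2 ν, ∀ h, T h =ᵐ[ν] h := by
  obtain ⟨x₀⟩ : Nonempty 𝒳 := nonempty_of_isProbabilityMeasure ν
  have hκ0 : 0 ≤ κ := by
    refine le_trans ?_ (hκ x₀)
    rw [← norm_feature_sq]
    positivity
  let T₀ : H →ₗ[ℝ] Lp ℝ 2 ν :=
    { toFun := fun h => (memLp_coe (ν := ν) hmeas hκ h).toLp
      map_add' := fun g h => by
        rw [← MemLp.toLp_add, MemLp.toLp_eq_toLp_iff, RKHS.coe_add]
      map_smul' := fun c h => by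
        rw [RingHom.id_apply, ← MemLp.toLp_const_smul, MemLp.toLp_eq_toLp_iff, RKHS.coe_smul] }
  refine ⟨T₀.mkContinuous (√κ) fun h => ?_, fun h => ?_⟩
  · change ‖(memLp_coe (ν := ν) hmeas hκ h).toLp‖ ≤ _
    rw [Lp.norm_toLp]
    refine ENNReal.toReal_le_of_le_ofReal (by positivity) ?_
    refine (eLpNorm_le_of_ae_bound (C := √κ * ‖h‖) (.of_forall fun x => ?_)).trans ?_
    · rw [Real.norm_eq_abs, ← Real.sqrt_sq (norm_nonneg h), ← Real.sqrt_mul hκ0]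
      exact Real.abs_le_sqrt (apply_sq_le hκ h x)
    · simp
  · exact MemLp.coeFn_toLp (memLp_coe (ν := ν) hmeas hκ h)

variable {T : H →L[ℝ] Lp ℝ 2 ν}

theorem inner_inclusion (hT : ∀ h, T h =ᵐ[ν] h) (g h : H) :
    inner ℝ (T g) (T h) = ∫ x, g x * h x ∂ν := by
  rw [L2.inner_def]
  refine integral_congr_ae ?_
  filter_upwards [hT g, hT h] with x h1 h2
  rw [h1, h2]
  simp [mul_comm]

theorem norm_inclusion_sq_le (hT : ∀ h, T h =ᵐ[ν] h) (hκ : ∀ x : 𝒳, kern H x x ≤ κ) (h : H) :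
    ‖T h‖ ^ 2 ≤ κ * ‖h‖ ^ 2 := by
  rw [← real_inner_self_eq_norm_sq, inner_inclusion hT]
  calc ∫ x, h x * h x ∂ν ≤ ∫ _, κ * ‖h‖ ^ 2 ∂ν := by
        refine integral_mono_of_nonneg (.of_forall fun x => mul_self_nonneg _)
          (integrable_const _) (.of_forall fun x => ?_)
        change h x * h x ≤ _
        rw [← sq]
        exact apply_sq_le hκ h x
    _ = κ * ‖h‖ ^ 2 := by simp

theorem isBoundedMeasurableKernel_kern (hmeas : Measurable (Function.uncurry (kern H (𝒳 := 𝒳))))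
    (hκ : ∀ x : 𝒳, kern H x x ≤ κ) : IsBoundedMeasurableKernel (kern H (𝒳 := 𝒳)) :=
  ⟨hmeas, κ, abs_kern_le H hκ⟩

/-- The adjoint of the inclusion is given by integration against the kernel. -/
theorem adjoint_inclusion_apply (hT : ∀ h, T h =ᵐ[ν] h) (g : Lp ℝ 2 ν) (x : 𝒳) :
    (T.adjoint g : H) x = ∫ y, kern H x y * g y ∂ν := by
  rw [← inner_feature, ContinuousLinearMap.adjoint_inner_right, L2.inner_def]
  refine integral_congr_ae ?_
  filter_upwards [hT (feature H x)] with y h1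
  rw [h1, feature_apply]
  simp [mul_comm]

theorem kernelOp_eq_comp_adjoint (hmeas : Measurable (Function.uncurry (kern H (𝒳 := 𝒳))))
    (hκ : ∀ x : 𝒳, kern H x x ≤ κ) (hT : ∀ h, T h =ᵐ[ν] h) :
    kernelOp ν (kern H) = T ∘L T.adjoint := by
  refine ContinuousLinearMap.ext fun g => Lp.ext ?_
  refine (kernelOp_ae_eq (isBoundedMeasurableKernel_kern hmeas hκ) g).trans ?_
  refine Filter.EventuallyEq.trans (.of_forall fun x => ?_) (hT (T.adjoint g)).symm
  exact (adjoint_inclusion_apply hT g x).symm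

theorem ofReal_norm_sq_eq_tsum {V ι : Type*} [NormedAddCommGroup V] [InnerProductSpace ℝ V]
    (b : HilbertBasis ι ℝ V) (v : V) :
    ENNReal.ofReal (‖v‖ ^ 2) = ∑' i, ENNReal.ofReal ((inner ℝ (b i) v) ^ 2) := by
  have h2 : HasSum (fun i => (inner ℝ (b i) v) ^ 2) (‖v‖ ^ 2) := by
    have h2 := b.hasSum_inner_mul_inner v v
    rw [real_inner_self_eq_norm_sq] at h2
    simpa only [real_inner_comm v, ← sq] using h2
  rw [← h2.tsum_eq, ENNReal.ofReal_tsum_of_nonneg (fun i => sq_nonneg _) h2.summable]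

/-- The mean squared energy norm of `(T* T + lam)⁻¹ k(X, ·)` is bounded by the effective
dimension. -/
theorem lintegral_norm_sq_toEnergy_resolvent_le [TopologicalSpace.SeparableSpace H]
    (hmeas : Measurable (Function.uncurry (kern H (𝒳 := 𝒳))))
    (hκ : ∀ x : 𝒳, kern H x x ≤ κ) (hT : ∀ h, T h =ᵐ[ν] h) {lam : ℝ} (hlam : 0 < lam) :
    ∫⁻ x, ENNReal.ofReal (‖toEnergy T lam (resolvent T lam (feature H x))‖ ^ 2) ∂ν
      ≤ effDim (kernelOp ν (kern H)) lam := by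
  set J := toEnergy T lam
  set R := resolvent T lam
  obtain ⟨w, b, -⟩ := exists_hilbertBasis ℝ (EnergySpace T lam)
  have : Countable w := countable_of_orthonormal b.orthonormal
  have hcoord : ∀ (i : w) (x : 𝒳), inner ℝ (b i) (J (R (feature H x)))
      = (R (J.adjoint (b i)) : H) x := by
    intro i x
    rw [← ContinuousLinearMap.adjoint_inner_left, ← inner_resolvent_comm hlam, real_inner_comm,
      inner_feature]
  have hpars : ∀ x : 𝒳, ENNReal.ofReal (‖J (R (feature H x))‖ ^ 2)
      = ∑' i : w, ENNReal.ofReal (((R (J.adjoint (b i)) : H) x) ^ 2) := by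
    intro x
    refine (ofReal_norm_sq_eq_tsum b (J (R (feature H x)))).trans (tsum_congr fun i => ?_)
    rw [hcoord]
  set L : EnergySpace T lam →L[ℝ] Lp ℝ 2 ν := T ∘L R ∘L J.adjoint with hL
  have hint : ∀ i : w, ∫⁻ x, ENNReal.ofReal (((R (J.adjoint (b i)) : H) x) ^ 2) ∂ν
      = ENNReal.ofReal (‖L (b i)‖ ^ 2) := by
    intro i
    have h1 : ‖L (b i)‖ ^ 2 = ∫ x, ((R (J.adjoint (b i)) : H) x) ^ 2 ∂ν := by
      rw [← real_inner_self_eq_norm_sq, hL]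
      simp only [ContinuousLinearMap.comp_apply]
      rw [inner_inclusion hT]
      simp only [sq]
    rw [h1, ofReal_integral_eq_lintegral_ofReal ((memLp_coe hmeas hκ _).integrable_sq)
      (.of_forall fun x => sq_nonneg _)]
  have hLL : L ∘L L.adjoint
      = kernelOp ν (kern H) *
        Ring.inverse (kernelOp ν (kern H) + lam • (1 : Lp ℝ 2 ν →L[ℝ] Lp ℝ 2 ν)) := by
    rw [kernelOp_eq_comp_adjoint hmeas hκ hT, ← comp_resolvent_comp_adjoint hlam]
    refine ContinuousLinearMap.ext fun v => ext_inner_right ℝ fun z => ?_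
    have hR : ∀ g h : H, inner ℝ (R g) h = inner ℝ g (R h) := inner_resolvent_comm hlam
    have hJR : ∀ g h : H, inner ℝ (J (R g)) (J h) = inner ℝ g h := inner_toEnergy_resolvent hlam
    have hJ : L.adjoint = J ∘L R ∘L T.adjoint := by
      refine ((ContinuousLinearMap.eq_adjoint_iff _ _).2 fun x y => ?_).symm
      simp only [hL, ContinuousLinearMap.comp_apply]
      rw [← ContinuousLinearMap.adjoint_inner_right J, hR, ContinuousLinearMap.adjoint_inner_left]
    rw [hJ]
    simp only [hL, ContinuousLinearMap.comp_apply]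
    have h3 : ∀ g : H, R (J.adjoint (J (R g))) = R g := by
      intro g
      refine congrArg R (ext_inner_right ℝ fun h => ?_)
      rw [ContinuousLinearMap.adjoint_inner_left, hJR]
    rw [h3]
  calc ∫⁻ x, ENNReal.ofReal (‖J (R (feature H x))‖ ^ 2) ∂ν
      = ∫⁻ x, ∑' i : w, ENNReal.ofReal (((R (J.adjoint (b i)) : H) x) ^ 2) ∂ν := by
        simp_rw [hpars]
    _ = ∑' i : w, ∫⁻ x, ENNReal.ofReal (((R (J.adjoint (b i)) : H) x) ^ 2) ∂ν := by
        refine lintegral_tsum fun i => ?_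
        exact ((measurable_coe hmeas _).pow_const 2).ennreal_ofReal.aemeasurable
    _ = ∑' i : w, ENNReal.ofReal (‖L (b i)‖ ^ 2) := by simp_rw [hint]
    _ ≤ posTrace (L ∘L L.adjoint) := by
        rw [ENNReal.tsum_eq_iSup_sum]
        exact iSup_le fun s => sum_norm_sq_le_posTrace L b.orthonormal s
    _ = effDim (kernelOp ν (kern H)) lam := by rw [hLL, effDim]

end Feature

/-! ### Spectral calculus on a finite family of eigenvectors -/

section Eigenvectors

open Polynomial

variable {H : Type*} [NormedAddCommGroup H] [InnerProductSpace ℝ H]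

/-- Diagonalization of a symmetric operator on a finite-dimensional invariant subspace. -/
theorem exists_eigenvectors {A : H →L[ℝ] H} (hA : ∀ g h, inner ℝ (A g) h = inner ℝ g (A h))
    (W : Submodule ℝ H) [FiniteDimensional ℝ W] (hW : ∀ x ∈ W, A x ∈ W) :
    ∃ (N : ℕ) (w : Fin N → H) (σ : Fin N → ℝ), Orthonormal ℝ w ∧ (∀ j, A (w j) = σ j • w j) ∧
      ∀ x ∈ W, x = ∑ j, inner ℝ (w j) x • w j := by
  set B : W →ₗ[ℝ] W := (A : H →ₗ[ℝ] H).restrict hW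
  have hB : B.IsSymmetric := fun x y => hA x y
  set e := hB.eigenvectorBasis (n := Module.finrank ℝ W) rfl
  refine ⟨_, fun j => (e j : H), hB.eigenvalues rfl, ?_, fun j => ?_, fun x hx => ?_⟩
  · exact e.orthonormal.comp_linearIsometry W.subtypeₗᵢ
  · have h := hB.apply_eigenvectorBasis (n := Module.finrank ℝ W) rfl j
    exact congrArg Subtype.val h
  · have h := e.sum_repr' ⟨x, hx⟩
    have h2 := congrArg Subtype.val h
    simp only [Submodule.coe_sum, Submodule.coe_smul] at h2
    exact h2.symm

variable {ι : Type*} [Fintype ι] {w : ι → H} {σ : ι → ℝ} {A : H →L[ℝ] H}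

theorem inner_sum_smul (hw : Orthonormal ℝ w) (c d : ι → ℝ) :
    inner ℝ (∑ j, c j • w j) (∑ j, d j • w j) = ∑ j, c j * d j := by
  rw [hw.inner_sum]
  simp

theorem norm_sum_smul_sq (hw : Orthonormal ℝ w) (c : ι → ℝ) :
    ‖∑ j, c j • w j‖ ^ 2 = ∑ j, c j ^ 2 := by
  rw [← real_inner_self_eq_norm_sq, inner_sum_smul hw]
  simp only [sq]

theorem aeval_sum_smul (hA : ∀ j, A (w j) = σ j • w j) (q : ℝ[X]) (c : ι → ℝ) :
    (aeval A q) (∑ j, c j • w j) = ∑ j, (q.eval (σ j) * c j) • w j := by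
  have h : ∀ j, (aeval A q) (w j) = q.eval (σ j) • w j := by
    intro j
    induction q using Polynomial.induction_on' with
    | add p q hp hq => rw [map_add, FunLike.coe_add, Pi.add_apply, hp, hq, eval_add, add_smul]
    | monomial n a =>
      have hpow : ∀ n : ℕ, (A ^ n) (w j) = (σ j) ^ n • w j := by
        intro n
        induction n with
        | zero => simp
        | succ n ih => rw [pow_succ', mul_apply_eq_comp, ih, map_smul, hA, smul_smul, pow_succ]
      rw [aeval_monomial, eval_monomial, mul_apply_eq_comp, hpow, Algebra.algebraMap_eq_smul_one,
        FunLike.coe_smul, Pi.smul_apply, FunLike.coe_one_eq_id, id_eq, smul_smul]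
  rw [map_sum]
  refine Finset.sum_congr rfl fun j _ => ?_
  rw [map_smul, h, smul_smul, mul_comm]

theorem apply_sum_smul (hA : ∀ j, A (w j) = σ j • w j) (c : ι → ℝ) :
    A (∑ j, c j • w j) = ∑ j, (σ j * c j) • w j := by
  simpa using aeval_sum_smul hA X c

theorem pow_sum_smul (hA : ∀ j, A (w j) = σ j • w j) (i : ℕ) (c : ι → ℝ) :
    (A ^ i) (∑ j, c j • w j) = ∑ j, (σ j ^ i * c j) • w j := by
  simpa using aeval_sum_smul hA (X ^ i) c

theorem energy_sum_smul (hw : Orthonormal ℝ w) (hA : ∀ j, A (w j) = σ j • w j) (lam : ℝ)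
    (c : ι → ℝ) :
    inner ℝ (A (∑ j, c j • w j)) (∑ j, c j • w j) + lam * ‖∑ j, c j • w j‖ ^ 2
      = ∑ j, (σ j + lam) * c j ^ 2 := by
  rw [apply_sum_smul hA, inner_sum_smul hw, norm_sum_smul_sq hw, Finset.mul_sum,
    ← Finset.sum_add_distrib]
  exact Finset.sum_congr rfl fun j _ => by ring

theorem pow_mul_exp_neg_le {x B : ℝ} (hx : 0 ≤ x) (hB : 0 < B) (n : ℕ) :
    x ^ n * Real.exp (-(x * B)) ≤ (n ! : ℝ) / B ^ n := by
  have h := Real.pow_div_factorial_le_exp (x * B) (by positivity) n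
  rw [div_le_iff₀ (by positivity)] at h
  rw [Real.exp_neg, ← div_eq_mul_inv, div_le_div_iff₀ (Real.exp_pos _) (by positivity),
    ← mul_pow]
  linarith

/-- The error bound for the early stopped conjugate gradient iteration, in operator form. The
hypothesis `hS` says that the source element `f` can only be tested against `g` in terms of the
energies of `g, A g, …, A^j g`; it is applied to spectrally localized elements `g`. -/
theorem energy_error_le (hw : Orthonormal ℝ w) (hA : ∀ j, A (w j) = σ j • w j)
    (hσ : ∀ j, 0 ≤ σ j) {b f : ι → ℝ} (hb : ∀ j, b j ≠ 0 → 0 < σ j) {lam Q F τ : ℝ}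
    (hτ : 3 / 2 ≤ τ) (hlam : 0 < lam) (hQ : 0 < Q) (hF : 0 ≤ F)
    (hZ : ∀ h : H, (inner ℝ (∑ j, b j • w j - A (∑ j, f j • w j)) h) ^ 2
      ≤ 9 / 16 * Q ^ 2 / lam * (inner ℝ (A h) h + lam * ‖h‖ ^ 2))
    {k : ℕ}
    (hS : ∀ (g : H) (G : ℝ), 0 ≤ G →
      (∀ i ≤ k, inner ℝ (A ((A ^ i) g)) ((A ^ i) g) + lam * ‖(A ^ i) g‖ ^ 2 ≤ (lam ^ i * G) ^ 2) →
      |inner ℝ g (∑ j, f j • w j)| ≤ F * G)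
    {m : ℕ} {q : ℝ[X]} (hq : q ∈ degreeLT ℝ m)
    (hmin : ∀ q' ∈ degreeLT ℝ m, ‖∑ j, b j • w j - A ((aeval A q) (∑ j, b j • w j))‖
      ≤ ‖∑ j, b j • w j - A ((aeval A q') (∑ j, b j • w j))‖)
    (hresid : ‖∑ j, b j • w j - A ((aeval A q) (∑ j, b j • w j))‖ ≤ τ * Q)
    (hbefore : 0 < m → ∀ q' ∈ degreeLT ℝ (m - 1),
      τ * Q ≤ ‖∑ j, b j • w j - A ((aeval A q') (∑ j, b j • w j))‖) :
    inner ℝ (A ((aeval A q) (∑ j, b j • w j) - ∑ j, f j • w j))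
        ((aeval A q) (∑ j, b j • w j) - ∑ j, f j • w j)
      + lam * ‖(aeval A q) (∑ j, b j • w j) - ∑ j, f j • w j‖ ^ 2
      ≤ (600 + 144 * τ ^ 2)
        * ((Q + lam * (√(2 * ((2 * k + 3)! : ℝ) * lam) * F)) ^ 2 / lam) := by
  have hres : ∀ q' : ℝ[X], ‖∑ j, b j • w j - A ((aeval A q') (∑ j, b j • w j))‖ ^ 2
      = sqNorm σ (fun j => b j ^ 2) (1 - X * q') := by
    intro q'
    rw [aeval_sum_smul hA, apply_sum_smul hA, ← Finset.sum_sub_distrib]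
    simp_rw [← sub_smul]
    rw [norm_sum_smul_sq hw, sqNorm]
    refine Finset.sum_congr rfl fun j _ => ?_
    simp only [eval_sub, eval_one, eval_mul, eval_X]
    ring
  have hdeg : ∀ (q' : ℝ[X]) (m' : ℕ), q' ∈ degreeLT ℝ m' → (1 - X * q').natDegree ≤ m' := by
    intro q' m' hq'
    rw [mem_degreeLT] at hq'
    refine (natDegree_sub_le _ _).trans ?_
    rw [natDegree_one]
    refine max_le (Nat.zero_le _) ?_
    rcases eq_or_ne q' 0 with rfl | h0
    · simp
    rw [natDegree_X_mul h0]
    exact (natDegree_lt_iff_degree_lt h0).2 hq'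
  have hsplit : ∀ (p : ℝ[X]) (m' : ℕ), p.natDegree ≤ m' → p.eval 0 = 1 →
      ∃ q' ∈ degreeLT ℝ m', p = 1 - X * q' := by
    intro p m' hp h0
    refine ⟨-p.divX, ?_, ?_⟩
    · rw [mem_degreeLT, degree_neg]
      rcases eq_or_ne p.divX 0 with h1 | h1
      · rw [h1, degree_zero]
        exact WithBot.bot_lt_coe _
      · rw [← natDegree_lt_iff_degree_lt h1, natDegree_divX_eq_natDegree_tsub_one]
        have : p.natDegree ≠ 0 := fun h => h1 (divX_eq_zero_iff.2 (eq_C_of_natDegree_eq_zero h))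
        omega
    · have h2 := X_mul_divX_add p
      rw [coeff_zero_eq_eval_zero, h0, C_1] at h2
      rw [mul_neg, sub_neg_eq_add, add_comm]
      exact h2.symm
  have hτQ : 0 ≤ τ * Q := mul_nonneg (by linarith) hQ.le
  have hp : IsMinResidual σ (fun j => b j ^ 2) m (1 - X * q) := by
    refine ⟨hdeg q m hq, by simp, fun p hpd hp0 => ?_⟩
    obtain ⟨q', hq', rfl⟩ := hsplit p m hpd hp0
    rw [← hres, ← hres]
    exact pow_le_pow_left₀ (norm_nonneg _) (hmin q' hq') 2
  set c : ℝ := ((2 * k + 3)! : ℝ) with hc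
  have hc1 : 1 ≤ c := by rw [hc]; exact_mod_cast Nat.one_le_iff_ne_zero.2 (Nat.factorial_ne_zero _)
  set F₁ := √(2 * c * lam) * F with hF₁
  have hF₁0 : 0 ≤ F₁ := by positivity
  have hs2 : √(2 * c * lam) ^ 2 = 2 * c * lam := Real.sq_sqrt (by positivity)
  have henergy : ∀ (d : ι → ℝ) (i : ℕ),
      inner ℝ (A ((A ^ i) (∑ j, d j • w j))) ((A ^ i) (∑ j, d j • w j))
        + lam * ‖(A ^ i) (∑ j, d j • w j)‖ ^ 2 = ∑ j, (σ j + lam) * (σ j ^ i * d j) ^ 2 := by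
    intro d i
    rw [pow_sum_smul hA, energy_sum_smul hw hA]
  have hquad : ∀ x y : ℝ, 0 ≤ x → 0 ≤ y → x ^ 2 ≤ y * x → x ≤ y := by
    intro x y hx hy h
    rcases hx.eq_or_lt with rfl | hx
    · exact hy
    · rw [sq] at h
      exact le_of_mul_le_mul_right h hx
  have hmain := spectral_error_le (σ := σ) (b := b) (f := f) (lam := lam) (Q := Q) (F := F₁)
    (τ := τ)
    hτ hσ hb hlam hQ hF₁0 ?_ ?_ ?_ hp ?_ ?_ rfl
  · rw [aeval_sum_smul hA, ← Finset.sum_sub_distrib]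
    simp_rw [← sub_smul]
    rw [energy_sum_smul hw hA]
    exact hmain
  · -- the noise bound, tested against `∑ j, (b j - σ j f j) / (σ j + lam) • w j`
    set S := ∑ j, (b j - σ j * f j) ^ 2 / (σ j + lam) with hSdef
    have h1 := hZ (∑ j, ((b j - σ j * f j) / (σ j + lam)) • w j)
    rw [energy_sum_smul hw hA, apply_sum_smul hA, ← Finset.sum_sub_distrib] at h1
    simp_rw [← sub_smul] at h1
    rw [inner_sum_smul hw] at h1
    have h2 : ∑ j, (b j - σ j * f j) * ((b j - σ j * f j) / (σ j + lam)) = S :=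
      Finset.sum_congr rfl fun j _ => by ring
    have h3 : ∑ j, (σ j + lam) * ((b j - σ j * f j) / (σ j + lam)) ^ 2 = S := by
      refine Finset.sum_congr rfl fun j _ => ?_
      have : σ j + lam ≠ 0 := by linarith [hσ j]
      field_simp
    rw [h2, h3] at h1
    exact hquad S _ (Finset.sum_nonneg fun j _ => div_nonneg (sq_nonneg _) (by linarith [hσ j]))
      (by positivity) h1
  · -- the low frequency part of `f`
    set d : ι → ℝ := fun j => if σ j ≤ lam then f j else 0 with hd
    set S := ∑ j, (if σ j ≤ lam then f j ^ 2 else 0) with hSdef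
    have hS0 : 0 ≤ S := Finset.sum_nonneg fun j _ => by split_ifs <;> positivity
    have h1 := hS (∑ j, d j • w j) (√(2 * c * lam) * √S) (by positivity) ?_
    · rw [inner_sum_smul hw] at h1
      have h2 : ∑ j, d j * f j = S := by
        refine Finset.sum_congr rfl fun j _ => ?_
        simp only [hd]
        split_ifs <;> ring
      rw [h2, abs_of_nonneg hS0] at h1
      have h3 : √S ≤ F₁ := by
        refine hquad _ _ (Real.sqrt_nonneg _) hF₁0 ?_
        rw [Real.sq_sqrt hS0, hF₁]
        linarith
      calc S = √S ^ 2 := (Real.sq_sqrt hS0).symm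
        _ ≤ F₁ ^ 2 := pow_le_pow_left₀ (Real.sqrt_nonneg _) h3 2
    · intro i _
      rw [henergy]
      have : (lam ^ i * (√(2 * c * lam) * √S)) ^ 2 = ∑ j, 2 * c * lam * (lam ^ i) ^ 2
          * (if σ j ≤ lam then f j ^ 2 else 0) := by
        rw [← Finset.mul_sum, mul_pow, mul_pow, hs2, Real.sq_sqrt hS0]
        ring
      rw [this]
      refine Finset.sum_le_sum fun j _ => ?_
      simp only [hd]
      split_ifs with hj
      · have h4 : σ j ^ i ≤ lam ^ i := pow_le_pow_left₀ (hσ j) hj i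
        have h5 : (σ j ^ i) ^ 2 ≤ (lam ^ i) ^ 2 := pow_le_pow_left₀ (pow_nonneg (hσ j) i) h4 2
        rw [mul_pow, ← mul_assoc]
        refine mul_le_mul_of_nonneg_right ?_ (sq_nonneg _)
        refine mul_le_mul ?_ h5 (sq_nonneg _) (by positivity)
        nlinarith [hσ j]
      · simp
  · -- the exponential filter
    intro B hB
    have hB0 : 0 < B := lt_of_lt_of_le (by positivity) hB
    have hBlam : 1 / B ≤ lam := by
      rw [div_le_iff₀ hB0]
      rw [div_le_iff₀ hlam] at hB
      linarith
    set e : ι → ℝ := fun j => Real.exp (-(σ j * B) / 2) with he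
    have he2 : ∀ j, e j ^ 2 = Real.exp (-(σ j * B)) := by
      intro j
      rw [he]
      simp only
      rw [← Real.exp_nat_mul]
      congr 1
      push_cast
      ring
    set S := ∑ j, Real.exp (-(σ j * B)) * (σ j * f j) ^ 2 with hSdef
    have hS0 : 0 ≤ S := Finset.sum_nonneg fun j _ => by positivity
    -- the coordinates of `exp(-B A) A² f`
    set d : ι → ℝ := fun j => e j ^ 2 * σ j ^ 2 * f j with hd
    have h1 := hS (∑ j, d j • w j) (√(2 * c * lam) * √S / B) (by positivity) ?_
    · rw [inner_sum_smul hw] at h1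
      have h2 : ∑ j, d j * f j = S := by
        refine Finset.sum_congr rfl fun j _ => ?_
        simp only [hd, ← he2]
        ring
      rw [h2, abs_of_nonneg hS0] at h1
      have h3 : √S ≤ F₁ / B := by
        refine hquad _ _ (Real.sqrt_nonneg _) (by positivity) ?_
        rw [Real.sq_sqrt hS0, hF₁]
        refine h1.trans (le_of_eq ?_)
        ring
      calc S = √S ^ 2 := (Real.sq_sqrt hS0).symm
        _ ≤ (F₁ / B) ^ 2 := pow_le_pow_left₀ (Real.sqrt_nonneg _) h3 2
    · intro i hi
      rw [henergy]
      have : (lam ^ i * (√(2 * c * lam) * √S / B)) ^ 2 = ∑ j, 2 * c * lam * (lam ^ i) ^ 2 / B ^ 2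
          * (Real.exp (-(σ j * B)) * (σ j * f j) ^ 2) := by
        rw [← Finset.mul_sum, mul_pow, div_pow, mul_pow, hs2, Real.sq_sqrt hS0]
        ring
      rw [this]
      refine Finset.sum_le_sum fun j _ => ?_
      have hfac : ∀ n : ℕ, n ≤ 2 * k + 3 → σ j ^ n * Real.exp (-(σ j * B)) ≤ c / B ^ n := by
        intro n hn
        refine (pow_mul_exp_neg_le (hσ j) hB0 n).trans ?_
        gcongr
        rw [hc]
        exact_mod_cast Nat.factorial_le hn
      have h6 : ∀ n : ℕ, 1 / B ^ n ≤ lam ^ n := by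
        intro n
        rw [← one_div_pow]
        exact pow_le_pow_left₀ (by positivity) hBlam n
      have h7 : (σ j + lam) * σ j ^ (2 * i + 2) * Real.exp (-(σ j * B))
          ≤ 2 * c * lam * (lam ^ i) ^ 2 / B ^ 2 := by
        have h8 := hfac (2 * i + 3) (by omega)
        have h9 := hfac (2 * i + 2) (by omega)
        have h10 : c / B ^ (2 * i + 3) ≤ c * lam ^ (2 * i + 1) / B ^ 2 := by
          have := h6 (2 * i + 1)
          calc c / B ^ (2 * i + 3) = c * (1 / B ^ (2 * i + 1)) / B ^ 2 := by
                field_simp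
                ring
            _ ≤ c * lam ^ (2 * i + 1) / B ^ 2 := by gcongr
        have h11 : lam * (c / B ^ (2 * i + 2)) ≤ c * lam ^ (2 * i + 1) / B ^ 2 := by
          have := h6 (2 * i)
          calc lam * (c / B ^ (2 * i + 2)) = lam * c * (1 / B ^ (2 * i)) / B ^ 2 := by
                field_simp
                ring
            _ ≤ lam * c * lam ^ (2 * i) / B ^ 2 := by gcongr
            _ = c * lam ^ (2 * i + 1) / B ^ 2 := by ring
        calc (σ j + lam) * σ j ^ (2 * i + 2) * Real.exp (-(σ j * B))
            = σ j ^ (2 * i + 3) * Real.exp (-(σ j * B))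
              + lam * (σ j ^ (2 * i + 2) * Real.exp (-(σ j * B))) := by ring
          _ ≤ c / B ^ (2 * i + 3) + lam * (c / B ^ (2 * i + 2)) := by gcongr
          _ ≤ c * lam ^ (2 * i + 1) / B ^ 2 + c * lam ^ (2 * i + 1) / B ^ 2 := add_le_add h10 h11
          _ = 2 * c * lam * (lam ^ i) ^ 2 / B ^ 2 := by ring
      calc (σ j + lam) * (σ j ^ i * d j) ^ 2
          = ((σ j + lam) * σ j ^ (2 * i + 2) * Real.exp (-(σ j * B)))
            * (Real.exp (-(σ j * B)) * (σ j * f j) ^ 2) := by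
            simp only [hd, he2]
            ring
        _ ≤ _ := mul_le_mul_of_nonneg_right h7 (by positivity)
  · rw [← hres]
    exact pow_le_pow_left₀ (norm_nonneg _) hresid 2
  · intro p hpd hp0
    obtain ⟨q', hq', rfl⟩ := hsplit p (m - 1) (by omega) hp0
    rw [← hres]
    exact pow_le_pow_left₀ hτQ (hbefore (by omega) q' hq') 2

/-- If `b` has no component on the kernel of `A`, then `b` lies in the range of `A` applied to
the Krylov space of `b`. -/
theorem exists_aeval_eq (hA : ∀ j, A (w j) = σ j • w j) {b : ι → ℝ}
    (hb : ∀ j, b j ≠ 0 → 0 < σ j) :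
    ∃ q : ℝ[X], A ((aeval A q) (∑ j, b j • w j)) = ∑ j, b j • w j := by
  classical
  set R : Multiset ℝ := (Finset.univ : Finset ι).val.map σ with hR
  set p := resPoly R with hp
  have h2 := X_mul_divX_add p
  rw [coeff_zero_eq_eval_zero, hp, eval_zero_resPoly, C_1, ← hp] at h2
  refine ⟨-p.divX, ?_⟩
  rw [aeval_sum_smul hA, apply_sum_smul hA]
  refine Finset.sum_congr rfl fun j _ => ?_
  by_cases hj : b j = 0
  · simp [hj]
  have hσj := hb j hj
  have h3 : p.eval (σ j) = 0 := by
    rw [hp, eval_resPoly]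
    refine Multiset.prod_eq_zero ?_
    rw [Multiset.mem_map]
    refine ⟨σ j, ?_, by rw [div_self hσj.ne', sub_self]⟩
    rw [hR, Multiset.mem_map]
    exact ⟨j, Finset.mem_univ j, rfl⟩
  have h4 := congrArg (eval (σ j)) h2
  simp only [eval_add, eval_mul, eval_X, eval_one] at h4
  rw [h3] at h4
  congr 1
  rw [eval_neg]
  linear_combination (-b j) * h4

end Eigenvectors

/-! ### The conjugate gradient iteration in the reproducing kernel Hilbert space -/

section SampleOperator

open Polynomial

variable {𝒳 : Type*} {H : Type*} [NormedAddCommGroup H] [InnerProductSpace ℝ H] [RKHS ℝ H 𝒳 ℝ]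
  [CompleteSpace H] {n : ℕ}

variable (H) in
/-- The empirical covariance operator `h ↦ (1/n) ∑ i, h(x_i) k(x_i, ·)`. -/
noncomputable def empCov (x : Fin n → 𝒳) : H →L[ℝ] H :=
  (1 / n : ℝ) • ∑ i, (innerSL ℝ (feature H (x i))).smulRight (feature H (x i))

theorem empCov_apply (x : Fin n → 𝒳) (h : H) :
    empCov H x h = (1 / n : ℝ) • ∑ i, h (x i) • feature H (x i) := by
  simp [empCov]

theorem expansionMap_apply (x : Fin n → 𝒳) (α : Fin n → ℝ) :
    expansionMap H x α = (1 / n : ℝ) • ∑ i, α i • feature H (x i) := rfl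

theorem empCov_eq_expansionMap (x : Fin n → 𝒳) (h : H) :
    empCov H x h = expansionMap H x fun i => h (x i) := by
  rw [empCov_apply, expansionMap_apply]

theorem inner_expansionMap (x : Fin n → 𝒳) (α : Fin n → ℝ) (h : H) :
    inner ℝ (expansionMap H x α) h = (1 / n) * ∑ i, α i * h (x i) := by
  rw [expansionMap_apply, inner_smul_left, sum_inner]
  simp [inner_smul_left]

theorem inner_empCov (x : Fin n → 𝒳) (g h : H) :
    inner ℝ (empCov H x g) h = (1 / n) * ∑ i, g (x i) * h (x i) := by
  rw [empCov_eq_expansionMap, inner_expansionMap]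

theorem empCov_symm (x : Fin n → 𝒳) (g h : H) :
    inner ℝ (empCov H x g) h = inner ℝ g (empCov H x h) := by
  rw [inner_empCov, real_inner_comm, inner_empCov]
  simp only [mul_comm]

theorem inner_empCov_self_nonneg (x : Fin n → 𝒳) (h : H) : 0 ≤ inner ℝ (empCov H x h) h := by
  rw [inner_empCov]
  exact mul_nonneg (by positivity) (Finset.sum_nonneg fun i _ => mul_self_nonneg _)

theorem coe_expansionMap (x : Fin n → 𝒳) (α : Fin n → ℝ) (t : 𝒳) :
    (expansionMap H x α : H) t = kernelExpansion (kern H) x α t := by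
  rw [← inner_feature, real_inner_comm, inner_expansionMap, kernelExpansion]
  simp [feature_apply, kern_comm t]

theorem expansionMap_mulVec (x : Fin n → 𝒳) (α : Fin n → ℝ) :
    expansionMap H x (kernelMatrix (kern H) x *ᵥ α) = empCov H x (expansionMap H x α) := by
  rw [empCov_eq_expansionMap]
  refine congrArg (expansionMap H x) (funext fun i => ?_)
  change ∑ j, kernelMatrix (kern H) x i j * α j = _
  rw [coe_expansionMap, kernelExpansion, Finset.mul_sum]
  refine Finset.sum_congr rfl fun j _ => ?_
  simp only [kernelMatrix, Matrix.of_apply]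
  rw [kern_comm (x i)]
  ring

theorem expansionMap_pow_mulVec (x : Fin n → 𝒳) (α : Fin n → ℝ) (j : ℕ) :
    expansionMap H x ((kernelMatrix (kern H) x ^ j) *ᵥ α)
      = (empCov H x ^ j) (expansionMap H x α) := by
  induction j with
  | zero => simp
  | succ j ih =>
    rw [pow_succ', ← Matrix.mulVec_mulVec, expansionMap_mulVec, ih, pow_succ', mul_apply_eq_comp]

/-- The evaluation `q ↦ q(A) v`. -/
noncomputable def aevalApply (A : H →L[ℝ] H) (v : H) : ℝ[X] →ₗ[ℝ] H where
  toFun q := aeval A q v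
  map_add' p q := by rw [map_add]; rfl
  map_smul' c q := by rw [map_smul]; rfl

/-- The functions `f_α`, for `α` in the Krylov space of the kernel matrix, form the Krylov space of
the empirical covariance. -/
theorem map_krylov (x : Fin n → 𝒳) (y : Fin n → ℝ) (m : ℕ) :
    (krylov (kernelMatrix (kern H) x) y m).map (expansionMap H x)
      = (degreeLT ℝ m).map (aevalApply (empCov H x) (expansionMap H x y)) := by
  rw [krylov, degreeLT_eq_span_X_pow, Submodule.map_span, Submodule.map_span]
  congr 1
  ext v
  simp only [Set.mem_image, Set.mem_Iio, Finset.coe_image, Finset.coe_range,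
    exists_exists_and_eq_and]
  refine exists_congr fun j => and_congr_right fun _ => ?_
  rw [expansionMap_pow_mulVec]
  simp [aevalApply]

theorem matNorm_residual (x : Fin n → 𝒳) (y : Fin n → ℝ) (m : ℕ) :
    matNorm (kernelMatrix (kern H) x) ((fun i => cgEstimator H x y m (x i)) - y)
      = ‖expansionMap H x y - empCov H x (expansionMap H x (cgCoeff H x y m))‖ := by
  rw [matNorm_kernelMatrix, map_sub, norm_sub_rev, empCov_eq_expansionMap]
  simp only [coe_expansionMap]
  rfl

/-- The iterate `f_m` is `q(A) b` for the polynomial `q` of degree less than `m` that minimizes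
`‖b - A q(A) b‖`, where `A` is the empirical covariance and `b` the expansion of the data. -/
theorem exists_cg_polynomial (x : Fin n → 𝒳) (y : Fin n → ℝ) (m : ℕ) :
    ∃ q ∈ degreeLT ℝ m,
      expansionMap H x (cgCoeff H x y m) = aeval (empCov H x) q (expansionMap H x y) ∧
      ∀ q' ∈ degreeLT ℝ m,
        ‖expansionMap H x y - empCov H x (aeval (empCov H x) q (expansionMap H x y))‖
          ≤ ‖expansionMap H x y - empCov H x (aeval (empCov H x) q' (expansionMap H x y))‖ := by
  obtain ⟨hmem, hmin⟩ : IsCGSolution (kernelMatrix (kern H) x) y m (cgCoeff H x y m) :=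
    (exists_isCGSolution H x y m).choose_spec
  have h1 := Submodule.mem_map_of_mem (f := expansionMap H x) hmem
  rw [map_krylov] at h1
  obtain ⟨q, hq, hqe⟩ := h1
  refine ⟨q, hq, hqe.symm, fun q' hq' => ?_⟩
  have h2 := Submodule.mem_map_of_mem (f := aevalApply (empCov H x) (expansionMap H x y)) hq'
  rw [← map_krylov] at h2
  obtain ⟨β, hβ, hβe⟩ := h2
  have h3 := hmin β hβ
  rw [matNorm_kernelMatrix, matNorm_kernelMatrix, map_sub, map_sub, expansionMap_mulVec,
    expansionMap_mulVec, hβe, ← hqe] at h3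
  exact h3

/-- Eigenvectors of the empirical covariance that span the data and a given element. -/
theorem exists_sample_eigenvectors (x : Fin n → 𝒳) (y : Fin n → ℝ) (f : H) :
    ∃ (N : ℕ) (w : Fin N → H) (σ b c : Fin N → ℝ), Orthonormal ℝ w ∧
      (∀ j, empCov H x (w j) = σ j • w j) ∧ (∀ j, 0 ≤ σ j) ∧ (∀ j, b j ≠ 0 → 0 < σ j) ∧
      expansionMap H x y = ∑ j, b j • w j ∧ f = ∑ j, c j • w j := by
  set W : Submodule ℝ H := Submodule.span ℝ (insert f (Set.range fun i => feature H (x i)))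
  have hfin : FiniteDimensional ℝ W :=
    FiniteDimensional.span_of_finite ℝ ((Set.finite_range _).insert f)
  have hE : ∀ α, expansionMap H x α ∈ W := by
    intro α
    rw [expansionMap_apply]
    refine W.smul_mem _ (W.sum_mem fun i _ => W.smul_mem _ (Submodule.subset_span ?_))
    exact Set.mem_insert_of_mem _ ⟨i, rfl⟩
  obtain ⟨N, w, σ, hw, hwA, hWe⟩ := exists_eigenvectors (empCov_symm x) W fun h _ => by
    rw [empCov_eq_expansionMap]
    exact hE _
  have hσ : ∀ j, σ j = inner ℝ (empCov H x (w j)) (w j) := by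
    intro j
    rw [hwA, inner_smul_left, real_inner_self_eq_norm_sq, hw.1 j]
    simp
  have hσ0 : ∀ j, 0 ≤ σ j := fun j => by rw [hσ]; exact inner_empCov_self_nonneg x _
  refine ⟨N, w, σ, fun j => inner ℝ (w j) (expansionMap H x y), fun j => inner ℝ (w j) f, hw, hwA,
    hσ0, fun j hj => ?_, hWe _ (hE y), hWe _ (Submodule.subset_span (Set.mem_insert _ _))⟩
  refine lt_of_le_of_ne (hσ0 j) fun h0 => hj ?_
  change inner ℝ (w j) (expansionMap H x y) = 0
  have h1 := hσ j
  rw [← h0, inner_empCov] at h1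
  rcases Nat.eq_zero_or_pos n with hn | hn
  · rw [real_inner_comm, inner_expansionMap]
    simp [hn]
  have h2 : ∑ i, w j (x i) * w j (x i) = 0 := by
    have : (1 / (n : ℝ)) ≠ 0 := by positivity
    rcases mul_eq_zero.1 h1.symm with h | h
    · exact absurd h this
    · exact h
  rw [Finset.sum_eq_zero_iff_of_nonneg fun i _ => mul_self_nonneg _] at h2
  rw [real_inner_comm, inner_expansionMap, Finset.sum_eq_zero, mul_zero]
  intro i hi
  rw [mul_self_eq_zero.1 (h2 i hi), mul_zero]

/-- The residual vanishes after finitely many iterations, so the stopping index exists. -/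
theorem exists_isDiscrepancyStop (x : Fin n → 𝒳) (y : Fin n → ℝ) {Λ : ℝ} (hΛ : 0 < Λ) :
    ∃ m, IsDiscrepancyStop H x y Λ m := by
  classical
  obtain ⟨N, w, σ, b, c, -, hA, -, hb, hbe, -⟩ := exists_sample_eigenvectors x y (0 : H)
  obtain ⟨q₀, hq₀⟩ := exists_aeval_eq hA hb
  rw [← hbe] at hq₀
  have hex : ∃ m, matNorm (kernelMatrix (kern H) x)
      ((fun i => cgEstimator H x y m (x i)) - y) < Λ := by
    refine ⟨q₀.natDegree + 1, ?_⟩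
    obtain ⟨q, -, hqe, hmin⟩ := exists_cg_polynomial (H := H) x y (q₀.natDegree + 1)
    have h1 := hmin q₀ (by
      rw [mem_degreeLT]
      exact degree_le_natDegree.trans_lt (by exact_mod_cast Nat.lt_succ_self _))
    rw [hq₀, sub_self, norm_zero] at h1
    rw [matNorm_residual, hqe]
    exact h1.trans_lt hΛ
  exact ⟨Nat.find hex, Nat.find_spec hex, fun m hm => Nat.find_min' hex hm⟩

/-- The error of the early stopped iteration in the empirical energy norm. -/
theorem IsDiscrepancyStop.energy_error_le {x : Fin n → 𝒳} {y : Fin n → ℝ} {τ Q : ℝ} {m : ℕ}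
    (hm : IsDiscrepancyStop H x y (τ * Q) m) {f : H} {lam F : ℝ}
    (hτ : 3 / 2 ≤ τ) (hlam : 0 < lam) (hQ : 0 < Q) (hF : 0 ≤ F)
    (hZ : ∀ h : H, (inner ℝ (expansionMap H x y - empCov H x f) h) ^ 2
      ≤ 9 / 16 * Q ^ 2 / lam * (inner ℝ (empCov H x h) h + lam * ‖h‖ ^ 2))
    {k : ℕ}
    (hS : ∀ (g : H) (G : ℝ), 0 ≤ G →
      (∀ i ≤ k, inner ℝ (empCov H x ((empCov H x ^ i) g)) ((empCov H x ^ i) g)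
        + lam * ‖(empCov H x ^ i) g‖ ^ 2 ≤ (lam ^ i * G) ^ 2) →
      |inner ℝ g f| ≤ F * G) :
    inner ℝ (empCov H x (expansionMap H x (cgCoeff H x y m) - f))
        (expansionMap H x (cgCoeff H x y m) - f)
      + lam * ‖expansionMap H x (cgCoeff H x y m) - f‖ ^ 2
      ≤ (600 + 144 * τ ^ 2)
        * ((Q + lam * (√(2 * ((2 * k + 3)! : ℝ) * lam) * F)) ^ 2 / lam) := by
  obtain ⟨N, w, σ, b, c, hw, hA, hσ, hb, hbe, hfe⟩ := exists_sample_eigenvectors x y f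
  obtain ⟨q, hq, hqe, hmin⟩ := exists_cg_polynomial (H := H) x y m
  have hresid := hm.1
  rw [Set.mem_ofPred_eq, matNorm_residual, hqe] at hresid
  have hbefore : 0 < m → ∀ q' ∈ degreeLT ℝ (m - 1), τ * Q
      ≤ ‖expansionMap H x y - empCov H x (aeval (empCov H x) q' (expansionMap H x y))‖ := by
    intro h0 q' hq'
    obtain ⟨q₁, -, hqe₁, hmin₁⟩ := exists_cg_polynomial (H := H) x y (m - 1)
    refine le_trans ?_ (hmin₁ q' hq')
    rw [← hqe₁, ← matNorm_residual]
    by_contra! hlt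
    have := hm.2 hlt
    omega
  rw [hqe]
  rw [hbe] at hmin hresid hbefore hZ ⊢
  rw [hfe] at hZ ⊢
  rw [hfe] at hS
  exact KernelCG.energy_error_le hw hA hσ hb hτ hlam hQ hF hZ hS hq hmin hresid.le hbefore

end SampleOperator

/-! ### Comparison of the empirical covariance with the population covariance -/

section Comparison

variable {E : Type*} [NormedAddCommGroup E] [InnerProductSpace ℝ E] [CompleteSpace E]
variable {H : Type*} [NormedAddCommGroup H] [InnerProductSpace ℝ H] [CompleteSpace H]
variable {T : H →L[ℝ] E} {A : H →L[ℝ] H} {lam κ η : ℝ}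

theorem sqrt_mul_norm_le_norm_toEnergy (hlam : 0 ≤ lam) (h : H) :
    √lam * ‖h‖ ≤ ‖toEnergy T lam h‖ := by
  rw [← Real.sqrt_sq (norm_nonneg (toEnergy T lam h)), norm_toEnergy_sq hlam,
    ← Real.sqrt_sq (norm_nonneg h), ← Real.sqrt_mul hlam, Real.sqrt_sq (norm_nonneg h)]
  exact Real.sqrt_le_sqrt (by linarith [sq_nonneg ‖T h‖])

/-- If `A` is close to `T* T`, then the energy norm of `T* T` is dominated by that of `A`. -/
theorem norm_toEnergy_sq_le_two_mul (hlam : 0 ≤ lam) (hη : 2 * η ≤ √lam)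
    (hA : ∀ g h, |inner ℝ (T g) (T h) - inner ℝ (A g) h| ≤ η * ‖g‖ * ‖toEnergy T lam h‖) (h : H) :
    ‖toEnergy T lam h‖ ^ 2 ≤ 2 * (inner ℝ (A h) h + lam * ‖h‖ ^ 2) := by
  have h1 := (abs_le.1 (hA h h)).2
  have h2 := sqrt_mul_norm_le_norm_toEnergy (T := T) hlam h
  have h3 := norm_toEnergy_sq (T := T) hlam h
  rw [real_inner_self_eq_norm_sq] at h1
  have h4 : 2 * (η * ‖h‖ * ‖toEnergy T lam h‖) ≤ ‖toEnergy T lam h‖ ^ 2 := by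
    calc 2 * (η * ‖h‖ * ‖toEnergy T lam h‖) = (2 * η) * ‖h‖ * ‖toEnergy T lam h‖ := by ring
      _ ≤ √lam * ‖h‖ * ‖toEnergy T lam h‖ := by gcongr
      _ ≤ ‖toEnergy T lam h‖ * ‖toEnergy T lam h‖ := by gcongr
      _ = _ := by ring
  linarith

theorem norm_comp_adjoint_apply_le (hκ : 0 ≤ κ) (hT : ∀ h, ‖T h‖ ^ 2 ≤ κ * ‖h‖ ^ 2) (x : E) :
    ‖(T ∘L T.adjoint) x‖ ≤ κ * ‖x‖ := by
  have h1 : ‖T‖ ≤ √κ := by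
    refine T.opNorm_le_bound (Real.sqrt_nonneg _) fun h => ?_
    rw [← Real.sqrt_sq (norm_nonneg h), ← Real.sqrt_mul hκ]
    exact Real.le_sqrt_of_sq_le (hT h)
  calc ‖(T ∘L T.adjoint) x‖ ≤ ‖T‖ * (‖T.adjoint‖ * ‖x‖) :=
        (T.le_opNorm _).trans (by gcongr; exact T.adjoint.le_opNorm x)
    _ ≤ √κ * (√κ * ‖x‖) := by
        rw [LinearIsometryEquiv.norm_map]
        gcongr
    _ = κ * ‖x‖ := by rw [← mul_assoc, Real.mul_self_sqrt hκ]

theorem norm_pow_comp_adjoint_apply_le (hκ : 0 ≤ κ) (hT : ∀ h, ‖T h‖ ^ 2 ≤ κ * ‖h‖ ^ 2) (i : ℕ)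
    (h : H) : ‖((T ∘L T.adjoint) ^ i) (T h)‖ ≤ κ ^ i * (√κ * ‖h‖) := by
  have hpow : ∀ x : E, ‖((T ∘L T.adjoint) ^ i) x‖ ≤ κ ^ i * ‖x‖ := by
    induction i with
    | zero => intro x; simp
    | succ i ihi =>
      intro x
      rw [pow_succ, mul_apply_eq_comp]
      refine (ihi _).trans ?_
      rw [pow_succ, mul_assoc]
      gcongr
      exact norm_comp_adjoint_apply_le hκ hT x
  refine (hpow _).trans ?_
  gcongr
  refine le_of_sq_le_sq ?_ (by positivity)
  rw [mul_pow, Real.sq_sqrt hκ]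
  exact hT h

/-- The bound on the energies of `g, A g, …, A^k g` for the empirical covariance `A` is transferred
to the population covariance `T* T`, one factor at a time. -/
theorem norm_pow_comp_adjoint_le (hlam : 0 < lam) (hκ : 0 ≤ κ)
    (hT : ∀ h, ‖T h‖ ^ 2 ≤ κ * ‖h‖ ^ 2) (hη0 : 0 ≤ η) (hη : 2 * η ≤ √lam)
    (hAs : ∀ g h, inner ℝ (A g) h = inner ℝ g (A h))
    (hA : ∀ g h, |inner ℝ (T g) (T h) - inner ℝ (A g) h| ≤ η * ‖g‖ * ‖toEnergy T lam h‖) {k : ℕ}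
    (hk : ∀ i < k, √κ * κ ^ i * (2 * η) ≤ lam ^ (i + 1)) (g : H) {G : ℝ} (hG : 0 ≤ G)
    (hg : ∀ i ≤ k, inner ℝ (A ((A ^ i) g)) ((A ^ i) g) + lam * ‖(A ^ i) g‖ ^ 2
      ≤ (lam ^ i * G) ^ 2) :
    ‖((T ∘L T.adjoint) ^ k) (T g)‖ ≤ (k + 2) * lam ^ k * G := by
  have hJ : ∀ (g : H) (G : ℝ), 0 ≤ G → inner ℝ (A g) g + lam * ‖g‖ ^ 2 ≤ G ^ 2 →
      ‖toEnergy T lam g‖ ≤ 2 * G := by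
    intro g G hG h
    refine le_of_sq_le_sq ?_ (by positivity)
    have := norm_toEnergy_sq_le_two_mul hlam.le hη hA g
    nlinarith [sq_nonneg G]
  induction k generalizing g G with
  | zero =>
    have h0 := hg 0 le_rfl
    simp only [pow_zero, FunLike.coe_one_eq_id, id_eq, one_mul] at h0
    have h1 := hJ g G hG h0
    have h2 : ‖T g‖ ≤ ‖toEnergy T lam g‖ := by
      refine le_of_sq_le_sq ?_ (norm_nonneg _)
      rw [norm_toEnergy_sq hlam.le]
      nlinarith [sq_nonneg ‖g‖]
    simpa using h2.trans h1
  | succ k ih =>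
    set K := T ∘L T.adjoint with hK
    -- `T* T g = A g + v`, where `v` is small because its pairing with `g` is
    set v : H := T.adjoint (T g) - A g with hv
    have hdec : (K ^ (k + 1)) (T g) = (K ^ k) (T (A g)) + (K ^ k) (T v) := by
      rw [pow_succ, mul_apply_eq_comp, ← map_add, ← map_add, hv, add_sub_cancel]
      rfl
    have h1 : ‖(K ^ k) (T (A g))‖ ≤ (k + 2) * lam ^ k * (lam * G) := by
      refine ih (fun i hi => hk i (by omega)) (A g) (by positivity) fun i hi => ?_
      have h2 := hg (i + 1) (by omega)
      have h3 : (A ^ (i + 1)) g = (A ^ i) (A g) := by rw [pow_succ, mul_apply_eq_comp]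
      rw [h3] at h2
      refine h2.trans (le_of_eq ?_)
      ring
    have h0 := hg 0 (Nat.zero_le _)
    simp only [pow_zero, FunLike.coe_one_eq_id, id_eq, one_mul] at h0
    have hJg := hJ g G hG h0
    have hvn : ‖v‖ ≤ η * (2 * G) := by
      have h2 : ‖v‖ ^ 2 ≤ η * ‖v‖ * ‖toEnergy T lam g‖ := by
        have h3 : ‖v‖ ^ 2 = inner ℝ (T v) (T g) - inner ℝ (A v) g := by
          rw [hAs, ← ContinuousLinearMap.adjoint_inner_right, ← inner_sub_right, ← hv,
            real_inner_self_eq_norm_sq]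
        rw [h3]
        exact (le_abs_self _).trans (hA v g)
      rcases (norm_nonneg v).eq_or_lt with h0 | h0
      · rw [← h0]; positivity
      · refine le_of_mul_le_mul_right ?_ h0
        calc ‖v‖ * ‖v‖ = ‖v‖ ^ 2 := (sq _).symm
          _ ≤ η * ‖v‖ * ‖toEnergy T lam g‖ := h2
          _ ≤ η * ‖v‖ * (2 * G) := by gcongr
          _ = η * (2 * G) * ‖v‖ := by ring
    have h4 : ‖(K ^ k) (T v)‖ ≤ lam ^ (k + 1) * G := by
      calc ‖(K ^ k) (T v)‖ ≤ κ ^ k * (√κ * (η * (2 * G))) :=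
            (norm_pow_comp_adjoint_apply_le hκ hT k v).trans (by gcongr)
        _ = (√κ * κ ^ k * (2 * η)) * G := by ring
        _ ≤ lam ^ (k + 1) * G := by
            gcongr
            exact hk k (Nat.lt_succ_self k)
    rw [hdec]
    refine (norm_add_le _ _).trans ((add_le_add h1 h4).trans (le_of_eq ?_))
    push_cast
    ring

end Comparison

section SourceFunctional

variable {E : Type*} [NormedAddCommGroup E] [InnerProductSpace ℝ E] [CompleteSpace E]
variable {H : Type*} [NormedAddCommGroup H] [InnerProductSpace ℝ H] [CompleteSpace H]
variable {T : H →L[ℝ] E} {lam κ r U : ℝ} {f : H}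

/-- An interpolation inequality that turns into `a = lam^(2 r - 1)` in the source condition. It uses
`2 r - 1 ≤ 2 ⌊r⌋ + 1`. -/
theorem rpow_le_rpow_add_mul_pow (hlam : 0 < lam) (hr : 1 / 2 ≤ r) {ξ : ℝ} (hξ : 0 < ξ) :
    ξ ^ (2 * r - 1) ≤ lam ^ (2 * r - 1)
      + lam ^ (2 * r - 1) / lam ^ (2 * ⌊r⌋₊ + 1) * ξ ^ (2 * ⌊r⌋₊ + 1) := by
  rcases le_or_gt ξ lam with h | h
  · have h1 : ξ ^ (2 * r - 1) ≤ lam ^ (2 * r - 1) := Real.rpow_le_rpow hξ.le h (by linarith)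
    have h2 : 0 ≤ lam ^ (2 * r - 1) / lam ^ (2 * ⌊r⌋₊ + 1) * ξ ^ (2 * ⌊r⌋₊ + 1) := by positivity
    linarith
  · have h1 : (ξ / lam) ^ (2 * r - 1) ≤ (ξ / lam) ^ (2 * ⌊r⌋₊ + 1) := by
      rw [← Real.rpow_natCast]
      refine Real.rpow_le_rpow_of_exponent_le ?_ ?_
      · rw [one_le_div hlam]; exact h.le
      · have := Nat.lt_floor_add_one r
        push_cast
        linarith
    rw [Real.div_rpow hξ.le hlam.le, div_pow, div_le_div_iff₀ (by positivity) (by positivity)] at h1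
    have h2 : ξ ^ (2 * r - 1) ≤ lam ^ (2 * r - 1) / lam ^ (2 * ⌊r⌋₊ + 1) * ξ ^ (2 * ⌊r⌋₊ + 1) := by
      rw [div_mul_eq_mul_div, le_div_iff₀ (by positivity)]
      linarith
    have h3 : 0 ≤ lam ^ (2 * r - 1) := by positivity
    linarith

theorem rpow_two_mul_sub_one (hlam : 0 < lam) (r : ℝ) :
    lam ^ (2 * r - 1) = lam * (lam ^ (r - 1)) ^ 2 := by
  rw [← Real.rpow_natCast, ← Real.rpow_mul hlam.le]
  nth_rewrite 2 [← Real.rpow_one lam]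
  rw [← Real.rpow_add hlam]
  congr 1
  push_cast
  ring

/-- The source element tested against `g`, when the energies of `g` are of size `G`. -/
theorem abs_inner_source_le (hlam : 0 < lam) (hr : 1 / 2 ≤ r) (hU : 0 ≤ U)
    (hf : ∀ (j : ℕ) (a b : ℝ), 0 ≤ a → 0 ≤ b →
      (∀ ξ, 0 < ξ → ξ ≤ κ → ξ ^ (2 * r - 1) ≤ a + b * ξ ^ (2 * j + 1)) →
      ∀ h : H, (inner ℝ h f) ^ 2
        ≤ U ^ 2 * (a * ‖h‖ ^ 2 + b * ‖((T ∘L T.adjoint) ^ j) (T h)‖ ^ 2))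
    {g : H} {G : ℝ} (hG : 0 ≤ G) (hg0 : lam * ‖g‖ ^ 2 ≤ G ^ 2)
    (hg1 : ‖((T ∘L T.adjoint) ^ ⌊r⌋₊) (T g)‖ ≤ (⌊r⌋₊ + 2) * lam ^ ⌊r⌋₊ * G) :
    |inner ℝ g f| ≤ (⌊r⌋₊ + 3) * U * lam ^ (r - 1) * G := by
  set k := ⌊r⌋₊
  have h1 := hf k (lam ^ (2 * r - 1)) (lam ^ (2 * r - 1) / lam ^ (2 * k + 1))
    (by positivity) (by positivity)
    (fun ξ h0 _ => rpow_le_rpow_add_mul_pow hlam hr h0) g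
  have h2 := rpow_two_mul_sub_one hlam r
  refine abs_le_of_sq_le_sq (h1.trans ?_) (by positivity)
  have h3 : lam ^ (2 * r - 1) * ‖g‖ ^ 2 ≤ (lam ^ (r - 1)) ^ 2 * G ^ 2 := by
    rw [h2]
    calc lam * (lam ^ (r - 1)) ^ 2 * ‖g‖ ^ 2 = (lam ^ (r - 1)) ^ 2 * (lam * ‖g‖ ^ 2) := by ring
      _ ≤ _ := by gcongr
  have h4 : lam ^ (2 * r - 1) / lam ^ (2 * k + 1) * ‖((T ∘L T.adjoint) ^ k) (T g)‖ ^ 2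
      ≤ (lam ^ (r - 1)) ^ 2 * ((k + 2) * G) ^ 2 := by
    calc _ ≤ lam ^ (2 * r - 1) / lam ^ (2 * k + 1) * ((k + 2) * lam ^ k * G) ^ 2 := by gcongr
      _ = (lam ^ (r - 1)) ^ 2 * ((k + 2) * G) ^ 2 := by
        rw [h2]
        field_simp
        ring
  calc U ^ 2 * (lam ^ (2 * r - 1) * ‖g‖ ^ 2
        + lam ^ (2 * r - 1) / lam ^ (2 * k + 1) * ‖((T ∘L T.adjoint) ^ k) (T g)‖ ^ 2)
      ≤ U ^ 2 * ((lam ^ (r - 1)) ^ 2 * G ^ 2 + (lam ^ (r - 1)) ^ 2 * ((k + 2) * G) ^ 2) := by gcongr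
    _ ≤ ((k + 3) * U * lam ^ (r - 1) * G) ^ 2 := by
      have h5 : (1 : ℝ) + (k + 2) ^ 2 ≤ (k + 3) ^ 2 := by
        have : (0 : ℝ) ≤ k := Nat.cast_nonneg k
        nlinarith
      calc _ = (U * lam ^ (r - 1) * G) ^ 2 * (1 + ((k : ℝ) + 2) ^ 2) := by ring
        _ ≤ (U * lam ^ (r - 1) * G) ^ 2 * ((k : ℝ) + 3) ^ 2 := by gcongr
        _ = _ := by ring

end SourceFunctional

/-! ### The excess risk on the good event -/

section GoodEvent

variable {𝒳 : Type*} {H : Type*} [NormedAddCommGroup H] [InnerProductSpace ℝ H] [RKHS ℝ H 𝒳 ℝ]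
  [CompleteSpace H] {n : ℕ}
variable {E : Type*} [NormedAddCommGroup E] [InnerProductSpace ℝ E] [CompleteSpace E]
variable {T : H →L[ℝ] E} {lam κ r ρ M τ : ℝ} {f : H} {x : Fin n → 𝒳} {y : Fin n → ℝ} {m : ℕ}

/-- The constant in the excess risk bound: `600 + 144 τ²` comes from the spectral error bound, the
factor `2` from the comparison of the norms, and the rest from the source condition. -/
noncomputable def rateConst (r τ : ℝ) : ℝ :=
  2 * (600 + 144 * τ ^ 2) * (√(2 * ((2 * ⌊r⌋₊ + 3)! : ℝ)) * (⌊r⌋₊ + 3)) ^ 2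

theorem rateConst_pos (r τ : ℝ) : 0 < rateConst r τ := by
  have : 0 < ((2 * ⌊r⌋₊ + 3)! : ℝ) := by exact_mod_cast Nat.factorial_pos _
  rw [rateConst]
  positivity

variable (T f κ r ρ) in
/-- The form in which the source condition `f = K^r u`, `‖u‖ ≤ κ^(-r) ρ` is used: a bound for the
functional `⟨·, f⟩` of the reproducing kernel Hilbert space by an interpolation between the norms
`‖h‖` and `‖K^j T h‖`. -/
def IsSourceFunctional : Prop :=
  ∀ (j : ℕ) (a b : ℝ), 0 ≤ a → 0 ≤ b →
    (∀ ξ, 0 < ξ → ξ ≤ κ → ξ ^ (2 * r - 1) ≤ a + b * ξ ^ (2 * j + 1)) →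
    ∀ h : H, (inner ℝ h f) ^ 2
      ≤ (κ ^ (-r) * ρ) ^ 2 * (a * ‖h‖ ^ 2 + b * ‖((T ∘L T.adjoint) ^ j) (T h)‖ ^ 2)

/-- The excess risk bound, once the empirical energy norm dominates the population norm, the noise
is controlled in the empirical energy norm, and empirical energies are transferred to the
population covariance. -/
theorem excess_le_of_transfer (hκ : 0 < κ) (hr : 1 / 2 ≤ r) (hρ : 0 ≤ ρ)
    (hf : IsSourceFunctional T κ r ρ f) (hτ : 3 / 2 ≤ τ) (hlam : 0 < lam) (hM : 0 < M)
    (hm : IsDiscrepancyStop H x y (τ * (M * √lam * (lam / κ) ^ r)) m)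
    (hcmp : ∀ h, ‖T h‖ ^ 2 ≤ 2 * (inner ℝ (empCov H x h) h + lam * ‖h‖ ^ 2))
    (hZ : ∀ h : H, (inner ℝ (expansionMap H x y - empCov H x f) h) ^ 2
      ≤ 9 / 16 * (M * (lam / κ) ^ r) ^ 2 * (inner ℝ (empCov H x h) h + lam * ‖h‖ ^ 2))
    (hpow : ∀ (g : H) (G : ℝ), 0 ≤ G →
      (∀ i ≤ ⌊r⌋₊, inner ℝ (empCov H x ((empCov H x ^ i) g)) ((empCov H x ^ i) g)
        + lam * ‖(empCov H x ^ i) g‖ ^ 2 ≤ (lam ^ i * G) ^ 2) →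
      ‖((T ∘L T.adjoint) ^ ⌊r⌋₊) (T g)‖ ≤ (⌊r⌋₊ + 2) * lam ^ ⌊r⌋₊ * G) :
    ‖T (expansionMap H x (cgCoeff H x y m) - f)‖ ^ 2
      ≤ rateConst r τ * (M + ρ) ^ 2 * (lam / κ) ^ (2 * r) := by
  set k := ⌊r⌋₊ with hk
  set c : ℝ := ((2 * k + 3)! : ℝ) with hc
  have hc1 : 1 ≤ c := by rw [hc]; exact_mod_cast Nat.one_le_iff_ne_zero.2 (Nat.factorial_ne_zero _)
  have ht0 : 0 < lam / κ := by positivity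
  set Q := M * √lam * (lam / κ) ^ r with hQ
  have hQ0 : 0 < Q := by positivity
  have hslam : 0 < √lam := Real.sqrt_pos.2 hlam
  have hslam2 : √lam ^ 2 = lam := Real.sq_sqrt hlam.le
  have hQlam : Q ^ 2 / lam = (M * (lam / κ) ^ r) ^ 2 := by
    rw [div_eq_iff hlam.ne']
    calc Q ^ 2 = (M * (lam / κ) ^ r) ^ 2 * √lam ^ 2 := by rw [hQ]; ring
      _ = _ := by rw [hslam2]
  set F := (k + 3) * (κ ^ (-r) * ρ) * lam ^ (r - 1) with hF
  have hF0 : 0 ≤ F := by positivity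
  have hmain := hm.energy_error_le (f := f) (F := F) (k := k) hτ hlam hQ0 hF0
    (fun h => by rw [mul_div_assoc, hQlam]; exact hZ h) (fun g G hG hg => ?_)
  · set e := expansionMap H x (cgCoeff H x y m) - f
    refine (hcmp e).trans ((mul_le_mul_of_nonneg_left hmain two_pos.le).trans ?_)
    have h1 : lam * (√(2 * c * lam) * F)
        = (√(2 * c) * (k + 3)) * (ρ * √lam * (lam / κ) ^ r) := by
      have h2 : lam ^ (r - 1) * lam = lam ^ r := by
        rw [Real.rpow_sub_one hlam.ne', div_mul_cancel₀ _ hlam.ne']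
      rw [Real.sqrt_mul (by positivity), hF, Real.div_rpow hlam.le hκ.le, Real.rpow_neg hκ.le, ← h2]
      field_simp
    rw [h1]
    set d := √(2 * c) * (k + 3) with hd
    have hd1 : 1 ≤ d := by
      have h2 : 1 ≤ √(2 * c) := by
        rw [Real.one_le_sqrt]
        linarith
      have h3 : (0 : ℝ) ≤ k := Nat.cast_nonneg k
      nlinarith
    have h4 : (lam / κ) ^ (2 * r) = ((lam / κ) ^ r) ^ 2 := by
      rw [← Real.rpow_natCast, ← Real.rpow_mul ht0.le]
      congr 1
      push_cast
      ring
    have h5 : (Q + d * (ρ * √lam * (lam / κ) ^ r)) ^ 2 / lam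
        ≤ d ^ 2 * (M + ρ) ^ 2 * (lam / κ) ^ (2 * r) := by
      rw [div_le_iff₀ hlam, h4]
      calc (Q + d * (ρ * √lam * (lam / κ) ^ r)) ^ 2
          ≤ (d * Q + d * (ρ * √lam * (lam / κ) ^ r)) ^ 2 := by
            gcongr
            exact le_mul_of_one_le_left hQ0.le hd1
        _ = d ^ 2 * (M + ρ) ^ 2 * ((lam / κ) ^ r) ^ 2 * √lam ^ 2 := by rw [hQ]; ring
        _ = _ := by rw [hslam2]
    rw [rateConst]
    calc 2 * ((600 + 144 * τ ^ 2) * ((Q + d * (ρ * √lam * (lam / κ) ^ r)) ^ 2 / lam))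
        ≤ 2 * ((600 + 144 * τ ^ 2) * (d ^ 2 * (M + ρ) ^ 2 * (lam / κ) ^ (2 * r))) := by gcongr
      _ = _ := by rw [hd]; ring
  · refine abs_inner_source_le hlam hr (by positivity) hf hG ?_ (hpow g G hG hg)
    have h0 := hg 0 (Nat.zero_le _)
    simp only [pow_zero, FunLike.coe_one_eq_id, id_eq, one_mul] at h0
    linarith [inner_empCov_self_nonneg x g]

/-- The excess risk bound when `lam ≤ κ`, on the event that the noise and the empirical covariance
deviate little from their means in the energy norm. -/
theorem excess_le_of_lam_le (hκ : 0 < κ) (hT : ∀ h, ‖T h‖ ^ 2 ≤ κ * ‖h‖ ^ 2) (hr : 1 / 2 ≤ r)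
    (hρ : 0 ≤ ρ) (hf : IsSourceFunctional T κ r ρ f) (hτ : 3 / 2 ≤ τ) (hlam : 0 < lam)
    (hlamκ : lam ≤ κ) (hM : 0 < M)
    (hm : IsDiscrepancyStop H x y (τ * (M * √lam * (lam / κ) ^ r)) m)
    (hnoise : ∀ h : H, |inner ℝ (expansionMap H x y - empCov H x f) h|
      ≤ 3 / 8 * (M * (lam / κ) ^ r) * ‖toEnergy T lam h‖)
    (hcov : ∀ g h : H, |inner ℝ (T g) (T h) - inner ℝ (empCov H x g) h|
      ≤ 1 / 2 * (√κ * (lam / κ) ^ r) * ‖g‖ * ‖toEnergy T lam h‖) :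
    ‖T (expansionMap H x (cgCoeff H x y m) - f)‖ ^ 2
      ≤ rateConst r τ * (M + ρ) ^ 2 * (lam / κ) ^ (2 * r) := by
  have ht0 : 0 < lam / κ := by positivity
  have ht1 : lam / κ ≤ 1 := (div_le_one hκ).2 hlamκ
  have hη : 2 * (1 / 2 * (√κ * (lam / κ) ^ r)) ≤ √lam := by
    have h1 : (lam / κ) ^ r ≤ √(lam / κ) := by
      rw [Real.sqrt_eq_rpow]
      exact Real.rpow_le_rpow_of_exponent_ge ht0 ht1 hr
    calc 2 * (1 / 2 * (√κ * (lam / κ) ^ r)) = √κ * (lam / κ) ^ r := by ring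
      _ ≤ √κ * √(lam / κ) := by gcongr
      _ = √lam := by rw [← Real.sqrt_mul hκ.le, mul_div_cancel₀ _ hκ.ne']
  have hcmp := norm_toEnergy_sq_le_two_mul hlam.le hη hcov
  refine excess_le_of_transfer hκ hr hρ hf hτ hlam hM hm (fun h => ?_) (fun h => ?_)
    (fun g G hG hg => ?_)
  · refine le_trans ?_ (hcmp h)
    rw [norm_toEnergy_sq hlam.le]
    nlinarith [sq_nonneg ‖h‖]
  · have h1 := hcmp h
    calc (inner ℝ (expansionMap H x y - empCov H x f) h) ^ 2
        = |inner ℝ (expansionMap H x y - empCov H x f) h| ^ 2 := (sq_abs _).symm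
      _ ≤ (3 / 8 * (M * (lam / κ) ^ r) * ‖toEnergy T lam h‖) ^ 2 :=
        pow_le_pow_left₀ (abs_nonneg _) (hnoise h) 2
      _ = 9 / 64 * (M * (lam / κ) ^ r) ^ 2 * ‖toEnergy T lam h‖ ^ 2 := by ring
      _ ≤ 9 / 64 * (M * (lam / κ) ^ r) ^ 2
          * (2 * (inner ℝ (empCov H x h) h + lam * ‖h‖ ^ 2)) := by gcongr
      _ ≤ _ := by
        have h2 : 0 ≤ inner ℝ (empCov H x h) h + lam * ‖h‖ ^ 2 :=
          add_nonneg (inner_empCov_self_nonneg x h) (by positivity)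
        have h3 : 0 ≤ (M * (lam / κ) ^ r) ^ 2 * (inner ℝ (empCov H x h) h + lam * ‖h‖ ^ 2) := by
          positivity
        linarith
  · refine norm_pow_comp_adjoint_le hlam hκ.le hT (by positivity) hη (empCov_symm x) hcov
      (fun i hi => ?_) g hG hg
    have h1 : (lam / κ) ^ r ≤ (lam / κ) ^ (i + 1) := by
      rw [← Real.rpow_natCast]
      refine Real.rpow_le_rpow_of_exponent_ge ht0 ht1 ?_
      have h2 : ((i + 1 : ℕ) : ℝ) ≤ ⌊r⌋₊ := by exact_mod_cast hi
      exact h2.trans (Nat.floor_le (by linarith))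
    calc √κ * κ ^ i * (2 * (1 / 2 * (√κ * (lam / κ) ^ r)))
        = (√κ * √κ) * κ ^ i * (lam / κ) ^ r := by ring
      _ = κ ^ (i + 1) * (lam / κ) ^ r := by rw [Real.mul_self_sqrt hκ.le]; ring
      _ ≤ κ ^ (i + 1) * (lam / κ) ^ (i + 1) := by gcongr
      _ = lam ^ (i + 1) := by rw [← mul_pow, mul_div_cancel₀ _ hκ.ne']

/-- The excess risk bound when `κ ≤ lam`. Here the empirical covariance is negligible. -/
theorem excess_le_of_le_lam (hκ : 0 < κ) (hT : ∀ h, ‖T h‖ ^ 2 ≤ κ * ‖h‖ ^ 2) (hr : 1 / 2 ≤ r)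
    (hρ : 0 ≤ ρ) (hf : IsSourceFunctional T κ r ρ f) (hτ : 3 / 2 ≤ τ)
    (hlamκ : κ ≤ lam) (hM : 0 < M)
    (hm : IsDiscrepancyStop H x y (τ * (M * √lam * (lam / κ) ^ r)) m)
    (hnoise : ‖expansionMap H x y - empCov H x f‖ ≤ 3 / 4 * (M * √lam * (lam / κ) ^ r)) :
    ‖T (expansionMap H x (cgCoeff H x y m) - f)‖ ^ 2
      ≤ rateConst r τ * (M + ρ) ^ 2 * (lam / κ) ^ (2 * r) := by
  have hlam : 0 < lam := hκ.trans_le hlamκ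
  have hE : ∀ h : H, lam * ‖h‖ ^ 2 ≤ inner ℝ (empCov H x h) h + lam * ‖h‖ ^ 2 := fun h => by
    linarith [inner_empCov_self_nonneg x h]
  refine excess_le_of_transfer hκ hr hρ hf hτ hlam hM hm (fun h => ?_) (fun h => ?_)
    (fun g G hG hg => ?_)
  · have h1 : κ * ‖h‖ ^ 2 ≤ lam * ‖h‖ ^ 2 := by gcongr
    have h2 : 0 ≤ lam * ‖h‖ ^ 2 := by positivity
    linarith [hE h, hT h]
  · calc (inner ℝ (expansionMap H x y - empCov H x f) h) ^ 2
        = |inner ℝ (expansionMap H x y - empCov H x f) h| ^ 2 := (sq_abs _).symm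
      _ ≤ (3 / 4 * (M * √lam * (lam / κ) ^ r) * ‖h‖) ^ 2 := by
        refine pow_le_pow_left₀ (abs_nonneg _) ?_ 2
        refine (abs_real_inner_le_norm _ _).trans ?_
        gcongr
      _ = 9 / 16 * (M * (lam / κ) ^ r) ^ 2 * (√lam ^ 2 * ‖h‖ ^ 2) := by ring
      _ ≤ _ := by
        rw [Real.sq_sqrt hlam.le]
        gcongr
        exact hE h
  · have h0 := hg 0 (Nat.zero_le _)
    simp only [pow_zero, FunLike.coe_one_eq_id, id_eq, one_mul] at h0
    have h1 : √κ * ‖g‖ ≤ G := by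
      refine le_of_sq_le_sq ?_ hG
      rw [mul_pow, Real.sq_sqrt hκ.le]
      have h1 : κ * ‖g‖ ^ 2 ≤ lam * ‖g‖ ^ 2 := by gcongr
      linarith [hE g]
    refine (norm_pow_comp_adjoint_apply_le hκ.le hT _ g).trans ?_
    calc κ ^ ⌊r⌋₊ * (√κ * ‖g‖) ≤ lam ^ ⌊r⌋₊ * G := by gcongr
      _ ≤ (⌊r⌋₊ + 2) * (lam ^ ⌊r⌋₊ * G) := by
        refine le_mul_of_one_le_left (by positivity) ?_
        have : (0 : ℝ) ≤ ⌊r⌋₊ := Nat.cast_nonneg _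
        linarith
      _ = _ := by ring

end GoodEvent

/-! ### Deviation of the noise -/

section Noise

variable {𝒳 : Type*} [MeasurableSpace 𝒳] {P : Measure (𝒳 × ℝ)} [IsProbabilityMeasure P]
  {f f' : 𝒳 → ℝ} {M : ℝ}

theorem ae_fst_of_ae {p : 𝒳 → Prop} (h : ∀ᵐ x ∂P.fst, p x) : ∀ᵐ z ∂P, p z.1 :=
  ae_of_ae_map measurable_fst.aemeasurable h

theorem BernsteinNoise.congr (h : BernsteinNoise P f M) (hff : f =ᵐ[P.fst] f') :
    BernsteinNoise P f' M := by
  intro p hp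
  have h1 : (fun z : 𝒳 × ℝ => (z.2 - f z.1) ^ p) =ᵐ[P] fun z => (z.2 - f' z.1) ^ p := by
    filter_upwards [ae_fst_of_ae hff] with z hz
    rw [hz]
  exact ⟨(h p hp).1.congr h1, (condExp_congr_ae h1).symm.trans_le (h p hp).2⟩

theorem IsRegressionFunction.congr (h : IsRegressionFunction P f) (hff : f =ᵐ[P.fst] f') :
    IsRegressionFunction P f' := by
  have h1 : (fun z : 𝒳 × ℝ => z.2 - f z.1) =ᵐ[P] fun z => z.2 - f' z.1 := by
    filter_upwards [ae_fst_of_ae hff] with z hz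
    rw [hz]
  exact ⟨(memLp_congr_ae hff).1 h.1, h.2.1.congr h1, (condExp_congr_ae h1).symm.trans h.2.2⟩

theorem integral_comp_fst {g : 𝒳 → ℝ} (hg : Measurable g) :
    ∫ z, g z.1 ∂P = ∫ x, g x ∂P.fst :=
  (integral_map measurable_fst.aemeasurable hg.aestronglyMeasurable).symm

/-- The conditional expectation given the design point may be inserted under an integral against a
function of the design point. -/
theorem integral_mul_eq_integral_mul_condExp {g : 𝒳 → ℝ} (hg : Measurable g) {C : ℝ}
    (hgC : ∀ x, |g x| ≤ C) {e : 𝒳 × ℝ → ℝ} (he : Integrable e P) :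
    Integrable (fun z => g z.1 * e z) P ∧
      ∫ z, g z.1 * e z ∂P
        = ∫ z, g z.1 * (P[e | MeasurableSpace.comap Prod.fst inferInstance]) z ∂P := by
  have hm : MeasurableSpace.comap Prod.fst (inferInstance : MeasurableSpace 𝒳)
      ≤ (inferInstance : MeasurableSpace (𝒳 × ℝ)) := measurable_fst.comap_le
  have hint : Integrable (fun z => g z.1 * e z) P :=
    he.bdd_mul (c := C) (hg.comp measurable_fst).aestronglyMeasurable
      (.of_forall fun z => hgC z.1)
  refine ⟨hint, ?_⟩
  have hsm : StronglyMeasurable[MeasurableSpace.comap Prod.fst inferInstance]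
      (fun z : 𝒳 × ℝ => g z.1) :=
    (hg.comp (comap_measurable (Prod.fst : 𝒳 × ℝ → 𝒳))).stronglyMeasurable
  have h1 := condExp_mul_of_stronglyMeasurable_left (μ := P) hsm hint he
  rw [← integral_condExp hm]
  exact integral_congr_ae h1

theorem BernsteinNoise.integral_mul_le (h : BernsteinNoise P f M) {p : ℕ} (hp : 2 ≤ p) {g : 𝒳 → ℝ}
    (hg : Measurable g) (hg0 : ∀ x, 0 ≤ g x) {C : ℝ} (hgC : ∀ x, g x ≤ C) :
    Integrable (fun z => g z.1 * (z.2 - f z.1) ^ p) P ∧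
      ∫ z, g z.1 * (z.2 - f z.1) ^ p ∂P ≤ (1 / 2 * (p ! : ℝ) * M ^ p) * ∫ x, g x ∂P.fst := by
  have hgC' : ∀ x, |g x| ≤ C := fun x => by rw [abs_of_nonneg (hg0 x)]; exact hgC x
  obtain ⟨h1, h2⟩ := integral_mul_eq_integral_mul_condExp hg hgC' (h p hp).1
  refine ⟨h1, ?_⟩
  rw [h2, ← integral_comp_fst hg, ← integral_const_mul]
  have hgi : Integrable (fun z : 𝒳 × ℝ => g z.1) P :=
    Integrable.of_bound (hg.comp measurable_fst).aestronglyMeasurable C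
      (.of_forall fun z => hgC' z.1)
  refine integral_mono_ae ?_ (hgi.const_mul _) ?_
  · exact (integrable_condExp).bdd_mul (c := C) (hg.comp measurable_fst).aestronglyMeasurable
      (.of_forall fun z => hgC' z.1)
  · filter_upwards [(h p hp).2] with z hz
    rw [mul_comm _ (g z.1)]
    exact mul_le_mul_of_nonneg_left hz (hg0 z.1)

theorem IsRegressionFunction.integral_mul_eq_zero (h : IsRegressionFunction P f) {g : 𝒳 → ℝ}
    (hg : Measurable g) {C : ℝ} (hgC : ∀ x, |g x| ≤ C) :
    Integrable (fun z => g z.1 * (z.2 - f z.1)) P ∧ ∫ z, g z.1 * (z.2 - f z.1) ∂P = 0 := by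
  obtain ⟨h1, h2⟩ := integral_mul_eq_integral_mul_condExp hg hgC h.2.1
  refine ⟨h1, ?_⟩
  rw [h2, integral_eq_zero_of_ae]
  filter_upwards [h.2.2] with z hz
  rw [hz]
  simp

variable {V : Type*} [NormedAddCommGroup V] [InnerProductSpace ℝ V]

/-- Bernstein's inequality for the noise, weighted by a bounded vector-valued function of the
design point. -/
theorem measure_norm_sum_noise_ge_le (hf : IsRegressionFunction P f) (hε : BernsteinNoise P f M)
    (hfm : Measurable f) (hM : 0 < M) {Ψ : 𝒳 → V} (hΨ : StronglyMeasurable Ψ) {b N : ℝ} (hb : 0 < b)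
    (hN : 0 ≤ N) (hΨb : ∀ x, ‖Ψ x‖ ≤ b)
    (hΨN : ∫⁻ x, ENNReal.ofReal (‖Ψ x‖ ^ 2) ∂P.fst ≤ ENNReal.ofReal N)
    {n : ℕ} {Ω : Type*} [MeasurableSpace Ω] {μ : Measure Ω} [IsProbabilityMeasure μ]
    {W : Fin n → Ω → 𝒳 × ℝ} (hW : ∀ i, Measurable (W i)) (hindep : iIndepFun W μ)
    (hlaw : ∀ i, μ.map (W i) = P) (x : ℝ) :
    μ {ω | (2 * (M * b) + M * √N * √n) * x
        ≤ ‖∑ i, ((W i ω).2 - f (W i ω).1) • Ψ (W i ω).1‖}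
      ≤ ENNReal.ofReal (2 * Real.exp (4 / 3) * Real.exp (-x)) := by
  refine measure_norm_sum_ge_le (P := P) (Φ := fun z => (z.2 - f z.1) • Ψ z.1) ?_ (by positivity)
    (by positivity) (fun j => ?_) (fun v => ?_) hW hindep hlaw x
  · exact (measurable_snd.sub (hfm.comp measurable_fst)).stronglyMeasurable.smul
      (hΨ.comp_measurable measurable_fst)
  · have hnm : Measurable fun x => ‖Ψ x‖ := hΨ.norm.measurable
    obtain ⟨h1, h2⟩ := hε.integral_mul_le (p := 2 * (j + 1)) (by omega) (hnm.pow_const 2)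
      (fun x => sq_nonneg _) (C := b ^ 2)
      (fun x => pow_le_pow_left₀ (norm_nonneg _) (hΨb x) 2)
    have heven : ∀ e : ℝ, 0 ≤ e ^ (2 * (j + 1)) := fun e => by
      rw [pow_mul]
      positivity
    have hsq : ∫ x, ‖Ψ x‖ ^ 2 ∂P.fst ≤ N := by
      rw [integral_eq_lintegral_of_nonneg_ae (.of_forall fun x => sq_nonneg _)
        (hnm.pow_const 2).aestronglyMeasurable]
      exact ENNReal.toReal_le_of_le_ofReal hN hΨN
    calc ∫⁻ z, ENNReal.ofReal (‖(z.2 - f z.1) • Ψ z.1‖ ^ (2 * (j + 1))) ∂P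
        ≤ ∫⁻ z, ENNReal.ofReal (b ^ (2 * j))
          * ENNReal.ofReal (‖Ψ z.1‖ ^ 2 * (z.2 - f z.1) ^ (2 * (j + 1))) ∂P := by
          refine lintegral_mono fun z => ?_
          rw [← ENNReal.ofReal_mul (by positivity)]
          refine ENNReal.ofReal_le_ofReal ?_
          have h3 : ‖Ψ z.1‖ ^ (2 * (j + 1)) ≤ b ^ (2 * j) * ‖Ψ z.1‖ ^ 2 := by
            calc ‖Ψ z.1‖ ^ (2 * (j + 1)) = ‖Ψ z.1‖ ^ (2 * j) * ‖Ψ z.1‖ ^ 2 := by ring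
              _ ≤ _ := by gcongr; exact hΨb z.1
          have h4 : ‖z.2 - f z.1‖ ^ (2 * (j + 1)) = (z.2 - f z.1) ^ (2 * (j + 1)) := by
            rw [Real.norm_eq_abs, pow_mul, sq_abs, ← pow_mul]
          rw [norm_smul, mul_pow, h4]
          calc (z.2 - f z.1) ^ (2 * (j + 1)) * ‖Ψ z.1‖ ^ (2 * (j + 1))
              ≤ (z.2 - f z.1) ^ (2 * (j + 1)) * (b ^ (2 * j) * ‖Ψ z.1‖ ^ 2) :=
                mul_le_mul_of_nonneg_left h3 (heven _)
            _ = _ := by ring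
      _ = ENNReal.ofReal (b ^ (2 * j))
          * ENNReal.ofReal (∫ z, ‖Ψ z.1‖ ^ 2 * (z.2 - f z.1) ^ (2 * (j + 1)) ∂P) := by
          rw [lintegral_const_mul' _ _ ENNReal.ofReal_ne_top, ofReal_integral_eq_lintegral_ofReal h1
            (.of_forall fun z => mul_nonneg (sq_nonneg _) (heven _))]
      _ ≤ ENNReal.ofReal (1 / 2 * ((2 * (j + 1))! : ℝ) * (M * √N) ^ 2 * (M * b) ^ (2 * j)) := by
          rw [← ENNReal.ofReal_mul (by positivity)]
          refine ENNReal.ofReal_le_ofReal ?_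
          calc b ^ (2 * j) * ∫ z, ‖Ψ z.1‖ ^ 2 * (z.2 - f z.1) ^ (2 * (j + 1)) ∂P
              ≤ b ^ (2 * j) * ((1 / 2 * ((2 * (j + 1))! : ℝ) * M ^ (2 * (j + 1))) * N) := by
                gcongr
                exact h2.trans (by gcongr)
            _ = _ := by
                rw [mul_pow M (√N), Real.sq_sqrt hN]
                ring
  · have hm : Measurable fun x => inner ℝ v (Ψ x) :=
      ((innerSL ℝ v).continuous.comp_stronglyMeasurable hΨ).measurable
    have h1 := hf.integral_mul_eq_zero hm (C := ‖v‖ * b) fun x =>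
      (abs_real_inner_le_norm _ _).trans (by gcongr; exact hΨb x)
    simp only [inner_smul_right]
    simpa only [mul_comm] using h1

end Noise

/-! ### Deviation of the empirical covariance -/

section Bounded

variable {𝒳 : Type*} [MeasurableSpace 𝒳] {ν : Measure 𝒳} [IsProbabilityMeasure ν]
variable {V : Type*} [NormedAddCommGroup V] [InnerProductSpace ℝ V] [CompleteSpace V]

/-- Centring decreases the second moment. -/
theorem integral_norm_sub_integral_sq_le {Φ : 𝒳 → V} (hΦ : StronglyMeasurable Φ) {b : ℝ}
    (hΦb : ∀ x, ‖Φ x‖ ≤ b) :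
    ∫ x, ‖Φ x - ∫ y, Φ y ∂ν‖ ^ 2 ∂ν ≤ ∫ x, ‖Φ x‖ ^ 2 ∂ν := by
  have hi : Integrable Φ ν := Integrable.of_bound hΦ.aestronglyMeasurable b (.of_forall hΦb)
  set c := ∫ y, Φ y ∂ν with hc
  have h2 : Integrable (fun x => ‖Φ x‖ ^ 2) ν :=
    Integrable.of_bound (hΦ.norm.pow 2).aestronglyMeasurable (b ^ 2) (.of_forall fun x => by
      rw [norm_pow, norm_norm]
      exact pow_le_pow_left₀ (norm_nonneg _) (hΦb x) 2)
  have h3 : Integrable (fun x => 2 * inner ℝ c (Φ x)) ν := (hi.const_inner c).const_mul 2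
  have h4 : ∀ x, ‖Φ x - c‖ ^ 2 = ‖Φ x‖ ^ 2 - 2 * inner ℝ c (Φ x) + ‖c‖ ^ 2 := fun x => by
    rw [norm_sub_sq_real, real_inner_comm]
  simp_rw [h4]
  have h5 : Integrable (fun x => ‖Φ x‖ ^ 2 - 2 * inner ℝ c (Φ x)) ν := h2.sub h3
  rw [integral_add h5 (integrable_const _), integral_sub h2 h3, integral_const_mul,
    integral_inner hi, ← hc, real_inner_self_eq_norm_sq]
  simp only [integral_const, probReal_univ, one_smul]
  linarith [sq_nonneg ‖c‖]

/-- Bernstein's inequality for a bounded random vector. -/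
theorem measure_norm_sum_sub_integral_ge_le {Φ : 𝒳 → V} (hΦ : StronglyMeasurable Φ) {b N : ℝ}
    (hb : 0 < b) (hN : 0 ≤ N) (hΦb : ∀ x, ‖Φ x‖ ≤ b)
    (hΦN : ∫⁻ x, ENNReal.ofReal (‖Φ x‖ ^ 2) ∂ν ≤ ENNReal.ofReal N)
    {n : ℕ} {Ω : Type*} [MeasurableSpace Ω] {μ : Measure Ω} [IsProbabilityMeasure μ]
    {W : Fin n → Ω → 𝒳} (hW : ∀ i, Measurable (W i)) (hindep : iIndepFun W μ)
    (hlaw : ∀ i, μ.map (W i) = ν) (x : ℝ) :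
    μ {ω | (2 * (2 * b) + √N * √n) * x ≤ ‖∑ i, (Φ (W i ω) - ∫ y, Φ y ∂ν)‖}
      ≤ ENNReal.ofReal (2 * Real.exp (4 / 3) * Real.exp (-x)) := by
  have hi : Integrable Φ ν := Integrable.of_bound hΦ.aestronglyMeasurable b (.of_forall hΦb)
  set c := ∫ y, Φ y ∂ν with hc
  have hcb : ‖c‖ ≤ b := by
    have h1 := norm_integral_le_of_norm_le_const (μ := ν) (f := Φ) (C := b) (.of_forall hΦb)
    simpa using h1
  have hΨ : StronglyMeasurable fun x => Φ x - c := hΦ.sub stronglyMeasurable_const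
  have hΨb : ∀ x, ‖Φ x - c‖ ≤ 2 * b := fun x => (norm_sub_le _ _).trans (by linarith [hΦb x])
  refine measure_norm_sum_ge_le (P := ν) (Φ := fun z => Φ z - c) hΨ (Real.sqrt_nonneg N)
    (by positivity) (fun j => ?_) (fun v => ?_) hW hindep hlaw x
  · have h2 : Integrable (fun x => ‖Φ x - c‖ ^ 2) ν :=
      Integrable.of_bound (hΨ.norm.pow 2).aestronglyMeasurable ((2 * b) ^ 2)
        (.of_forall fun x => by
          rw [norm_pow, norm_norm]
          exact pow_le_pow_left₀ (norm_nonneg _) (hΨb x) 2)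
    have hsq : ∫ x, ‖Φ x‖ ^ 2 ∂ν ≤ N := by
      rw [integral_eq_lintegral_of_nonneg_ae (.of_forall fun x => sq_nonneg _)
        (hΦ.norm.pow 2).aestronglyMeasurable]
      exact ENNReal.toReal_le_of_le_ofReal hN hΦN
    calc ∫⁻ z, ENNReal.ofReal (‖Φ z - c‖ ^ (2 * (j + 1))) ∂ν
        ≤ ∫⁻ z, ENNReal.ofReal ((2 * b) ^ (2 * j)) * ENNReal.ofReal (‖Φ z - c‖ ^ 2) ∂ν := by
          refine lintegral_mono fun z => ?_
          rw [← ENNReal.ofReal_mul (by positivity)]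
          refine ENNReal.ofReal_le_ofReal ?_
          calc ‖Φ z - c‖ ^ (2 * (j + 1)) = ‖Φ z - c‖ ^ (2 * j) * ‖Φ z - c‖ ^ 2 := by ring
            _ ≤ _ := by gcongr; exact hΨb z
      _ = ENNReal.ofReal ((2 * b) ^ (2 * j)) * ENNReal.ofReal (∫ z, ‖Φ z - c‖ ^ 2 ∂ν) := by
          rw [lintegral_const_mul' _ _ ENNReal.ofReal_ne_top, ofReal_integral_eq_lintegral_ofReal h2
            (.of_forall fun z => sq_nonneg _)]
      _ ≤ ENNReal.ofReal (1 / 2 * ((2 * (j + 1))! : ℝ) * √N ^ 2 * (2 * b) ^ (2 * j)) := by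
          rw [← ENNReal.ofReal_mul (by positivity)]
          refine ENNReal.ofReal_le_ofReal ?_
          have hfac : (2 : ℝ) ≤ ((2 * (j + 1))! : ℝ) := by
            have : (2)! ≤ (2 * (j + 1))! := Nat.factorial_le (by omega)
            exact_mod_cast this
          rw [Real.sq_sqrt hN]
          calc (2 * b) ^ (2 * j) * ∫ z, ‖Φ z - c‖ ^ 2 ∂ν ≤ (2 * b) ^ (2 * j) * (1 * N) := by
                gcongr
                rw [one_mul]
                exact (integral_norm_sub_integral_sq_le hΦ hΦb).trans hsq
            _ ≤ (2 * b) ^ (2 * j) * ((1 / 2 * ((2 * (j + 1))! : ℝ)) * N) := by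
                gcongr
                linarith
            _ = _ := by ring
  · have h3 : Integrable (fun z => Φ z - c) ν := hi.sub (integrable_const _)
    refine ⟨h3.const_inner v, ?_⟩
    rw [integral_inner h3, integral_sub hi (integrable_const _), ← hc]
    simp

end Bounded

/-! ### The deviation events for the kernel sample -/

section Events

open scoped TensorProduct

variable {𝒳 : Type*} [MeasurableSpace 𝒳] {H : Type*} [NormedAddCommGroup H]
  [InnerProductSpace ℝ H] [RKHS ℝ H 𝒳 ℝ] [CompleteSpace H] [TopologicalSpace.SeparableSpace H]
  {n : ℕ} {κ lam : ℝ}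

theorem norm_feature_le (hκ : ∀ x : 𝒳, kern H x x ≤ κ) (x : 𝒳) : ‖feature H x‖ ≤ √κ := by
  refine Real.le_sqrt_of_sq_le ?_
  rw [norm_feature_sq]
  exact hκ x

section Whitened

variable {E : Type*} [NormedAddCommGroup E] [InnerProductSpace ℝ E] [CompleteSpace E]
  {T : H →L[ℝ] E}

theorem norm_toEnergy_resolvent_feature_le (hκ : ∀ x : 𝒳, kern H x x ≤ κ) (hlam : 0 < lam)
    (x : 𝒳) : ‖toEnergy T lam (resolvent T lam (feature H x))‖ ≤ √(κ / lam) := by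
  refine Real.le_sqrt_of_sq_le ((norm_toEnergy_resolvent_sq_le hlam _).trans ?_)
  rw [norm_feature_sq]
  have := hκ x
  gcongr

theorem stronglyMeasurable_toEnergy_resolvent_feature
    (hmeas : Measurable (Function.uncurry (kern H (𝒳 := 𝒳)))) :
    StronglyMeasurable fun x : 𝒳 => toEnergy T lam (resolvent T lam (feature H x)) :=
  ((toEnergy T lam) ∘L (resolvent T lam)).continuous.comp_stronglyMeasurable
    (stronglyMeasurable_feature hmeas)

theorem expansionMap_sub_empCov (x : Fin n → 𝒳) (y : Fin n → ℝ) (f : H) :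
    expansionMap H x y - empCov H x f = (1 / n : ℝ) • ∑ i, (y i - f (x i)) • feature H (x i) := by
  rw [empCov_eq_expansionMap, ← map_sub, expansionMap_apply]
  rfl

/-- A bound for the sum of the noise variables, weighted by `(T* T + lam)⁻¹ k(X, ·)` in the energy
space, bounds the pairing of the empirical noise with `h` by the energy norm of `h`. -/
theorem abs_inner_noise_le (hn : 0 < n) (hlam : 0 < lam) (x : Fin n → 𝒳) (y : Fin n → ℝ) (f : H)
    {a : ℝ}
    (ha : ‖∑ i, (y i - f (x i)) • toEnergy T lam (resolvent T lam (feature H (x i)))‖ ≤ n * a)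
    (h : H) :
    |inner ℝ (expansionMap H x y - empCov H x f) h| ≤ a * ‖toEnergy T lam h‖ := by
  have hn0 : (0 : ℝ) < n := Nat.cast_pos.2 hn
  have h1 : inner ℝ (expansionMap H x y - empCov H x f) h
      = (1 / n) * inner ℝ
        (∑ i, (y i - f (x i)) • toEnergy T lam (resolvent T lam (feature H (x i))))
        (toEnergy T lam h) := by
    rw [expansionMap_sub_empCov, inner_smul_left, sum_inner, sum_inner]
    simp only [inner_smul_left, inner_toEnergy_resolvent hlam, conj_trivial]
  rw [h1, abs_mul, abs_of_pos (by positivity : (0 : ℝ) < 1 / n), one_div_mul_eq_div,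
    div_le_iff₀ hn0]
  calc |inner ℝ (∑ i, (y i - f (x i)) • toEnergy T lam (resolvent T lam (feature H (x i))))
        (toEnergy T lam h)| ≤ _ := abs_real_inner_le_norm _ _
    _ ≤ n * a * ‖toEnergy T lam h‖ := by gcongr
    _ = _ := by ring

/-- The random rank one operator `k(x, ·) ⊗ (T* T + lam)⁻¹ k(x, ·)`, as an element of a Hilbert
space; the tensor product is completed so that expectations can be taken. -/
noncomputable def rankOneFeature (T : H →L[ℝ] E) (lam : ℝ) (x : 𝒳) :
    UniformSpace.Completion (H ⊗[ℝ] EnergySpace T lam) :=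
  ((feature H x ⊗ₜ[ℝ] toEnergy T lam (resolvent T lam (feature H x)) : H ⊗[ℝ] EnergySpace T lam) :
    UniformSpace.Completion (H ⊗[ℝ] EnergySpace T lam))

theorem norm_rankOneFeature (x : 𝒳) :
    ‖rankOneFeature T lam x‖
      = ‖feature H x‖ * ‖toEnergy T lam (resolvent T lam (feature H x))‖ := by
  rw [rankOneFeature, UniformSpace.Completion.norm_coe, TensorProduct.norm_tmul]

theorem inner_rankOneFeature (hlam : 0 < lam) (x : 𝒳) (g h : H) :
    inner ℝ (((g ⊗ₜ[ℝ] toEnergy T lam h : H ⊗[ℝ] EnergySpace T lam) :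
      UniformSpace.Completion (H ⊗[ℝ] EnergySpace T lam))) (rankOneFeature T lam x)
      = g x * h x := by
  refine (UniformSpace.Completion.inner_coe _ _).trans ?_
  rw [TensorProduct.inner_tmul, real_inner_comm, inner_feature]
  congr 1
  rw [real_inner_comm]
  exact (inner_toEnergy_resolvent hlam _ _).trans (inner_feature x h)

theorem stronglyMeasurable_rankOneFeature
    (hmeas : Measurable (Function.uncurry (kern H (𝒳 := 𝒳)))) :
    StronglyMeasurable (rankOneFeature T lam : 𝒳 → _) := by
  have h1 : Continuous fun z : H × EnergySpace T lam =>
      ((z.1 ⊗ₜ[ℝ] z.2 : H ⊗[ℝ] EnergySpace T lam) :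
        UniformSpace.Completion (H ⊗[ℝ] EnergySpace T lam)) :=
    (UniformSpace.Completion.continuous_coe _).comp TensorProduct.continuous_tmul
  have h2 : StronglyMeasurable fun x : 𝒳 =>
      (feature H x, toEnergy T lam (resolvent T lam (feature H x))) :=
    (stronglyMeasurable_feature hmeas).prodMk
      (stronglyMeasurable_toEnergy_resolvent_feature hmeas)
  have h3 := h1.comp_stronglyMeasurable h2
  exact h3

theorem norm_rankOneFeature_le (hκ0 : 0 ≤ κ) (hκ : ∀ x : 𝒳, kern H x x ≤ κ) (hlam : 0 < lam)
    (x : 𝒳) : ‖rankOneFeature T lam x‖ ≤ κ / √lam := by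
  rw [norm_rankOneFeature]
  calc _ ≤ √κ * √(κ / lam) := by
        gcongr
        · exact norm_feature_le hκ x
        · exact norm_toEnergy_resolvent_feature_le hκ hlam x
    _ = κ / √lam := by
        rw [Real.sqrt_div hκ0, ← mul_div_assoc, Real.mul_self_sqrt hκ0]

end Whitened

variable {ν : Measure 𝒳} [IsProbabilityMeasure ν] {T : H →L[ℝ] Lp ℝ 2 ν}

theorem lintegral_norm_sq_rankOneFeature_le
    (hmeas : Measurable (Function.uncurry (kern H (𝒳 := 𝒳)))) (hκ0 : 0 ≤ κ)
    (hκ : ∀ x : 𝒳, kern H x x ≤ κ) (hT : ∀ h, T h =ᵐ[ν] h) (hlam : 0 < lam) {N : ℝ}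
    (hN : effDim (kernelOp ν (kern H)) lam ≤ ENNReal.ofReal N) :
    ∫⁻ x, ENNReal.ofReal (‖rankOneFeature T lam x‖ ^ 2) ∂ν ≤ ENNReal.ofReal (κ * N) := by
  calc ∫⁻ x, ENNReal.ofReal (‖rankOneFeature T lam x‖ ^ 2) ∂ν
      ≤ ∫⁻ x, ENNReal.ofReal κ
        * ENNReal.ofReal (‖toEnergy T lam (resolvent T lam (feature H x))‖ ^ 2) ∂ν := by
        refine lintegral_mono fun x => ?_
        rw [← ENNReal.ofReal_mul hκ0, norm_rankOneFeature, mul_pow, norm_feature_sq]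
        refine ENNReal.ofReal_le_ofReal ?_
        have := hκ x
        gcongr
    _ ≤ ENNReal.ofReal κ * ENNReal.ofReal N := by
        rw [lintegral_const_mul' _ _ ENNReal.ofReal_ne_top]
        gcongr
        exact (lintegral_norm_sq_toEnergy_resolvent_le hmeas hκ hT hlam).trans hN
    _ = _ := (ENNReal.ofReal_mul hκ0).symm

/-- A bound for the centred sum of the rank one operators bounds the difference of the population
and the empirical covariance, as a bilinear form, by the norm and the energy norm. -/
theorem abs_inner_sub_empCov_le (hmeas : Measurable (Function.uncurry (kern H (𝒳 := 𝒳))))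
    (hκ0 : 0 ≤ κ) (hκ : ∀ x : 𝒳, kern H x x ≤ κ) (hT : ∀ h, T h =ᵐ[ν] h) (hlam : 0 < lam)
    (hn : 0 < n) (x : Fin n → 𝒳) {a : ℝ}
    (ha : ‖∑ i, (rankOneFeature T lam (x i) - ∫ y, rankOneFeature T lam y ∂ν)‖ ≤ n * a)
    (g h : H) :
    |inner ℝ (T g) (T h) - inner ℝ (empCov H x g) h| ≤ a * ‖g‖ * ‖toEnergy T lam h‖ := by
  have hn0 : (0 : ℝ) < n := Nat.cast_pos.2 hn
  set z : UniformSpace.Completion (H ⊗[ℝ] EnergySpace T lam) :=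
    ((g ⊗ₜ[ℝ] toEnergy T lam h : H ⊗[ℝ] EnergySpace T lam) :
      UniformSpace.Completion (H ⊗[ℝ] EnergySpace T lam)) with hz
  have hi : Integrable (fun y => rankOneFeature T lam y) ν :=
    Integrable.of_bound (stronglyMeasurable_rankOneFeature hmeas).aestronglyMeasurable (κ / √lam)
      (.of_forall (norm_rankOneFeature_le hκ0 hκ hlam))
  have h1 : inner ℝ z (∑ i, (rankOneFeature T lam (x i) - ∫ y, rankOneFeature T lam y ∂ν))
      = n * (inner ℝ (empCov H x g) h - inner ℝ (T g) (T h)) := by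
    rw [inner_sum]
    simp only [inner_sub_right, hz]
    rw [← integral_inner hi]
    simp only [inner_rankOneFeature hlam]
    rw [← inner_inclusion hT, Finset.sum_sub_distrib, inner_empCov]
    simp only [Finset.sum_const, Finset.card_univ, Fintype.card_fin, nsmul_eq_mul]
    field_simp
  have h2 : ‖z‖ = ‖g‖ * ‖toEnergy T lam h‖ := by
    rw [hz, UniformSpace.Completion.norm_coe, TensorProduct.norm_tmul]
  have h3 := abs_real_inner_le_norm z
    (∑ i, (rankOneFeature T lam (x i) - ∫ y, rankOneFeature T lam y ∂ν))
  rw [h1, abs_mul, abs_of_pos hn0, h2, abs_sub_comm] at h3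
  refine le_of_mul_le_mul_left (h3.trans ?_) hn0
  calc ‖g‖ * ‖toEnergy T lam h‖ * _ ≤ ‖g‖ * ‖toEnergy T lam h‖ * (n * a) := by gcongr
    _ = _ := by ring

end Events

/-! ### The rate and the probabilities of the deviation events -/

section Rates

variable {r s D L t : ℝ} {n : ℕ}

theorem one_le_log_six_div {γ : ℝ} (hγ0 : 0 < γ) (hγ1 : γ < 1) : 1 ≤ Real.log (6 / γ) := by
  rw [Real.le_log_iff_exp_le (by positivity)]
  have h1 := Real.exp_one_lt_d9
  have h2 : 6 ≤ 6 / γ := by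
    rw [le_div_iff₀ hγ0]
    linarith
  linarith

/-- The failure probability in Bernstein's inequality at `x = log (6 / γ)`. -/
theorem two_mul_exp_mul_exp_neg_log_le {γ : ℝ} (hγ0 : 0 < γ) :
    2 * Real.exp (4 / 3) * Real.exp (-Real.log (6 / γ)) ≤ 3 / 2 * γ := by
  rw [Real.exp_neg, Real.exp_log (by positivity), inv_div]
  have h1 : Real.exp (4 / 3) ≤ 9 / 2 := by
    refine le_of_pow_le_pow_left₀ (n := 3) three_ne_zero (by norm_num) ?_
    rw [← Real.exp_nat_mul]
    have h2 : ((3 : ℕ) : ℝ) * (4 / 3) = ((4 : ℕ) : ℝ) * 1 := by norm_num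
    rw [h2, Real.exp_nat_mul]
    calc Real.exp 1 ^ 4 ≤ (3 : ℝ) ^ 4 := by
          gcongr
          exact Real.exp_one_lt_three.le
      _ ≤ _ := by norm_num
  calc 2 * Real.exp (4 / 3) * (γ / 6) ≤ 2 * (9 / 2) * (γ / 6) := by gcongr
    _ = 3 / 2 * γ := by ring

/-- The two terms in Bernstein's inequality, at the level `lam = κ t` with
`t^(r + s / 2) = 4 D L / √n`: the variance term is `n t^r / 4`, and the other one is smaller. -/
theorem bernstein_terms (hr : 1 / 2 ≤ r) (hs : 0 ≤ s) (hD : 1 ≤ D) (hL : 1 ≤ L) (hn : 0 < n)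
    (ht0 : 0 < t) (ht1 : t ≤ 1) (ht : t ^ (r + s / 2) = 4 * D / √n * L) :
    √(D ^ 2 * t ^ (-s)) * √n * L = n * (1 / 4 * t ^ r) ∧
      2 * (1 / √t) * L ≤ n * (1 / 8 * t ^ r) := by
  have hn0 : (0 : ℝ) < n := Nat.cast_pos.2 hn
  have hsn : 0 < √(n : ℝ) := Real.sqrt_pos.2 hn0
  have hsn2 : √(n : ℝ) ^ 2 = n := Real.sq_sqrt hn0.le
  generalize √(n : ℝ) = w at *
  have hst : 0 < √t := Real.sqrt_pos.2 ht0
  have hts : √(D ^ 2 * t ^ (-s)) = D * t ^ (-(s / 2)) := by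
    rw [Real.sqrt_mul (sq_nonneg D), Real.sqrt_sq (by linarith), Real.sqrt_eq_rpow,
      ← Real.rpow_mul ht0.le]
    congr 2
    ring
  have hDL : D * L * w = n * (t ^ (r + s / 2) / 4) := by
    rw [ht, ← hsn2]
    field_simp
  constructor
  · rw [hts]
    calc D * t ^ (-(s / 2)) * w * L = t ^ (-(s / 2)) * (D * L * w) := by ring
      _ = n * (1 / 4 * (t ^ (-(s / 2)) * t ^ (r + s / 2))) := by rw [hDL]; ring
      _ = n * (1 / 4 * t ^ r) := by
        rw [← Real.rpow_add ht0]
        congr 3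
        ring
  · have h1 : n * t ^ (2 * r + s) = 16 * D ^ 2 * L ^ 2 := by
      have h2 : t ^ (2 * r + s) = (t ^ (r + s / 2)) ^ 2 := by
        rw [← Real.rpow_natCast, ← Real.rpow_mul ht0.le]
        congr 1
        push_cast
        ring
      rw [h2, ht, ← hsn2]
      field_simp
      ring
    have h3 : t ^ (2 * r + s) ≤ t ^ r * √t := by
      rw [Real.sqrt_eq_rpow, ← Real.rpow_add ht0]
      exact Real.rpow_le_rpow_of_exponent_ge ht0 ht1 (by linarith)
    have h4 : 16 * L ≤ 16 * D ^ 2 * L ^ 2 := by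
      have h5 : 1 ≤ D ^ 2 := one_le_pow₀ hD
      nlinarith
    have h6 : 16 * L ≤ n * (t ^ r * √t) := by
      rw [← h1] at h4
      exact h4.trans (by gcongr)
    have h7 : 2 * (1 / √t) * L = 2 * L / √t := by ring
    rw [h7, div_le_iff₀ hst]
    linarith

end Rates

section Probability

variable {𝒳 : Type*} [MeasurableSpace 𝒳] {H : Type*} [NormedAddCommGroup H]
  [InnerProductSpace ℝ H] [RKHS ℝ H 𝒳 ℝ] [CompleteSpace H] [TopologicalSpace.SeparableSpace H]
  {P : Measure (𝒳 × ℝ)} [IsProbabilityMeasure P] {T : H →L[ℝ] Lp ℝ 2 P.fst} {f : H}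
  {κ lam M r s D γ : ℝ} {n : ℕ}
  {Ω : Type*} [MeasurableSpace Ω] {μ : Measure Ω} [IsProbabilityMeasure μ]
  {X : Fin n → Ω → 𝒳} {Y : Fin n → Ω → ℝ}

/-- For `lam ≤ κ`: with high probability the noise and the empirical covariance deviate little
from their means, in the energy norm. -/
theorem measure_not_good_of_lam_le
    (hmeas : Measurable (Function.uncurry (kern H (𝒳 := 𝒳)))) (hκ0 : 0 < κ)
    (hκ : ∀ x : 𝒳, kern H x x ≤ κ) (hT : ∀ h, T h =ᵐ[P.fst] h)
    (hf : IsRegressionFunction P f) (hM : 0 < M) (hε : BernsteinNoise P f M)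
    (hr : 1 / 2 ≤ r) (hs : 0 ≤ s) (hD : 1 ≤ D) (hdim : IntrinsicDim P.fst (kern H) κ s D)
    (hγ0 : 0 < γ) (hγ1 : γ < 1) (hn : 0 < n) (hlam : 0 < lam) (hlamκ : lam ≤ κ)
    (hrate : (lam / κ) ^ (r + s / 2) = 4 * D / √n * Real.log (6 / γ))
    (hX : ∀ i, Measurable (X i)) (hY : ∀ i, Measurable (Y i))
    (hindep : iIndepFun (fun i ω => (X i ω, Y i ω)) μ)
    (hlaw : ∀ i, μ.map (fun ω => (X i ω, Y i ω)) = P) :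
    μ {ω | ¬ ((∀ h : H,
        |inner ℝ (expansionMap H (fun i => X i ω) (fun i => Y i ω)
            - empCov H (fun i => X i ω) f) h|
          ≤ 3 / 8 * (M * (lam / κ) ^ r) * ‖toEnergy T lam h‖) ∧
        ∀ g h : H, |inner ℝ (T g) (T h) - inner ℝ (empCov H (fun i => X i ω) g) h|
          ≤ 1 / 2 * (√κ * (lam / κ) ^ r) * ‖g‖ * ‖toEnergy T lam h‖)}
      ≤ ENNReal.ofReal (3 * γ) := by
  set L := Real.log (6 / γ) with hL
  have hL1 : 1 ≤ L := one_le_log_six_div hγ0 hγ1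
  have ht0 : 0 < lam / κ := by positivity
  set t := lam / κ with ht
  have ht1 : t ≤ 1 := (div_le_one hκ0).2 hlamκ
  obtain ⟨hvar, hlin⟩ := bernstein_terms hr hs hD hL1 hn ht0 ht1 hrate
  set N := D ^ 2 * t ^ (-s) with hN
  have hN0 : 0 ≤ N := by positivity
  have hdimN : effDim (kernelOp P.fst (kern H)) lam ≤ ENNReal.ofReal N := by
    have h1 := hdim lam hlam hlamκ
    rwa [← div_eq_inv_mul] at h1
  have hn0 : (0 : ℝ) < n := Nat.cast_pos.2 hn
  have hpair : ∀ i, Measurable fun ω => (X i ω, Y i ω) := fun i => (hX i).prodMk (hY i)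
  have hinv : √(κ / lam) = 1 / √t := by
    rw [one_div, ← Real.sqrt_inv, ht, inv_div]
  have ha := measure_norm_sum_noise_ge_le hf hε (measurable_coe hmeas f) hM
    (stronglyMeasurable_toEnergy_resolvent_feature (T := T) (lam := lam) hmeas)
    (b := √(κ / lam)) (N := N) (Real.sqrt_pos.2 (by positivity)) hN0
    (norm_toEnergy_resolvent_feature_le hκ hlam)
    ((lintegral_norm_sq_toEnergy_resolvent_le hmeas hκ hT hlam).trans hdimN)
    hpair hindep hlaw L
  have hlawX : ∀ i, μ.map (X i) = P.fst := by
    intro i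
    rw [Measure.fst, ← hlaw i, Measure.map_map measurable_fst (hpair i)]
    rfl
  have hindepX : iIndepFun X μ :=
    hindep.comp (fun _ => Prod.fst) (fun _ => measurable_fst)
  have hb := measure_norm_sum_sub_integral_ge_le (ν := P.fst)
    (stronglyMeasurable_rankOneFeature (T := T) (lam := lam) hmeas) (b := κ / √lam) (N := κ * N)
    (by positivity) (by positivity) (norm_rankOneFeature_le hκ0.le hκ hlam)
    (lintegral_norm_sq_rankOneFeature_le hmeas hκ0.le hκ hT hlam hdimN) hX hindepX hlawX L
  have hdevA : (2 * (M * √(κ / lam)) + M * √N * √n) * L ≤ n * (3 / 8 * (M * t ^ r)) := by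
    rw [hinv]
    calc (2 * (M * (1 / √t)) + M * √N * √n) * L
        = M * (2 * (1 / √t) * L) + M * (√N * √n * L) := by ring
      _ ≤ M * (n * (1 / 8 * t ^ r)) + M * (n * (1 / 4 * t ^ r)) := by
        rw [hvar]
        gcongr
      _ = _ := by ring
  have hdevB : (2 * (2 * (κ / √lam)) + √(κ * N) * √n) * L ≤ n * (1 / 2 * (√κ * t ^ r)) := by
    have h1 : κ / √lam = √κ * (1 / √t) := by
      rw [← hinv, Real.sqrt_div hκ0.le, ← mul_div_assoc, Real.mul_self_sqrt hκ0.le]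
    rw [h1, Real.sqrt_mul hκ0.le]
    calc (2 * (2 * (√κ * (1 / √t))) + √κ * √N * √n) * L
        = 2 * √κ * (2 * (1 / √t) * L) + √κ * (√N * √n * L) := by ring
      _ ≤ 2 * √κ * (n * (1 / 8 * t ^ r)) + √κ * (n * (1 / 4 * t ^ r)) := by
        rw [hvar]
        gcongr
      _ = _ := by ring
  have hprob : ENNReal.ofReal (2 * Real.exp (4 / 3) * Real.exp (-L))
      ≤ ENNReal.ofReal (3 / 2 * γ) :=
    ENNReal.ofReal_le_ofReal (two_mul_exp_mul_exp_neg_log_le hγ0)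
  refine le_trans (measure_mono ?_) ((measure_union_le _ _).trans
    ((add_le_add (ha.trans hprob) (hb.trans hprob)).trans ?_))
  · intro ω hω
    by_contra hc
    rw [Set.mem_union, not_or] at hc
    obtain ⟨h1, h2⟩ := hc
    rw [Set.mem_ofPred_eq, not_le] at h1 h2
    refine hω ⟨abs_inner_noise_le hn hlam _ _ f (h1.le.trans hdevA), ?_⟩
    exact abs_inner_sub_empCov_le hmeas hκ0.le hκ hT hlam hn _ (h2.le.trans hdevB)
  · rw [← ENNReal.ofReal_add (by positivity) (by positivity)]
    refine le_of_eq (congrArg ENNReal.ofReal ?_)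
    ring

/-- For large `lam` a bound for the norm of the noise suffices. -/
theorem measure_not_good_of_one_le
    (hmeas : Measurable (Function.uncurry (kern H (𝒳 := 𝒳)))) (hκ0 : 0 < κ)
    (hκ : ∀ x : 𝒳, kern H x x ≤ κ)
    (hf : IsRegressionFunction P f) (hM : 0 < M) (hε : BernsteinNoise P f M) (hD : 1 ≤ D)
    (hγ0 : 0 < γ) (hγ1 : γ < 1) (hn : 0 < n)
    (hX : ∀ i, Measurable (X i)) (hY : ∀ i, Measurable (Y i))
    (hindep : iIndepFun (fun i ω => (X i ω, Y i ω)) μ)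
    (hlaw : ∀ i, μ.map (fun ω => (X i ω, Y i ω)) = P) :
    μ {ω | ¬ ‖expansionMap H (fun i => X i ω) (fun i => Y i ω)
            - empCov H (fun i => X i ω) f‖
          ≤ 3 / 4 * (M * √κ * (4 * D / √n * Real.log (6 / γ)))}
      ≤ ENNReal.ofReal (3 * γ) := by
  set L := Real.log (6 / γ) with hL
  have hL1 : 1 ≤ L := one_le_log_six_div hγ0 hγ1
  have hn0 : (0 : ℝ) < n := Nat.cast_pos.2 hn
  have hsn : 1 ≤ √(n : ℝ) := by
    rw [Real.one_le_sqrt]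
    exact_mod_cast hn
  have hsn2 : √(n : ℝ) * √n = n := Real.mul_self_sqrt hn0.le
  have hpair : ∀ i, Measurable fun ω => (X i ω, Y i ω) := fun i => (hX i).prodMk (hY i)
  have ha := measure_norm_sum_noise_ge_le hf hε (measurable_coe hmeas f) hM
    (stronglyMeasurable_feature hmeas) (b := √κ) (N := κ) (Real.sqrt_pos.2 hκ0) hκ0.le
    (norm_feature_le hκ) (by
      calc ∫⁻ x, ENNReal.ofReal (‖feature H x‖ ^ 2) ∂P.fst ≤ ∫⁻ _, ENNReal.ofReal κ ∂P.fst := by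
            refine lintegral_mono fun x => ENNReal.ofReal_le_ofReal ?_
            rw [norm_feature_sq]
            exact hκ x
        _ = ENNReal.ofReal κ := by simp)
    hpair hindep hlaw L
  refine le_trans (measure_mono ?_) (ha.trans (ENNReal.ofReal_le_ofReal
    ((two_mul_exp_mul_exp_neg_log_le hγ0).trans (by linarith))))
  intro ω hω
  rw [Set.mem_ofPred_eq] at hω ⊢
  by_contra hc
  rw [not_le] at hc
  refine hω ?_
  rw [expansionMap_sub_empCov, norm_smul, Real.norm_eq_abs,
    abs_of_pos (by positivity : (0 : ℝ) < 1 / n), one_div_mul_eq_div, div_le_iff₀ hn0]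
  refine hc.le.trans ?_
  have h1 : 3 / 4 * (M * √κ * (4 * D / √n * L)) * n = M * √κ * L * (3 * D * √n) := by
    have h2 : 0 < √(n : ℝ) := by linarith
    generalize √(n : ℝ) = w at hsn2 h2
    rw [← hsn2]
    field_simp
  rw [h1]
  calc (2 * (M * √κ) + M * √κ * √n) * L = M * √κ * L * (2 + √n) := by ring
    _ ≤ M * √κ * L * (3 * D * √n) := by
      gcongr
      nlinarith

end Probability

/-! ### The main theorem -/

section Main

variable {𝒳 : Type*} [MeasurableSpace 𝒳] {H : Type*} [NormedAddCommGroup H]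
  [InnerProductSpace ℝ H] [RKHS ℝ H 𝒳 ℝ] [CompleteSpace H] [TopologicalSpace.SeparableSpace H]
  {ν : Measure 𝒳} [IsProbabilityMeasure ν]

/-- The source condition provides a representative of the regression function in the reproducing
kernel Hilbert space. -/
theorem SourceCondition.exists_isSourceFunctional {κ r ρ : ℝ} {f : 𝒳 → ℝ}
    (hsrc : SourceCondition ν (kern H) κ r ρ f)
    (hmeas : Measurable (Function.uncurry (kern H (𝒳 := 𝒳)))) (hκ0 : 0 < κ)
    (hκ : ∀ x : 𝒳, kern H x x ≤ κ) (hr : 1 / 2 ≤ r) {T : H →L[ℝ] Lp ℝ 2 ν}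
    (hT : ∀ h, T h =ᵐ[ν] h) :
    0 ≤ ρ ∧ ∃ fH : H, f =ᵐ[ν] fH ∧ IsSourceFunctional T κ r ρ fH := by
  obtain ⟨u, g, hu, hg, hfg⟩ := hsrc
  rw [kernelOp_eq_comp_adjoint hmeas hκ hT] at hg
  obtain ⟨fH, hfH, hsf⟩ := exists_preimage_of_isOperatorPow hκ0
    (norm_inclusion_sq_le hT hκ) hr hg
  have hκr : 0 < κ ^ (-r) := Real.rpow_pos_of_pos hκ0 _
  refine ⟨nonneg_of_mul_nonneg_right ((norm_nonneg u).trans hu) hκr, fH, ?_, ?_⟩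
  · rw [← hfH] at hfg
    exact hfg.trans (hT fH)
  · intro j a b ha hb hab h
    refine (hsf j a b ha hb hab h).trans ?_
    gcongr

theorem eLpNorm_cgEstimator_sub_sq {f : 𝒳 → ℝ} {T : H →L[ℝ] Lp ℝ 2 ν} (hT : ∀ h, T h =ᵐ[ν] h)
    {fH : H} (hf : f =ᵐ[ν] fH) {n : ℕ} (x : Fin n → 𝒳) (y : Fin n → ℝ) (m : ℕ) :
    eLpNorm (fun t => cgEstimator H x y m t - f t) 2 ν ^ 2
      = ENNReal.ofReal (‖T (expansionMap H x (cgCoeff H x y m) - fH)‖ ^ 2) := by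
  have h1 : (fun t => cgEstimator H x y m t - f t)
      =ᵐ[ν] T (expansionMap H x (cgCoeff H x y m) - fH) := by
    filter_upwards [hf, hT (expansionMap H x (cgCoeff H x y m) - fH)] with t h2 h3
    rw [h3, h2, RKHS.coe_sub, Pi.sub_apply, coe_expansionMap]
    rfl
  rw [eLpNorm_congr_ae h1, ENNReal.ofReal_pow (norm_nonneg _), ofReal_norm,
    Lp.enorm_def]

/-- The deviation level `δ = 4 D log(6 / γ) / √n` in terms of `t = δ^(2 / (2 r + s))`. -/
theorem rpow_rates {r s δ : ℝ} (hr : 1 / 2 ≤ r) (hs : 0 ≤ s) (hδ : 0 < δ) :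
    (δ ^ (2 / (2 * r + s))) ^ (r + s / 2) = δ ∧
      √(δ ^ (2 / (2 * r + s))) * (δ ^ (2 / (2 * r + s))) ^ r = δ ^ ((2 * r + 1) / (2 * r + s)) ∧
      (δ ^ (2 / (2 * r + s))) ^ (2 * r) = (δ ^ 2) ^ (2 * r / (2 * r + s)) := by
  have h0 : 2 * r + s ≠ 0 := by linarith
  refine ⟨?_, ?_, ?_⟩
  · rw [← Real.rpow_mul hδ.le]
    have : 2 / (2 * r + s) * (r + s / 2) = 1 := by
      field_simp
    rw [this, Real.rpow_one]
  · rw [Real.sqrt_eq_rpow, ← Real.rpow_mul hδ.le, ← Real.rpow_mul hδ.le, ← Real.rpow_add hδ]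
    congr 1
    field_simp
    ring
  · rw [← Real.rpow_natCast, ← Real.rpow_mul hδ.le, ← Real.rpow_mul hδ.le]
    congr 1
    push_cast
    ring

end Main

end KernelCG

open KernelCG in
/-- Optimal rates for kernel conjugate gradient regression with discrepancy stopping. -/
theorem theorem2 (r τ' : ℝ) (hr : 1 / 2 ≤ r) (hτ' : 3 / 2 < τ') :
    ∃ c : ℝ, 0 < c ∧
      ∀ (𝒳 : Type*) [MeasurableSpace 𝒳]
        (H : Type*) [NormedAddCommGroup H] [InnerProductSpace ℝ H] [CompleteSpace H]
        [TopologicalSpace.SeparableSpace H] [RKHS ℝ H 𝒳 ℝ]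
        (P : Measure (𝒳 × ℝ)) [IsProbabilityMeasure P] (f : 𝒳 → ℝ)
        (κ M ρ s D γ : ℝ),
        -- the kernel is measurable and bounded
        Measurable (Function.uncurry (kern H (𝒳 := 𝒳))) →
        0 < κ → (∀ x, kern H x x ≤ κ) →
        -- the regression model, the noise, the source condition, the intrinsic dimensionality
        IsRegressionFunction P f →
        0 < M → BernsteinNoise P f M →
        SourceCondition P.fst (kern H) κ r ρ f →
        0 ≤ s → 1 ≤ D → IntrinsicDim P.fst (kern H) κ s D →
        0 < γ → γ < 1 →
        -- an i.i.d. sample from `P`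
        ∀ (n : ℕ), 0 < n →
        (s ≤ 1 ∨ 4 * D / √n * Real.log (6 / γ) ≤ 1) →
        ∀ (Ω : Type*) [MeasurableSpace Ω] (μ : Measure Ω) [IsProbabilityMeasure μ]
          (X : Fin n → Ω → 𝒳) (Y : Fin n → Ω → ℝ),
          (∀ i, Measurable (X i)) → (∀ i, Measurable (Y i)) →
          iIndepFun (fun i ω => (X i ω, Y i ω)) μ →
          (∀ i, μ.map (fun ω => (X i ω, Y i ω)) = P) →
          -- outside an event of probability at most `3 γ`
          μ {ω | ¬ ∃ m : ℕ,
              IsDiscrepancyStop H (fun i => X i ω) (fun i => Y i ω)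
                (τ' * M * √κ *
                  (4 * D / √n * Real.log (6 / γ)) ^ ((2 * r + 1) / (2 * r + s))) m ∧
              eLpNorm (fun x => cgEstimator H (fun i => X i ω) (fun i => Y i ω) m x - f x)
                  2 P.fst ^ 2 ≤
                ENNReal.ofReal (c * (M + ρ) ^ 2 *
                  (16 * D ^ 2 / n * Real.log (6 / γ) ^ 2) ^ (2 * r / (2 * r + s)))}
            ≤ ENNReal.ofReal (3 * γ) := by
  refine ⟨rateConst r τ', rateConst_pos r τ', ?_⟩
  intro 𝒳 _ H _ _ _ _ _ P _ f κ M ρ s D γ hmeas hκ0 hκ hreg hM hbern hsrc hs hD hdim hγ0 hγ1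
    n hn hcase Ω _ μ _ X Y hX hY hindep hlaw
  obtain ⟨T, hT⟩ := exists_inclusion P.fst hmeas hκ
  obtain ⟨hρ, fH, hfH, hsf⟩ := hsrc.exists_isSourceFunctional hmeas hκ0 hκ hr hT
  have hreg' := hreg.congr hfH
  have hbern' := hbern.congr hfH
  have hTκ := norm_inclusion_sq_le hT hκ
  have hn0 : (0 : ℝ) < n := Nat.cast_pos.2 hn
  have hL1 := one_le_log_six_div hγ0 hγ1
  set δ := 4 * D / √n * Real.log (6 / γ) with hδ
  have hδ0 : 0 < δ := by positivity
  set t := δ ^ (2 / (2 * r + s)) with ht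
  have ht0 : 0 < t := by positivity
  obtain ⟨hr1, hr2, hr3⟩ := rpow_rates hr hs hδ0
  rw [← ht] at hr1 hr2 hr3
  have hδ2 : 16 * D ^ 2 / n * Real.log (6 / γ) ^ 2 = δ ^ 2 := by
    rw [hδ, mul_pow, div_pow, Real.sq_sqrt hn0.le]
    ring
  set lam := κ * t with hlam
  have hlam0 : 0 < lam := by positivity
  have hlamt : lam / κ = t := by rw [hlam, mul_div_cancel_left₀ _ hκ0.ne']
  have hslam : M * √lam * (lam / κ) ^ r = M * √κ * δ ^ ((2 * r + 1) / (2 * r + s)) := by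
    rw [hlamt, ← hr2, hlam, Real.sqrt_mul hκ0.le]
    ring
  have hΛ : τ' * M * √κ * δ ^ ((2 * r + 1) / (2 * r + s))
      = τ' * (M * √lam * (lam / κ) ^ r) := by
    rw [hslam]
    ring
  rw [hδ2, hΛ, ← hr3, ← hlamt]
  have hexists : ∀ ω, ∃ m, IsDiscrepancyStop H (fun i => X i ω) (fun i => Y i ω)
      (τ' * (M * √lam * (lam / κ) ^ r)) m := fun ω =>
    exists_isDiscrepancyStop _ _ (by positivity)
  rcases le_or_gt δ 1 with hδ1 | hδ1
  · have hlamκ : lam ≤ κ := by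
      rw [hlam]
      refine mul_le_of_le_one_right hκ0.le ?_
      exact Real.rpow_le_one hδ0.le hδ1 (by positivity)
    refine le_trans (measure_mono fun ω hω => ?_)
      (measure_not_good_of_lam_le hmeas hκ0 hκ hT hreg' hM hbern' hr hs hD hdim hγ0 hγ1 hn hlam0
        hlamκ (by rw [hlamt]; exact hr1) hX hY hindep hlaw)
    intro hgood
    obtain ⟨m, hm⟩ := hexists ω
    refine hω ⟨m, hm, ?_⟩
    rw [eLpNorm_cgEstimator_sub_sq hT hfH]
    exact ENNReal.ofReal_le_ofReal (excess_le_of_lam_le hκ0 hTκ hr hρ hsf hτ'.le hlam0 hlamκ hM hm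
      hgood.1 hgood.2)
  · have hs1 : s ≤ 1 := hcase.resolve_right (not_le.2 hδ1)
    have hlamκ : κ ≤ lam := by
      rw [hlam]
      refine le_mul_of_one_le_right hκ0.le ?_
      exact Real.one_le_rpow hδ1.le (by positivity)
    refine le_trans (measure_mono fun ω hω => ?_)
      (measure_not_good_of_one_le hmeas hκ0 hκ hreg' hM hbern' hD hγ0 hγ1 hn hX hY hindep hlaw)
    intro hgood
    obtain ⟨m, hm⟩ := hexists ω
    refine hω ⟨m, hm, ?_⟩
    rw [eLpNorm_cgEstimator_sub_sq hT hfH]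
    refine ENNReal.ofReal_le_ofReal (excess_le_of_le_lam hκ0 hTκ hr hρ hsf hτ'.le hlamκ hM hm
      (hgood.trans ?_))
    rw [hslam]
    have h1 : δ ≤ δ ^ ((2 * r + 1) / (2 * r + s)) := by
      refine Real.self_le_rpow_of_one_le hδ1.le ?_
      rw [one_le_div (by linarith)]
      linarith
    gcongr
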